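/- \textbf{Conventions.} All vector spaces are over $\mathbb{Z}/2$, finite-dimensional and ungraded. A ground ring is a finite product $K=\prod_{i}\mathbb{Z}/2\,e_i$. A DG-algebra $A$ over a ground ring $K$ is a finite-dimensional unital differential algebra with a unit map $K\to A$ of differential algebras. Dually to $A$ as a bimodule over itself, $A^\vee$ is a type-$AA$ $A,A$-bimodule. A left $\mathcal{A}_\infty$-module ${}_AM$ has operations $m_{i|1}\colon A^{\otimes i}\otimes M\to M$; a type-$AD$ bimodule ${}_BX^A$ (type $A$ on the left over $B$, type $D$ on the right over $A$) has operations $\delta_{i|1}\colon B^{\otimes i}\otimes X\to X\otimes A$, with iteration $\overline\delta\colon B^{\otimes i}\otimes X\to X\otimes A^{\otimes k}$. Each satisfies the usual $\mathcal{A}_\infty$ structure equation, tensor products being over the ground rings; no strict unitality of modules is required. The dual of ${}_BX^A$ is a bimodule ${}^A(X^\vee)_B$. A square tensor product $P\boxtimes_A Q$ feeds the $A$-outputs of the type-$D$ factor into the $A$-inputs of the type-$A$ factor. It is called defined if the type-$D$ factor is relatively bounded in $A$ (for each number of inputs the number of outputs in $A$ of $\overline\delta$ is bounded) or the type-$A$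 factor is bounded in $A$ (only finitely many numbers of inputs from $A$ give nonzero operations). Morphisms of type-$AA$ bimodules $P\to Q$ over $B,B$ are all collections of maps $B^{\otimes i}\otimes P\otimes B^{\otimes j}\to Q$ (similarly for type $AD$, with values in $Q\otimes A$); they form complexes, homomorphisms are cycles, and morphisms are homotopic if they differ by a boundary. A homotopy equivalence is a homomorphism having an inverse homomorphism up to homotopy. For a left $\mathcal{A}_\infty$-module ${}_AM$ the join map $\nabla_M\colon M\otimes_{\mathbb{Z}/2} M^\vee\to A^\vee$ is the morphism of $A,A$-bimodules with $$\langle\nabla_{M}(a_1,\dots,a_i,\,p,q^\vee,\,a'_1,\dots,a'_j),a''\rangle=\langle m(a'_1,\dots,a'_j,a'',a_1,\dots,a_i,\,p),q^\vee\rangle .$$ \textbf{Proposition.} Let $A$ and $B$ be DG-algebras, and let ${}_BX^A$ and ${}_AY^B$ be type-$AD$ bimodules such that $Y\boxtimes X$ and $X\boxtimes Y$ are defined and there are homotopy equivalences of bimodules $${}_A(Y\boxtimes X)^A\simeq{}_A\mathbb{I}^A,\qquad {}_B(X\boxtimes Y)^B\simeq{}_B\mathbb{I}^B,$$ where ${}_A\mathbb{I}^A$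 is the identity bimodule: the ground ring, with only nonzero operation $\delta_{1|1}\colon A\otimes K\cong K\otimes A$. Suppose moreover that $H_*(B^\vee)$ and $H_*(X\boxtimes A^\vee\boxtimes X^\vee)$ have the same rank over $\mathbb{Z}/2$. Then there is a homotopy equivalence of type-$AA$ $B,B$-bimodules $$\varphi_X\colon X\boxtimes A^\vee\boxtimes X^\vee\to B^\vee$$ such that for every left $\mathcal{A}_\infty$-module ${}_AM$ for which $X\boxtimes M$ is defined, the morphisms $$\nabla_{X\boxtimes M}\quad\text{and}\quad \varphi_X\circ(\mathrm{id}_X\boxtimes\nabla_M\boxtimes\mathrm{id}_{X^\vee})\colon\; X\boxtimes M\otimes M^\vee\boxtimes X^\vee\to B^\vee$$ are homotopic, where $(X\boxtimes M)\otimes(X\boxtimes M)^\vee$ is identified with $X\boxtimes M\otimes M^\vee\boxtimes X^\vee$ in the canonical way. The equivalence $\varphi_X$ does not depend on $M$. -/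

import Mathlib

/-!
All vector spaces are over `ZMod 2`.  A ground ring with canonical basis indexed by a finite type
`ι` is `ι → ZMod 2`.  A finite-dimensional bimodule over two ground rings is the direct sum of its
components `e_i M e_j`, so it is described by a finite homogeneous basis (`gen`), each basis element
carrying its left and right idempotent.  Maps out of and into tensor products over ground rings are
described by their matrix coefficients on basis elements; a coefficient can only be nonzero on
composable strings of basis elements.  Elements of the bar collection of `A` are handled through
lists of basis elements of `A`, the length of the list being the bar index.
-/

open scoped BigOperators

noncomputable section

namespace Bordered

/-- `StringFrom l r i as j`: the string `as` is composable, starts at the idempotent `i` and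
ends at `j`. -/
def StringFrom {ι G : Type} (l r : G → ι) : ι → List G → ι → Prop
  | i, [], j => i = j
  | i, a :: as, j => l a = i ∧ StringFrom l r (r a) as j

/-- Kronecker delta in `ZMod 2`. -/
def kron {S : Type} (s t : S) : ZMod 2 := by
  classical exact if s = t then 1 else 0

/-! ### Bimodules over ground rings -/

/-- A finite-dimensional bimodule over the ground rings `ι → ZMod 2` and `κ → ZMod 2`, with
homogeneous basis `gen`: the basis element `g` lies in `e_{l g} · M · e_{r g}`. -/
structure Bimod (ι κ : Type) where
  gen : Type
  [fin : Fintype gen]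
  l : gen → ι
  r : gen → κ

attribute [instance] Bimod.fin

/-- The tensor product over the common ground ring. -/
def Bimod.tens {ι κ ν : Type} (M : Bimod ι κ) (N : Bimod κ ν) : Bimod ι ν where
  gen := {p : M.gen × N.gen // M.r p.1 = N.l p.2}
  fin := by classical infer_instance
  l p := M.l p.1.1
  r p := N.r p.1.2

/-- The dual bimodule, with the dual basis. -/
def Bimod.dual {ι κ : Type} (M : Bimod ι κ) : Bimod κ ι where
  gen := M.gen
  fin := M.fin
  l := M.r
  r := M.l

/-! ### Differential graded algebras -/

/-- A finite-dimensional (unital, ungraded) DG-algebra over the ground ring `ι → ZMod 2`.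
The family `e` is the image of the canonical basis under the unit map of the ground ring; it
determines the bimodule structure.  A homogeneous basis is part of the data; one always exists. -/
structure DGAlgebra (ι : Type) [Fintype ι] where
  carrier : Type
  [ring : Ring carrier]
  [algebra : Algebra (ZMod 2) carrier]
  d : carrier →ₗ[ZMod 2] carrier
  d_d : ∀ a, d (d a) = 0
  leibniz : ∀ a b, d (a * b) = d a * b + a * d b
  e : ι → carrier
  idem : CompleteOrthogonalIdempotents e
  d_e : ∀ i, d (e i) = 0
  gen : Type
  [fin : Fintype gen]
  basis : Module.Basis gen (ZMod 2) carrier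
  l : gen → ι
  r : gen → ι
  e_mul_basis : ∀ g, e (l g) * basis g = basis g
  basis_mul_e : ∀ g, basis g * e (r g) = basis g

attribute [instance] DGAlgebra.ring DGAlgebra.algebra DGAlgebra.fin

namespace DGAlgebra

variable {ι : Type} [Fintype ι] (A : DGAlgebra ι)

/-- The coefficient of `c` in the differential of `a`. -/
def dCoeff (a c : A.gen) : ZMod 2 := A.basis.repr (A.d (A.basis a)) c

/-- The coefficient of `c` in the product `a * b`. -/
def mulCoeff (a b c : A.gen) : ZMod 2 := A.basis.repr (A.basis a * A.basis b) c

/-- The coefficient of `c` in the idempotent `e i`. -/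
def unitCoeff (i : ι) (c : A.gen) : ZMod 2 := A.basis.repr (A.e i) c

/-- The bimodule underlying the algebra. -/
def toBimod : Bimod ι ι where
  gen := A.gen
  l := A.l
  r := A.r

/-- Precomposition of a functional on the bar of `A` with the bar differential: the sum over all
ways of differentiating one letter or multiplying two adjacent letters. -/
def barMu : (List A.gen → ZMod 2) → List A.gen → ZMod 2
  | _, [] => 0
  | F, [a] => ∑ c, A.dCoeff a c * F [c]
  | F, a :: b :: as =>
      ∑ c, A.dCoeff a c * F (c :: b :: as) + ∑ c, A.mulCoeff a b c * F (c :: as)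
        + barMu (fun w => F (a :: w)) (b :: as)

end DGAlgebra

/-! ### Left modules of type `A` -/

/-- The data of a left type-`A` module over `A`; `m as p q` is the coefficient of `q`
in `m_{i|1}(a_1, …, a_i, p)`. -/
structure LeftData {ι : Type} [Fintype ι] (A : DGAlgebra ι) extends Bimod ι Unit where
  m : List A.gen → gen → gen → ZMod 2

/-- The data `M` is an `A_∞`-module: `m` is a map over the ground ring and satisfies the structure
equation. -/
structure LeftData.IsModule {ι : Type} [Fintype ι] {A : DGAlgebra ι} (M : LeftData A) : Prop where
  supp : ∀ as p q, M.m as p q ≠ 0 → StringFrom A.l A.r (M.l q) as (M.l p)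
  struct : ∀ as p q,
    ∑ s ∈ Finset.range (as.length + 1), ∑ n, M.m (as.drop s) p n * M.m (as.take s) n q
      + A.barMu (fun w => M.m w p q) as = 0

/-- Boundedness: only finitely many `m_{i|1}` are nonzero. -/
def LeftData.Bounded {ι : Type} [Fintype ι] {A : DGAlgebra ι} (M : LeftData A) : Prop :=
  ∃ N : ℕ, ∀ as p q, N < as.length → M.m as p q = 0

/-! ### Bimodules of type `AA` -/

/-- The data of a type-`AA` bimodule; `m as p bs q` is the coefficient of `q`
in `m_{i|1|j}(a_1, …, a_i, p, b_1, …, b_j)`. -/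
structure AAData {ι κ : Type} [Fintype ι] [Fintype κ] (A : DGAlgebra ι) (B : DGAlgebra κ)
    extends Bimod ι κ where
  m : List A.gen → gen → List B.gen → gen → ZMod 2

namespace AAData

variable {ι κ : Type} [Fintype ι] [Fintype κ] {A : DGAlgebra ι} {B : DGAlgebra κ}

/-- The matrix coefficients of a morphism (not necessarily a cycle) of type-`AA` bimodules. -/
abbrev Mor (P Q : AAData A B) : Type :=
  List A.gen → P.gen → List B.gen → Q.gen → ZMod 2

/-- The coefficients describe maps over the ground rings. -/
def IsMor (P Q : AAData A B) (f : Mor P Q) : Prop :=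
  ∀ as p bs q, f as p bs q ≠ 0 →
    StringFrom A.l A.r (Q.l q) as (P.l p) ∧ StringFrom B.l B.r (P.r p) bs (Q.r q)

/-- Composition `g ∘ f`. -/
def comp {P Q R : AAData A B} (g : Mor Q R) (f : Mor P Q) : Mor P R := fun as p bs q =>
  ∑ s ∈ Finset.range (as.length + 1), ∑ t ∈ Finset.range (bs.length + 1), ∑ n,
    f (as.drop s) p (bs.take t) n * g (as.take s) n (bs.drop t) q

/-- The identity morphism. -/
def ident (P : AAData A B) : Mor P P := fun as p bs q => kron as [] * kron bs [] * kron p q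

/-- The differential of a morphism. -/
def diff (P Q : AAData A B) (f : Mor P Q) : Mor P Q := fun as p bs q =>
  comp (P := P) (Q := P) (R := Q) f P.m as p bs q
    + comp (P := P) (Q := Q) (R := Q) Q.m f as p bs q
    + A.barMu (fun w => f w p bs q) as + B.barMu (fun w => f as p w q) bs

/-- A homomorphism is a morphism that is a cycle. -/
def IsHom (P Q : AAData A B) (f : Mor P Q) : Prop :=
  IsMor P Q f ∧ diff P Q f = 0

/-- Two morphisms are homotopic if their sum is a boundary. -/
def Homotopic (P Q : AAData A B) (f g : Mor P Q) : Prop :=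
  ∃ H : Mor P Q, IsMor P Q H ∧ diff P Q H = f + g

/-- A homotopy equivalence of type-`AA` bimodules. -/
def IsHomotopyEquiv (P Q : AAData A B) (f : Mor P Q) : Prop :=
  IsHom P Q f ∧ ∃ g : Mor Q P, IsHom Q P g ∧
    Homotopic P P (comp g f) (ident P) ∧ Homotopic Q Q (comp f g) (ident Q)

/-- The differential `m_{0|1|0}` of the underlying chain complex. -/
def chainD (P : AAData A B) : (P.gen → ZMod 2) →ₗ[ZMod 2] (P.gen → ZMod 2) :=
  Matrix.mulVecLin (Matrix.of fun q p => P.m [] p [] q)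

/-- The rank over `ZMod 2` of the homology (cycles modulo boundaries) of the underlying complex. -/
def homologyRank (P : AAData A B) : ℕ :=
  Module.finrank (ZMod 2)
    (LinearMap.ker P.chainD ⧸ (LinearMap.range P.chainD).comap (LinearMap.ker P.chainD).subtype)

/-- The dual of a type-`AA` bimodule (rotation by 180 degrees). -/
def dual (P : AAData A B) : AAData B A where
  toBimod := P.toBimod.dual
  m bs q as p := P.m as p bs q

/-- The algebra as a bimodule over itself. -/
def ofAlgebra (A : DGAlgebra ι) : AAData A A where
  toBimod := A.toBimod
  m as p bs q :=
    match as, bs with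
    | [], [] => A.dCoeff p q
    | [a], [] => A.mulCoeff a p q
    | [], [b] => A.mulCoeff p b q
    | _, _ => 0

end AAData

/-- The type-`AA` bimodule `M ⊗ M^∨`, where `M^∨` is the dual right module. -/
def LeftData.tensDual {ι : Type} [Fintype ι] {A : DGAlgebra ι} (M : LeftData A) : AAData A A where
  toBimod := M.toBimod.tens M.toBimod.dual
  m as p bs q :=
    kron bs [] * kron p.1.2 q.1.2 * M.m as p.1.1 q.1.1
      + kron as [] * kron p.1.1 q.1.1 * M.m bs q.1.2 p.1.2

/-- The algebraic join map `∇_M : M ⊗ M^∨ → A^∨`: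
`⟨∇(a_1, …, a_i, p, q^∨, a'_1, …, a'_j), a''⟩ = ⟨m(a'_1, …, a'_j, a'', a_1, …, a_i, p), q^∨⟩`. -/
def LeftData.nabla {ι : Type} [Fintype ι] {A : DGAlgebra ι} (M : LeftData A) :
    AAData.Mor M.tensDual (AAData.ofAlgebra A).dual :=
  fun as p bs (c : A.gen) => M.m ((bs : List A.gen) ++ c :: as) p.1.1 p.1.2

/-! ### Bimodules of type `DA` and of type `AD` -/

/-- The data of a bimodule of type `A` on the left over `B` and type `D` on the right over `A`;
`δ bs x y a` is the coefficient of `y ⊗ a` in `δ(b_1, …, b_i, x)`. -/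
structure ADData {κ ι : Type} [Fintype κ] [Fintype ι] (B : DGAlgebra κ) (A : DGAlgebra ι)
    extends Bimod κ ι where
  δ : List B.gen → gen → gen → A.gen → ZMod 2

/-- The data of a bimodule of type `D` on the left over `A` and type `A` on the right over `B`;
`δ x bs a y` is the coefficient of `a ⊗ y` in `δ(x, b_1, …, b_i)`. -/
structure DAData {ι κ : Type} [Fintype ι] [Fintype κ] (A : DGAlgebra ι) (B : DGAlgebra κ)
    extends Bimod ι κ where
  δ : gen → List B.gen → A.gen → gen → ZMod 2

/-- The iterated structure map `X ⊗ Bar B → Bar A ⊗ X`. -/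
def DAData.deltaBar {ι κ : Type} [Fintype ι] [Fintype κ] {A : DGAlgebra ι} {B : DGAlgebra κ}
    (Z : DAData A B) : Z.gen → List B.gen → List A.gen → Z.gen → ZMod 2
  | x, bs, [], y => kron bs [] * kron x y
  | x, bs, a :: as, y => ∑ s ∈ Finset.range (bs.length + 1), ∑ n,
      Z.δ x (bs.take s) a n * Z.deltaBar n (bs.drop s) as y

namespace ADData

variable {κ ι ν : Type} [Fintype κ] [Fintype ι] [Fintype ν]
  {B : DGAlgebra κ} {A : DGAlgebra ι} {C : DGAlgebra ν}

/-- The matrix coefficients of a morphism of type-`AD` bimodules. -/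
abbrev Mor (X Z : ADData B A) : Type := List B.gen → X.gen → Z.gen → A.gen → ZMod 2

/-- The coefficients describe maps over the ground rings. -/
def IsMor (X Z : ADData B A) (f : Mor X Z) : Prop :=
  ∀ bs x z a, f bs x z a ≠ 0 →
    StringFrom B.l B.r (Z.l z) bs (X.l x) ∧ Z.r z = A.l a ∧ A.r a = X.r x

/-- Composition `g ∘ f`: the outputs of `g` and `f` in `A` are multiplied, in this order. -/
def comp {X Z W : ADData B A} (g : Mor Z W) (f : Mor X Z) : Mor X W := fun bs x w a =>
  ∑ s ∈ Finset.range (bs.length + 1), ∑ n, ∑ a₁, ∑ a₂,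
    f (bs.drop s) x n a₂ * g (bs.take s) n w a₁ * A.mulCoeff a₁ a₂ a

/-- The sum of the terms in which only the differential of `A` and the bar differential of `B`
are applied to `f`. -/
def innerDiff {X Z : ADData B A} (f : Mor X Z) : Mor X Z := fun bs x z a =>
  ∑ a₁, f bs x z a₁ * A.dCoeff a₁ a + B.barMu (fun w => f w x z a) bs

/-- The data `X` is a type-`AD` bimodule: `δ` is a map over the ground rings and satisfies the
structure equation. -/
def IsBimodule (X : ADData B A) : Prop :=
  IsMor X X X.δ ∧ comp (X := X) (Z := X) (W := X) X.δ X.δ + innerDiff (X := X) (Z := X) X.δ = 0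

/-- The identity morphism `x ↦ x ⊗ 1`. -/
def ident (X : ADData B A) : Mor X X := fun bs x y a =>
  kron bs [] * kron x y * A.unitCoeff (X.r x) a

/-- The differential of a morphism. -/
def diff (X Z : ADData B A) (f : Mor X Z) : Mor X Z :=
  comp (X := X) (Z := X) (W := Z) f X.δ + comp (X := X) (Z := Z) (W := Z) Z.δ f
    + innerDiff (X := X) (Z := Z) f

/-- A homomorphism is a morphism that is a cycle. -/
def IsHom (X Z : ADData B A) (f : Mor X Z) : Prop :=
  IsMor X Z f ∧ diff X Z f = 0

/-- Two morphisms are homotopic if their sum is a boundary. -/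
def Homotopic (X Z : ADData B A) (f g : Mor X Z) : Prop :=
  ∃ H : Mor X Z, IsMor X Z H ∧ diff X Z H = f + g

/-- There is a homotopy equivalence between the two type-`AD` bimodules. -/
def HomotopyEquivalent (X Z : ADData B A) : Prop :=
  ∃ (f : Mor X Z) (g : Mor Z X), IsHom X Z f ∧ IsHom Z X g ∧
    Homotopic X X (comp (X := X) (Z := Z) (W := X) g f) (ident X) ∧
    Homotopic Z Z (comp (X := Z) (Z := X) (W := Z) f g) (ident Z)

/-- The iterated structure map `Bar B ⊗ X → X ⊗ Bar A`. -/
def deltaBar (X : ADData B A) : List B.gen → X.gen → X.gen → List A.gen → ZMod 2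
  | bs, x, y, [] => kron bs [] * kron x y
  | bs, x, y, a :: as => ∑ s ∈ Finset.range (bs.length + 1), ∑ n,
      X.deltaBar (bs.drop s) x n as * X.δ (bs.take s) n y a

/-- The identity bimodule: its underlying bimodule is the ground ring and its only nonzero
operation is `δ(a, e) = e' ⊗ a`. -/
def identity (A : DGAlgebra ι) : ADData A A where
  gen := ι
  l := id
  r := id
  δ bs x y a :=
    match bs with
    | [b] => kron b a * kron (A.l a) y * kron (A.r a) x
    | _ => 0

/-- The dual type-`DA` bimodule (rotation by 180 degrees). -/
def dual (X : ADData B A) : DAData A B where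
  toBimod := X.toBimod.dual
  δ y bs a x := X.δ bs x y a

/-- Relative boundedness in the `D`-side algebra `A` with respect to the `A`-side algebra `B`:
for each number of inputs from `B`, the number of outputs in `A` is bounded. -/
def RelBoundedD (X : ADData B A) : Prop :=
  ∀ k : ℕ, ∃ N : ℕ, ∀ bs x y as, bs.length = k → N < as.length → X.deltaBar bs x y as = 0

/-- Boundedness in the `A`-side algebra: only finitely many components of `δ` are nonzero. -/
def BoundedA (X : ADData B A) : Prop :=
  ∃ N : ℕ, ∀ bs x y a, N < bs.length → X.δ bs x y a = 0

/-- The square tensor product of two type-`AD` bimodules is defined. -/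
def BoxDefined (X : ADData B A) (Y : ADData A C) : Prop := X.RelBoundedD ∨ Y.BoundedA

/-- The square tensor product of a type-`AD` bimodule and a left module is defined. -/
def BoxLeftDefined (X : ADData B A) (M : LeftData A) : Prop := X.RelBoundedD ∨ M.Bounded

/-- The square tensor product of two type-`AD` bimodules. The sum runs over all strings in `A`; it
is finite when the product is defined. -/
def box (X : ADData B A) (Y : ADData A C) : ADData B C where
  toBimod := X.toBimod.tens Y.toBimod
  δ bs p q c := ∑ᶠ as : List A.gen, X.deltaBar bs p.1.1 q.1.1 as * Y.δ as p.1.2 q.1.2 c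

/-- The square tensor product `X ⊠ M` with a left module. -/
def boxLeft (X : ADData B A) (M : LeftData A) : LeftData B where
  toBimod := X.toBimod.tens M.toBimod
  m bs p q := ∑ᶠ as : List A.gen, X.deltaBar bs p.1.1 q.1.1 as * M.m as p.1.2 q.1.2

/-- The square tensor product `X ⊠ P` with a type-`AA` bimodule. -/
def boxAA (X : ADData B A) (P : AAData A C) : AAData B C where
  toBimod := X.toBimod.tens P.toBimod
  m bs p cs q := ∑ᶠ as : List A.gen, X.deltaBar bs p.1.1 q.1.1 as * P.m as p.1.2 cs q.1.2

/-- The induced morphism `id_X ⊠ f`. -/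
def idBox (X : ADData B A) {P Q : AAData A C} (f : AAData.Mor P Q) :
    AAData.Mor (X.boxAA P) (X.boxAA Q) := fun bs p cs q =>
  ∑ᶠ as : List A.gen, X.deltaBar bs p.1.1 q.1.1 as * f as p.1.2 cs q.1.2

end ADData

namespace AAData

variable {κ ι ν : Type} [Fintype κ] [Fintype ι] [Fintype ν]
  {B : DGAlgebra κ} {A : DGAlgebra ι} {C : DGAlgebra ν}

/-- The square tensor product `P ⊠ Z` of a type-`AA` and a type-`DA` bimodule. -/
def boxDA (P : AAData C A) (Z : DAData A B) : AAData C B where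
  toBimod := P.toBimod.tens Z.toBimod
  m cs p bs q := ∑ᶠ as : List A.gen, P.m cs p.1.1 as q.1.1 * Z.deltaBar p.1.2 bs as q.1.2

/-- The induced morphism `f ⊠ id_Z`. -/
def boxId {P Q : AAData C A} (f : Mor P Q) (Z : DAData A B) :
    Mor (P.boxDA Z) (Q.boxDA Z) := fun cs p bs q =>
  ∑ᶠ as : List A.gen, f cs p.1.1 as q.1.1 * Z.deltaBar p.1.2 bs as q.1.2

end AAData

namespace ADData

variable {κ ι : Type} [Fintype κ] [Fintype ι] {B : DGAlgebra κ} {A : DGAlgebra ι}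

/-- `X ⊠ P ⊠ X^∨`. -/
def conj (X : ADData B A) (P : AAData A A) : AAData B B := (X.boxAA P).boxDA X.dual

/-- `id_X ⊠ f ⊠ id_{X^∨}`. -/
def conjMor (X : ADData B A) {P Q : AAData A A} (f : AAData.Mor P Q) :
    AAData.Mor (X.conj P) (X.conj Q) :=
  AAData.boxId (P := X.boxAA P) (Q := X.boxAA Q) (X.idBox f) X.dual

/-- The canonical identification of `X ⊠ M ⊗ M^∨ ⊠ X^∨` with `(X ⊠ M) ⊗ (X ⊠ M)^∨`, given on
basis elements by `((x, (p, q)), y) ↦ ((x, p), (y, q))`. -/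
def regroup (X : ADData B A) (M : LeftData A) :
    (X.conj M.tensDual).gen ≃ (X.boxLeft M).tensDual.gen where
  toFun g := ⟨(⟨(g.1.1.1.1, g.1.1.1.2.1.1), g.1.1.2⟩, ⟨(g.1.2, g.1.1.1.2.1.2), g.2.symm⟩), rfl⟩
  invFun h := ⟨(⟨(h.1.1.1.1, ⟨(h.1.1.1.2, h.1.2.1.2), rfl⟩), h.1.1.2⟩, h.1.2.1.1), h.1.2.2.symm⟩
  left_inv _ := rfl
  right_inv _ := rfl

/-- The join map of `X ⊠ M`, with source written as `X ⊠ M ⊗ M^∨ ⊠ X^∨`. -/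
def nablaBox (X : ADData B A) (M : LeftData A) :
    AAData.Mor (X.conj M.tensDual) (AAData.ofAlgebra B).dual :=
  fun bs g bs' c => (X.boxLeft M).nabla bs (X.regroup M g) bs' c

end ADData

end Bordered

end

/-! The operations of `X` with a fixed input word form a matrix over `A` indexed by the generators
of `X`. In these terms the structure equation says that `δ` is a twisting cochain on the bar
construction of `B`: the sum of `δ(u) δ(v)` over all cuts of a word, plus `d δ`, plus `δ`
precomposed with the bar differential, is zero. Functionals on `X ⊠ A^∨ ⊠ X^∨` are matrices of the
same kind, and the transposed bimodule operations become `z ↦ d z`, `z ↦ z δ(as)` and `z ↦ δ(bs) z`.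

The map `φ_X` is `joinMor`: its value on `as`, `x ⊗ a^∨ ⊗ y^∨`, `bs` has as `c`-coefficient the
coefficient of `y ⊗ a` in `δ(bs, c, as, x)`. The twisting equation on a word with a marked letter
`c` is precisely the cycle equation for `φ_X` (`diff_eq_zero_of_twisting`).

Compatibility with join maps holds on the nose (`nablaBox_eq`). When the iterated structure map is
applied to `bs, c, as`, exactly one output `a` consumes `c`. That output is the argument `a''` of
`∇_M`; the outputs before it come from `X^∨`, those after it from `X`.

It remains to see that `φ_X` is an equivalence. Since the homologies have equal rank, surjectivity
on homology suffices (`joinMor_surjective`). If a class is missed, some functional kills all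
boundaries and the image of all cycles, but not that class. Such a functional is a cycle `w` of `B`
whose action on `X` is null-homotopic, say by `U`. Then `U ⊠ id_Y` makes `w` act null-homotopically
on `X ⊠ Y` (`exists_box_null_homotopy`). As `X ⊠ Y` is equivalent to the identity bimodule, on which
`w` can be read off from its action, `w` is a boundary (`exists_d_eq_of_null_homotopy`) and pairs to
zero with every cycle of `B^∨`, a contradiction.

Finally, a quasi-isomorphism is a homotopy equivalence: the acyclic mapping cone has a linear
contraction over the ground rings, the differential of this contraction is the identity plus terms
with inputs, and a geometric series inverts it (`exists_diff_eq_ident`). The blocks of the resulting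
contraction of the cone are the inverse and the two homotopies. -/

open scoped BigOperators

noncomputable section

namespace Bordered

/-! ### Sums over the splittings of a word -/

section SplitSum

variable {G : Type*} {V W : Type*} [AddCommMonoid V] [AddCommMonoid W]

/-- The sum of `φ u v` over all ways of writing `w = u ++ v`. -/
def splitSum (w : List G) (φ : List G → List G → V) : V :=
  ∑ s ∈ Finset.range (w.length + 1), φ (w.take s) (w.drop s)

@[simp] theorem splitSum_nil (φ : List G → List G → V) : splitSum [] φ = φ [] [] := by
  simp [splitSum]

theorem splitSum_cons (a : G) (w : List G) (φ : List G → List G → V) :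
    splitSum (a :: w) φ = φ [] (a :: w) + splitSum w (fun u v => φ (a :: u) v) := by
  rw [splitSum, List.length_cons, Finset.sum_range_succ', add_comm]
  simp [splitSum]

theorem splitSum_congr {w : List G} {φ ψ : List G → List G → V}
    (h : ∀ u v, u ++ v = w → φ u v = ψ u v) : splitSum w φ = splitSum w ψ :=
  Finset.sum_congr rfl fun s _ => h _ _ (List.take_append_drop s w)

theorem splitSum_eq_zero {w : List G} {φ : List G → List G → V}
    (h : ∀ u v, u ++ v = w → φ u v = 0) : splitSum w φ = 0 :=
  Finset.sum_eq_zero fun s _ => h _ _ (List.take_append_drop s w)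

@[simp] theorem splitSum_zero (w : List G) : splitSum w (fun _ _ => (0 : V)) = 0 :=
  splitSum_eq_zero fun _ _ _ => rfl

theorem splitSum_add (w : List G) (φ ψ : List G → List G → V) :
    splitSum w (fun u v => φ u v + ψ u v) = splitSum w φ + splitSum w ψ :=
  Finset.sum_add_distrib

theorem splitSum_sum {α : Type*} (t : Finset α) (w : List G) (φ : α → List G → List G → V) :
    splitSum w (fun u v => ∑ c ∈ t, φ c u v) = ∑ c ∈ t, splitSum w (φ c) :=
  Finset.sum_comm

theorem splitSum_comm {H : Type*} (w : List G) (w' : List H)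
    (φ : List G → List G → List H → List H → V) :
    splitSum w (fun u v => splitSum w' (fun u' v' => φ u v u' v'))
      = splitSum w' (fun u' v' => splitSum w (fun u v => φ u v u' v')) :=
  Finset.sum_comm

theorem map_splitSum {F : Type*} [FunLike F V W] [AddMonoidHomClass F V W] (f : F)
    (w : List G) (φ : List G → List G → V) :
    f (splitSum w φ) = splitSum w (fun u v => f (φ u v)) :=
  map_sum f _ _

theorem splitSum_apply {α : Type*} {Z : α → Type*} [∀ x, AddCommMonoid (Z x)] (w : List G)
    (φ : List G → List G → ∀ x, Z x) (x : α) :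
    splitSum w φ x = splitSum w (fun u v => φ u v x) :=
  Finset.sum_apply _ _ _

theorem splitSum_mul {R : Type*} [NonUnitalNonAssocSemiring R] (w : List G)
    (φ : List G → List G → R) (x : R) :
    splitSum w φ * x = splitSum w (fun u v => φ u v * x) :=
  Finset.sum_mul _ _ _

theorem mul_splitSum {R : Type*} [NonUnitalNonAssocSemiring R] (w : List G)
    (φ : List G → List G → R) (x : R) :
    x * splitSum w φ = splitSum w (fun u v => x * φ u v) :=
  Finset.mul_sum _ _ _

/-- Coassociativity of deconcatenation: both sides run over the ways to cut `w` into three pieces.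
-/
theorem splitSum_assoc (w : List G) (φ : List G → List G → List G → V) :
    splitSum w (fun u v => splitSum u (fun u₁ u₂ => φ u₁ u₂ v))
      = splitSum w (fun u v => splitSum v (fun v₁ v₂ => φ u v₁ v₂)) := by
  induction w generalizing φ with
  | nil => simp
  | cons a w ih =>
    simp only [splitSum_cons, splitSum_nil, splitSum_add]
    rw [ih (fun u v x => φ (a :: u) v x), add_assoc]

/-- The cut falls either before or after the marked letter `c`. This dichotomy is later what
separates the left from the right action in the cycle equation for `φ_X`. -/
theorem splitSum_append_cons (u : List G) (c : G) (v : List G) (φ : List G → List G → V) :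
    splitSum (u ++ c :: v) φ = splitSum u (fun u₁ u₂ => φ u₁ (u₂ ++ c :: v))
      + splitSum v (fun v₁ v₂ => φ (u ++ c :: v₁) v₂) := by
  induction u generalizing φ with
  | nil => simp [splitSum_cons]
  | cons a u ih => simp [splitSum_cons, ih, add_assoc]

/-- Only the splitting with empty first part contributes. -/
theorem splitSum_eq_left (w : List G) (φ : List G → List G → V)
    (h : ∀ a u v, φ (a :: u) v = 0) : splitSum w φ = φ [] w := by
  cases w with
  | nil => simp
  | cons a w => simp [splitSum_cons, h]

/-- Only the splitting with empty second part contributes. -/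
theorem splitSum_eq_right (w : List G) (φ : List G → List G → V)
    (h : ∀ u a v, φ u (a :: v) = 0) : splitSum w φ = φ w [] := by
  induction w generalizing φ with
  | nil => simp
  | cons a w ih => rw [splitSum_cons, h, zero_add, ih _ fun u b v => h _ _ _]

end SplitSum

/-! ### Formal series in noncommuting variables -/

/-- Formal series with coefficients in `R` in noncommuting variables indexed by `G`. -/
def Series (G R : Type*) : Type _ := List G → R

namespace Series

variable {G R : Type*} [Ring R]

instance : AddCommGroup (Series G R) := inferInstanceAs (AddCommGroup (List G → R))

instance : Mul (Series G R) := ⟨fun F H w => splitSum w fun u v => F u * H v⟩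

instance : One (Series G R) := ⟨fun w => match w with
  | [] => 1
  | _ :: _ => 0⟩

theorem mul_apply (F H : Series G R) (w : List G) :
    (F * H) w = splitSum w fun u v => F u * H v := rfl

theorem add_apply (F H : Series G R) (w : List G) : (F + H) w = F w + H w := rfl

theorem zero_apply (w : List G) : (0 : Series G R) w = 0 := rfl

@[simp] theorem one_nil : (1 : Series G R) [] = 1 := rfl

@[simp] theorem one_cons (a : G) (w : List G) : (1 : Series G R) (a :: w) = 0 := rfl

instance : Ring (Series G R) where
  __ := (inferInstance : AddCommGroup (Series G R))
  left_distrib F H K := by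
    funext w
    simp only [mul_apply, add_apply, mul_add, splitSum_add]
  right_distrib F H K := by
    funext w
    simp only [mul_apply, add_apply, add_mul, splitSum_add]
  zero_mul F := by
    funext w
    simp [mul_apply, zero_apply]
  mul_zero F := by
    funext w
    simp [mul_apply, zero_apply]
  mul_assoc F H K := by
    funext w
    simp only [mul_apply, splitSum_mul, mul_splitSum, mul_assoc]
    exact splitSum_assoc w fun u v x => F u * (H v * K x)
  one_mul F := by
    funext w
    rw [mul_apply, splitSum_eq_left _ _ (by simp)]
    simp
  mul_one F := by
    funext w
    rw [mul_apply, splitSum_eq_right _ _ (by simp)]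
    simp

end Series

/-! ### The bar differential with general coefficients -/

namespace DGAlgebra

variable {ι : Type} [Fintype ι] (A : DGAlgebra ι)

section Lin

variable {V W : Type*} [AddCommGroup V] [Module (ZMod 2) V] [AddCommGroup W] [Module (ZMod 2) W]

/-- The linear extension of a function on the basis. -/
def lin (f : A.gen → V) : A.carrier →ₗ[ZMod 2] V := A.basis.constr (ZMod 2) f

theorem lin_eq (f : A.gen → V) (x : A.carrier) : A.lin f x = ∑ c, A.basis.repr x c • f c :=
  A.basis.constr_apply_fintype _ _ _

@[simp] theorem lin_basis (f : A.gen → V) (a : A.gen) : A.lin f (A.basis a) = f a :=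
  A.basis.constr_basis _ _ _

theorem lin_comp (f : A.gen → V) (T : A.carrier →ₗ[ZMod 2] A.carrier) (x : A.carrier) :
    A.lin (fun c => A.lin f (T (A.basis c))) x = A.lin f (T x) := by
  have : A.lin (fun c => A.lin f (T (A.basis c))) = A.lin f ∘ₗ T :=
    A.basis.ext fun c => by simp
  rw [this, LinearMap.comp_apply]

theorem lin_lin_mul_left (f : A.gen → V) (y x : A.carrier) :
    A.lin (fun c => A.lin f (y * A.basis c)) x = A.lin f (y * x) :=
  A.lin_comp f (LinearMap.mulLeft (ZMod 2) y) x

theorem lin_lin_mul_right (f : A.gen → V) (y x : A.carrier) :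
    A.lin (fun c => A.lin f (A.basis c * y)) x = A.lin f (x * y) :=
  A.lin_comp f (LinearMap.mulRight (ZMod 2) y) x

theorem lin_add (f g : A.gen → V) (x : A.carrier) :
    A.lin (fun c => f c + g c) x = A.lin f x + A.lin g x := by
  simp [lin_eq, Finset.sum_add_distrib]

theorem lin_map (f : A.gen → V) (T : V →ₗ[ZMod 2] W) (x : A.carrier) :
    T (A.lin f x) = A.lin (fun c => T (f c)) x := by
  simp [lin_eq]

/-- Precomposition of a vector-valued function with the bar differential. -/
def barDiff : (List A.gen → V) → List A.gen → V
  | _, [] => 0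
  | F, [a] => A.lin (fun c => F [c]) (A.d (A.basis a))
  | F, a :: b :: as =>
      A.lin (fun c => F (c :: b :: as)) (A.d (A.basis a))
        + A.lin (fun c => F (c :: as)) (A.basis a * A.basis b)
        + barDiff (fun w => F (a :: w)) (b :: as)

/-- The part of the bar differential multiplying a given letter into a word. -/
def mulHead (F : List A.gen → V) (a : A.gen) : List A.gen → V
  | [] => 0
  | b :: as => A.lin (fun c => F (c :: as)) (A.basis a * A.basis b)

@[simp] theorem barDiff_nil (F : List A.gen → V) : A.barDiff F [] = 0 := by
  rw [barDiff]

theorem barDiff_cons (F : List A.gen → V) (a : A.gen) (w : List A.gen) :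
    A.barDiff F (a :: w) = A.lin (fun c => F (c :: w)) (A.d (A.basis a)) + A.mulHead F a w
      + A.barDiff (fun w => F (a :: w)) w := by
  cases w <;> simp [barDiff, mulHead]

theorem barDiff_add (F H : List A.gen → V) (w : List A.gen) :
    A.barDiff (fun w => F w + H w) w = A.barDiff F w + A.barDiff H w := by
  induction w generalizing F H with
  | nil => simp
  | cons a w ih =>
    have h1 : ∀ w, A.mulHead (fun w => F w + H w) a w = A.mulHead F a w + A.mulHead H a w := by
      rintro (_ | ⟨b, w⟩) <;> simp [mulHead, lin_add]
    rw [barDiff_cons, barDiff_cons, barDiff_cons, h1, ih, lin_add]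
    abel

theorem map_barDiff (T : V →ₗ[ZMod 2] W) (F : List A.gen → V) (w : List A.gen) :
    T (A.barDiff F w) = A.barDiff (fun w => T (F w)) w := by
  induction w generalizing F with
  | nil => simp
  | cons a w ih =>
    rw [barDiff_cons, barDiff_cons, map_add, map_add, ih, lin_map]
    cases w <;> simp [mulHead, lin_map]

theorem barDiff_zero (w : List A.gen) : A.barDiff (fun _ => (0 : V)) w = 0 := by
  simpa using (A.map_barDiff (0 : V →ₗ[ZMod 2] V) (fun _ => 0) w).symm

/-- Lets the scalar operator of the definitions be replaced by a vector-valued one, which can be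
applied to matrix-valued cochains. -/
theorem barMu_eq (F : List A.gen → ZMod 2) (w : List A.gen) : A.barMu F w = A.barDiff F w := by
  induction w generalizing F with
  | nil => simp [barMu]
  | cons a w ih =>
    rw [barDiff_cons]
    cases w with
    | nil => simp [barMu, mulHead, lin_eq, dCoeff]
    | cons b w => simp [barMu, mulHead, ih, lin_eq, dCoeff, mulCoeff]

/-- The bar differential is a coderivation: a cut of a modified word comes from a unique cut of `w`
with the modified letters all on one side. It is the source of every Leibniz rule below. -/
theorem barDiff_splitSum (φ : List A.gen → List A.gen → V) (w : List A.gen) :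
    A.barDiff (fun w => splitSum w φ) w
      = splitSum w (fun u v => A.barDiff (fun u => φ u v) u)
        + splitSum w (fun u v => A.barDiff (fun v => φ u v) v) := by
  induction w generalizing φ with
  | nil => simp
  | cons a w ih =>
    have hmul : A.mulHead (fun w => splitSum w φ) a w
        = A.mulHead (φ []) a w + splitSum w (fun u v => A.mulHead (fun u => φ u v) a u) := by
      cases w with
      | nil => simp [mulHead]
      | cons b w =>
        simp only [mulHead, splitSum_cons, lin_eq, smul_add, Finset.sum_add_distrib, zero_add,
          splitSum_sum]
        simp only [splitSum, Finset.smul_sum]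
    have hlin : A.lin (fun c => splitSum (c :: w) φ) (A.d (A.basis a))
        = A.lin (fun c => φ [] (c :: w)) (A.d (A.basis a))
          + splitSum w (fun u v => A.lin (fun c => φ (c :: u) v) (A.d (A.basis a))) := by
      simp only [splitSum_cons, lin_eq, smul_add, Finset.sum_add_distrib, splitSum_sum]
      simp only [splitSum, Finset.smul_sum]
    have hbar : A.barDiff (fun w => splitSum (a :: w) φ) w
        = A.barDiff (fun w => φ [] (a :: w)) w
          + A.barDiff (fun w => splitSum w (fun u v => φ (a :: u) v)) w := by
      simp only [splitSum_cons]
      exact A.barDiff_add (fun w => φ [] (a :: w))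
        (fun w => splitSum w (fun u v => φ (a :: u) v)) w
    rw [barDiff_cons, hmul, hlin, hbar, ih]
    simp only [splitSum_cons, barDiff_nil, barDiff_cons, splitSum_add]
    abel

/-- For fixed `x` the linear extension evaluated at `x` is linear in the function extended, so it
commutes with the bar differential in the other letters. -/
theorem barDiff_lin (F : A.gen → List A.gen → V) (x : A.carrier) (w : List A.gen) :
    A.barDiff (fun w => A.lin (fun c => F c w) x) w = A.lin (fun c => A.barDiff (F c) w) x := by
  have h1 := A.map_barDiff
    ((LinearMap.applyₗ x).comp (A.basis.constr (M' := V) (ZMod 2)).toLinearMap)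
    (fun w c => F c w) w
  have h2 : A.barDiff (fun w c => F c w) w = fun c => A.barDiff (F c) w := by
    funext c
    exact A.map_barDiff (LinearMap.proj c) (fun w c => F c w) w
  rw [h2] at h1
  exact h1.symm

/-- Terms cancel in pairs in characteristic two, by `d ∘ d = 0`, the Leibniz rule and associativity
of the algebra. -/
theorem barDiff_barDiff (F : List A.gen → V) (w : List A.gen) :
    A.barDiff (A.barDiff F) w = 0 := by
  induction w generalizing F with
  | nil => simp
  | cons a w ih =>
    have h1 : A.barDiff (fun w => A.barDiff F (a :: w)) w
        = A.lin (fun c => A.barDiff (fun w => F (c :: w)) w) (A.d (A.basis a))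
          + A.barDiff (A.mulHead F a) w := by
      simp only [barDiff_cons]
      rw [barDiff_add, barDiff_add, barDiff_lin, ih, add_zero]
    have h2 : A.lin (fun c => A.barDiff F (c :: w)) (A.d (A.basis a))
        = A.lin (fun c => A.mulHead F c w) (A.d (A.basis a))
          + A.lin (fun c => A.barDiff (fun w => F (c :: w)) w) (A.d (A.basis a)) := by
      simp only [barDiff_cons, lin_add]
      rw [A.lin_comp (fun c => F (c :: w)) A.d, d_d, map_zero, zero_add]
    rw [barDiff_cons, h1, h2]
    -- Differentiating `a` and modifying the tail in either order gives the same term twice. What is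
    -- left involves multiplying `a` into the next letter.
    suffices h : A.lin (fun c => A.mulHead F c w) (A.d (A.basis a))
        + A.mulHead (A.barDiff F) a w + A.barDiff (A.mulHead F a) w = 0 by
      rw [← h]
      have := ZModModule.add_self
        (A.lin (fun c => A.barDiff (fun w => F (c :: w)) w) (A.d (A.basis a)))
      rw [← add_zero (_ + _ + A.barDiff (A.mulHead F a) w), ← this]
      abel
    cases w with
    | nil => simp [mulHead, lin_eq]
    | cons b w =>
      have h3 : A.mulHead (A.barDiff F) a (b :: w)
          = A.lin (fun c => F (c :: w)) (A.d (A.basis a * A.basis b))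
            + A.lin (fun c => A.mulHead F c w) (A.basis a * A.basis b)
            + A.lin (fun c => A.barDiff (fun w => F (c :: w)) w) (A.basis a * A.basis b) := by
        simp only [mulHead, barDiff_cons, lin_add]
        rw [A.lin_comp (fun c => F (c :: w)) A.d]
      have h4 : A.barDiff (A.mulHead F a) (b :: w)
          = A.lin (fun c => F (c :: w)) (A.basis a * A.d (A.basis b))
            + A.mulHead (A.mulHead F a) b w
            + A.lin (fun c => A.barDiff (fun w => F (c :: w)) w) (A.basis a * A.basis b) := by
        rw [barDiff_cons]
        simp only [mulHead, barDiff_lin]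
        rw [A.lin_lin_mul_left (fun c => F (c :: w))]
      have h5 : A.lin (fun c => A.mulHead F c (b :: w)) (A.d (A.basis a))
          = A.lin (fun c => F (c :: w)) (A.d (A.basis a) * A.basis b) := by
        simp only [mulHead]
        exact A.lin_lin_mul_right (fun c => F (c :: w)) _ _
      have h6 : A.mulHead (A.mulHead F a) b w
          = A.lin (fun c => A.mulHead F c w) (A.basis a * A.basis b) := by
        cases w with
        | nil => simp [mulHead, lin_eq]
        | cons b' w =>
          simp only [mulHead]
          rw [A.lin_lin_mul_left (fun c => F (c :: w)),
            A.lin_lin_mul_right (fun c => F (c :: w)), mul_assoc]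
      rw [h3, h4, h5, h6, leibniz, map_add]
      generalize A.lin (fun c => F (c :: w)) (A.d (A.basis a) * A.basis b) = p
      generalize A.lin (fun c => F (c :: w)) (A.basis a * A.d (A.basis b)) = q
      generalize A.lin (fun c => A.mulHead F c w) (A.basis a * A.basis b) = r
      generalize A.lin (fun c => A.barDiff (fun w => F (c :: w)) w) (A.basis a * A.basis b) = s
      rw [show p + (p + q + r + s) + (q + r + s) = (p + p) + (q + q) + (r + r) + (s + s) by abel]
      simp only [ZModModule.add_self]

end Lin

end DGAlgebra

/-! ### Support of structure constants -/

theorem kron_self {S : Type} (s : S) : kron s s = 1 := by simp [kron]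

theorem kron_of_ne {S : Type} {s t : S} (h : s ≠ t) : kron s t = 0 := by simp [kron, h]

theorem kron_comm {S : Type} (s t : S) : kron s t = kron t s := by
  by_cases h : s = t
  · rw [h]
  · rw [kron_of_ne h, kron_of_ne (Ne.symm h)]

theorem eq_of_kron_ne_zero {S : Type} {s t : S} (h : kron s t ≠ 0) : s = t := by
  by_contra h'
  exact h (kron_of_ne h')

@[simp] theorem kron_nil_nil {G : Type} : kron ([] : List G) [] = 1 := kron_self _

@[simp] theorem kron_cons_nil {G : Type} (a : G) (w : List G) : kron (a :: w) [] = 0 :=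
  kron_of_ne (by simp)

theorem sum_kron_mul {S : Type} [Fintype S] (s : S) (f : S → ZMod 2) :
    ∑ t, kron s t * f t = f s := by
  classical
  simp [kron]

theorem sum_kron_mul' {S : Type} [Fintype S] (s : S) (f : S → ZMod 2) :
    ∑ t, kron t s * f t = f s := by
  simp only [kron_comm _ s, sum_kron_mul]

theorem stringFrom_append {ι G : Type} {l r : G → ι} {u v : List G} {i j : ι} :
    StringFrom l r i (u ++ v) j ↔ ∃ k, StringFrom l r i u k ∧ StringFrom l r k v j := by
  induction u generalizing i with
  | nil => simp [StringFrom]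
  | cons a u ih => simp [StringFrom, ih, and_assoc]

namespace DGAlgebra

variable {ι : Type} [Fintype ι] (A : DGAlgebra ι)

theorem repr_e_mul (x : A.carrier) (i : ι) (c : A.gen) :
    A.basis.repr (A.e i * x) c = kron (A.l c) i * A.basis.repr x c := by
  have h : ∀ g, A.e i * A.basis g = kron (A.l g) i • A.basis g := by
    intro g
    by_cases hg : A.l g = i
    · subst hg
      simp [kron_self, A.e_mul_basis]
    · rw [kron_of_ne hg, zero_smul, ← A.e_mul_basis g, ← mul_assoc, A.idem.ortho (Ne.symm hg),
        zero_mul]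
  conv_lhs => rw [← A.basis.sum_repr x]
  classical
  simp only [Finset.mul_sum, mul_smul_comm, h, map_sum, map_smul, Finsupp.coe_finsetSum,
    Finset.sum_apply, Finsupp.smul_apply, A.basis.repr_self, Finsupp.single_apply, smul_eq_mul]
  rw [Finset.sum_eq_single c] <;> simp +contextual [mul_comm]

theorem repr_mul_e (x : A.carrier) (i : ι) (c : A.gen) :
    A.basis.repr (x * A.e i) c = kron (A.r c) i * A.basis.repr x c := by
  have h : ∀ g, A.basis g * A.e i = kron (A.r g) i • A.basis g := by
    intro g
    by_cases hg : A.r g = i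
    · subst hg
      simp [kron_self, A.basis_mul_e]
    · rw [kron_of_ne hg, zero_smul, ← A.basis_mul_e g, mul_assoc, A.idem.ortho hg,
        mul_zero]
  conv_lhs => rw [← A.basis.sum_repr x]
  classical
  simp only [Finset.sum_mul, smul_mul_assoc, h, map_sum, map_smul, Finsupp.coe_finsetSum,
    Finset.sum_apply, Finsupp.smul_apply, A.basis.repr_self, Finsupp.single_apply, smul_eq_mul]
  rw [Finset.sum_eq_single c] <;> simp +contextual [mul_comm]

/-- Since `d` kills the idempotents, the Leibniz rule gives `d(e a) = e d(a)` and `d(a e) = d(a) e`.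
-/
theorem dCoeff_ne_zero {a c : A.gen} (h : A.dCoeff a c ≠ 0) : A.l a = A.l c ∧ A.r a = A.r c := by
  constructor
  · have h1 : A.d (A.basis a) = A.e (A.l a) * A.d (A.basis a) := by
      conv_lhs => rw [← A.e_mul_basis a, A.leibniz, A.d_e, zero_mul, zero_add]
    rw [dCoeff, h1, repr_e_mul] at h
    exact (eq_of_kron_ne_zero (left_ne_zero_of_mul h)).symm
  · have h1 : A.d (A.basis a) = A.d (A.basis a) * A.e (A.r a) := by
      conv_lhs => rw [← A.basis_mul_e a, A.leibniz, A.d_e, mul_zero, add_zero]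
    rw [dCoeff, h1, repr_mul_e] at h
    exact (eq_of_kron_ne_zero (left_ne_zero_of_mul h)).symm

theorem mulCoeff_ne_zero {a b c : A.gen} (h : A.mulCoeff a b c ≠ 0) :
    A.l a = A.l c ∧ A.r a = A.l b ∧ A.r b = A.r c := by
  refine ⟨?_, ?_, ?_⟩
  · rw [mulCoeff, ← A.e_mul_basis a, mul_assoc, repr_e_mul] at h
    exact (eq_of_kron_ne_zero (left_ne_zero_of_mul h)).symm
  · by_contra hab
    apply h
    rw [mulCoeff, ← A.basis_mul_e a, mul_assoc, ← A.e_mul_basis b, ← mul_assoc (A.e _),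
      A.idem.ortho hab]
    simp
  · rw [mulCoeff, ← A.basis_mul_e b, ← mul_assoc, repr_mul_e] at h
    exact (eq_of_kron_ne_zero (left_ne_zero_of_mul h)).symm

/-- Differentiating a letter or multiplying two neighbours preserves the outer idempotents, and a
composable result can only come from a composable word. -/
theorem stringFrom_of_barMu_ne_zero {F : List A.gen → ZMod 2} {i j : ι}
    (hF : ∀ w, F w ≠ 0 → StringFrom A.l A.r i w j) {w : List A.gen} (hw : A.barMu F w ≠ 0) :
    StringFrom A.l A.r i w j := by
  rw [barMu_eq] at hw
  induction w generalizing F i with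
  | nil => simp at hw
  | cons a w ih =>
    contrapose! hw
    have h1 : A.lin (fun c => F (c :: w)) (A.d (A.basis a)) = 0 := by
      rw [lin_eq]
      refine Finset.sum_eq_zero fun c _ => ?_
      by_contra h
      obtain ⟨h2, h3⟩ := A.dCoeff_ne_zero (left_ne_zero_of_mul h)
      obtain ⟨h4, h5⟩ := hF _ (right_ne_zero_of_mul h)
      exact hw ⟨h2.trans h4, h3 ▸ h5⟩
    have h2 : A.mulHead F a w = 0 := by
      cases w with
      | nil => rfl
      | cons b w =>
        rw [mulHead, lin_eq]
        refine Finset.sum_eq_zero fun c _ => ?_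
        by_contra h
        obtain ⟨h2, h3, h4⟩ := A.mulCoeff_ne_zero (left_ne_zero_of_mul h)
        obtain ⟨h5, h6⟩ := hF _ (right_ne_zero_of_mul h)
        exact hw ⟨h2.trans h5, h3.symm, h4 ▸ h6⟩
    rw [barDiff_cons, h1, h2, zero_add, zero_add]
    by_contra h
    by_cases hi : A.l a = i
    · exact hw ⟨hi, ih (fun v hv => (hF (a :: v) hv).2) h⟩
    · have : (fun v => F (a :: v)) = fun _ => 0 := by
        funext v
        by_contra hv
        exact hi (hF (a :: v) hv).1
      rw [this, barDiff_zero] at h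
      exact h rfl

end DGAlgebra

/-! ### The differential ring of matrices over series in two sets of variables -/

/-- Write `∂x = m x + x m + D x`, a derivation of square zero by the Maurer–Cartan equation `mc`.
The element `U = ∂h` is a cycle, hence so is its right inverse `K`, and `∂(h K) = U K + h ∂K = 1`.
-/
theorem exists_null_homotopy {R : Type*} [Ring R] (two : ∀ x : R, x + x = 0) (D : R →+ R)
    (leib : ∀ x y, D (x * y) = D x * y + x * D y) (sq : ∀ x, D (D x) = 0) {m h K : R}
    (mc : m * m + D m = 0) (hK : (m * h + h * m + D h) * K = 1)
    (inj : ∀ x, (m * h + h * m + D h) * x = 0 → x = 0) :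
    m * (h * K) + h * K * m + D (h * K) = 1 := by
  have D1 : D 1 = 0 := by
    have := leib 1 1
    rwa [mul_one, mul_one, one_mul, two] at this
  have hU : m * (m * h + h * m + D h) + (m * h + h * m + D h) * m + D (m * h + h * m + D h)
      = 0 := by
    rw [map_add, map_add, leib, leib, sq, add_zero]
    calc _ = (m * m + D m) * h + h * (m * m + D m) + (m * h * m + m * h * m)
          + (m * D h + m * D h) + (D h * m + D h * m) := by noncomm_ring
      _ = 0 := by simp [mc, two]
  set U := m * h + h * m + D h with hU'
  -- Applying `∂` to `U K = 1` gives `U ∂K = 0`, and `U` is left-cancellable.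
  have hKc : m * K + K * m + D K = 0 := by
    apply inj
    have h1 := leib U K
    rw [hK, D1] at h1
    calc U * (m * K + K * m + D K)
        = (U * m * K + U * K * m + (D U * K + U * D K)) + D U * K - (D U * K + D U * K)
            + (D U * K) - D U * K := by noncomm_ring
      _ = (m * U + U * m + D U) * K - m * (U * K) + U * K * m + (D U * K + U * D K)
            - (D U * K + D U * K) + D U * K - D U * K := by noncomm_ring
      _ = 0 := by rw [hU, ← h1, two, hK]; simp
  calc m * (h * K) + h * K * m + D (h * K)
      = U * K + h * (m * K + K * m + D K) - (h * (m * K) + h * (m * K)) := by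
        rw [leib, hU']; noncomm_ring
    _ = 1 := by rw [hKc, two, hK]; simp

section BiSeries

variable {ι κ : Type} [Fintype ι] [Fintype κ] (A : DGAlgebra ι) (B : DGAlgebra κ)

/-- Formal series in the variables of `A` and, with reversed multiplication, of `B`. -/
abbrev BiSeries : Type := Series A.gen (Series B.gen (ZMod 2))ᵐᵒᵖ

variable {A B}

/-- The coefficient of a series. -/
def BiSeries.coeff (F : BiSeries A B) (as : List A.gen) (bs : List B.gen) : ZMod 2 :=
  (F as).unop bs

/-- The series with given coefficients. -/
def BiSeries.mk (f : List A.gen → List B.gen → ZMod 2) : BiSeries A B :=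
  fun as => MulOpposite.op (f as)

@[simp] theorem BiSeries.coeff_mk (f : List A.gen → List B.gen → ZMod 2) (as : List A.gen)
    (bs : List B.gen) : (BiSeries.mk f).coeff as bs = f as bs := rfl

theorem BiSeries.ext {F H : BiSeries A B} (h : ∀ as bs, F.coeff as bs = H.coeff as bs) :
    F = H := by
  funext as
  exact MulOpposite.unop_injective (funext fun bs => h as bs)

theorem BiSeries.coeff_add (F H : BiSeries A B) (as : List A.gen) (bs : List B.gen) :
    (F + H).coeff as bs = F.coeff as bs + H.coeff as bs := rfl

theorem BiSeries.coeff_zero (as : List A.gen) (bs : List B.gen) :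
    (0 : BiSeries A B).coeff as bs = 0 := rfl

theorem BiSeries.coeff_one (as : List A.gen) (bs : List B.gen) :
    (1 : BiSeries A B).coeff as bs = kron as [] * kron bs [] := by
  cases as <;> cases bs <;> simp [BiSeries.coeff]
  all_goals rfl

theorem BiSeries.coeff_sum {α : Type*} (t : Finset α) (F : α → BiSeries A B) (as : List A.gen)
    (bs : List B.gen) : (∑ i ∈ t, F i).coeff as bs = ∑ i ∈ t, (F i).coeff as bs := by
  classical
  induction t using Finset.induction_on with
  | empty => rfl
  | insert i t hi ih => rw [Finset.sum_insert hi, Finset.sum_insert hi, coeff_add, ih]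

/-- The left factor takes the outer letters: an initial piece on the `A` side but a final piece on
the `B` side. This is why the coefficient ring is opposite, and it is the cutting pattern of
composition of morphisms. -/
theorem BiSeries.coeff_mul (F H : BiSeries A B) (as : List A.gen) (bs : List B.gen) :
    (F * H).coeff as bs
      = splitSum as fun u v => splitSum bs fun p q => H.coeff v p * F.coeff u q := by
  have h : ∀ x y : (Series B.gen (ZMod 2))ᵐᵒᵖ, (x + y).unop bs = x.unop bs + y.unop bs :=
    fun _ _ => rfl
  let T : (Series B.gen (ZMod 2))ᵐᵒᵖ →+ ZMod 2 :=
    { toFun := fun x => x.unop bs, map_zero' := rfl, map_add' := h }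
  exact map_splitSum T as fun u v => F u * H v

/-- The differential induced by the bar differentials. -/
def BiSeries.D (F : BiSeries A B) : BiSeries A B :=
  BiSeries.mk fun as bs =>
    A.barDiff (fun w => F.coeff w bs) as + B.barDiff (fun w => F.coeff as w) bs

theorem BiSeries.D_add (F H : BiSeries A B) : (F + H).D = F.D + H.D := by
  refine BiSeries.ext fun as bs => ?_
  simp only [D, coeff_mk, coeff_add, DGAlgebra.barDiff_add]
  abel

theorem barDiff_mul_const (F : List A.gen → ZMod 2) (x : ZMod 2) (w : List A.gen) :
    A.barDiff (fun w => F w * x) w = A.barDiff F w * x :=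
  (A.map_barDiff (LinearMap.mulRight (ZMod 2) x) F w).symm

theorem barDiff_const_mul (F : List A.gen → ZMod 2) (x : ZMod 2) (w : List A.gen) :
    A.barDiff (fun w => x * F w) w = x * A.barDiff F w :=
  (A.map_barDiff (LinearMap.mulLeft (ZMod 2) x) F w).symm

theorem barDiff_sum {α : Type*} (t : Finset α) (F : α → List A.gen → ZMod 2) (w : List A.gen) :
    A.barDiff (fun w => ∑ i ∈ t, F i w) w = ∑ i ∈ t, A.barDiff (F i) w := by
  classical
  induction t using Finset.induction_on with
  | empty => simp [A.barDiff_zero]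
  | insert i t hi ih => simp only [Finset.sum_insert hi, A.barDiff_add, ih]

theorem barDiff_splitSum_const {G : Type*} (t : List G) (F : List G → List G → List A.gen → ZMod 2)
    (w : List A.gen) :
    A.barDiff (fun w => splitSum t fun u v => F u v w) w
      = splitSum t fun u v => A.barDiff (F u v) w :=
  barDiff_sum _ _ _

theorem BiSeries.D_mul (F H : BiSeries A B) : (F * H).D = F.D * H + F * H.D := by
  refine BiSeries.ext fun as bs => ?_
  simp only [D, coeff_mk, coeff_add, coeff_mul, A.barDiff_splitSum, barDiff_splitSum_const,
    B.barDiff_splitSum, barDiff_mul_const, barDiff_const_mul, mul_add, add_mul, splitSum_add]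
  abel

theorem barDiff_barDiff_comm (f : List A.gen → List B.gen → ZMod 2) (as : List A.gen)
    (bs : List B.gen) :
    A.barDiff (fun u => B.barDiff (f u) bs) as
      = B.barDiff (fun v => A.barDiff (fun u => f u v) as) bs := by
  have h1 := A.map_barDiff (V := List B.gen → ZMod 2) (W := ZMod 2)
    { toFun := fun F => B.barDiff F bs
      map_add' := fun F H => B.barDiff_add F H bs
      map_smul' := fun x F => barDiff_const_mul F x bs } f as
  have h2 : A.barDiff f as = fun v => A.barDiff (fun u => f u v) as := by
    funext v
    exact A.map_barDiff (LinearMap.proj v) f as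
  rw [h2] at h1
  exact h1.symm

theorem BiSeries.D_D (F : BiSeries A B) : F.D.D = 0 := by
  refine BiSeries.ext fun as bs => ?_
  simp only [D, coeff_mk, coeff_zero, A.barDiff_add, B.barDiff_add]
  rw [show A.barDiff (fun w => A.barDiff (fun w => F.coeff w bs) w) as = 0 from
      A.barDiff_barDiff _ _,
    show B.barDiff (fun w => B.barDiff (fun w => F.coeff as w) w) bs = 0 from
      B.barDiff_barDiff _ _, zero_add, add_zero, barDiff_barDiff_comm]
  exact ZModModule.add_self _

theorem BiSeries.add_self (F : BiSeries A B) : F + F = 0 :=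
  BiSeries.ext fun as bs => ZModModule.add_self (F.coeff as bs)

end BiSeries

namespace AAData

variable {ι κ : Type} [Fintype ι] [Fintype κ] {A : DGAlgebra ι} {B : DGAlgebra κ}

/-! ### Morphisms as matrices of series -/

/-- The operations of `P` are maps over the ground rings and satisfy the structure equation. -/
def IsBimodule (P : AAData A B) : Prop :=
  IsMor P P P.m ∧ ∀ as p bs q,
    comp (P := P) (Q := P) (R := P) P.m P.m as p bs q
      + A.barMu (fun w => P.m w p bs q) as + B.barMu (fun w => P.m as p w q) bs = 0

theorem comp_eq {P Q R : AAData A B} (g : Mor Q R) (f : Mor P Q) (as : List A.gen) (p : P.gen)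
    (bs : List B.gen) (q : R.gen) :
    comp g f as p bs q
      = ∑ n, splitSum as fun u v => splitSum bs fun u' v' => f v p u' n * g u n v' q := by
  rw [← splitSum_sum]
  refine Finset.sum_congr rfl fun s _ => ?_
  exact splitSum_sum Finset.univ bs fun n u' v' =>
    f (as.drop s) p u' n * g (as.take s) n v' q

/-- The matrix of series of a morphism. -/
def toMatrix {P Q : AAData A B} (f : Mor P Q) : Matrix Q.gen P.gen (BiSeries A B) :=
  fun q p => BiSeries.mk fun as bs => f as p bs q

theorem coeff_toMatrix {P Q : AAData A B} (f : Mor P Q) (as : List A.gen) (p : P.gen)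
    (bs : List B.gen) (q : Q.gen) : (toMatrix f q p).coeff as bs = f as p bs q := rfl

theorem toMatrix_mul {P Q R : AAData A B} (g : Mor Q R) (f : Mor P Q) :
    toMatrix g * toMatrix f = toMatrix (comp g f) := by
  ext q p
  refine BiSeries.ext fun as bs => ?_
  rw [Matrix.mul_apply, BiSeries.coeff_sum, coeff_toMatrix, comp_eq]
  simp only [BiSeries.coeff_mul, coeff_toMatrix]

theorem toMatrix_inj {P Q : AAData A B} {f g : Mor P Q} (h : toMatrix f = toMatrix g) :
    f = g := by
  funext as p bs q
  rw [← coeff_toMatrix f, h, coeff_toMatrix]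

/-- The entrywise differential. -/
def matrixD (n : Type) : Matrix n n (BiSeries A B) →+ Matrix n n (BiSeries A B) :=
  (AddMonoidHom.mk' BiSeries.D BiSeries.D_add).mapMatrix

theorem matrixD_apply {n : Type} (M : Matrix n n (BiSeries A B)) (i j : n) :
    matrixD n M i j = (M i j).D := rfl

theorem matrixD_mul {n : Type} [Fintype n] (M N : Matrix n n (BiSeries A B)) :
    matrixD n (M * N) = matrixD n M * N + M * matrixD n N := by
  ext i j
  have : AddMonoidHom.mk' BiSeries.D BiSeries.D_add (∑ k, M i k * N k j)
      = ∑ k, (M i k).D * N k j + ∑ k, M i k * (N k j).D := by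
    rw [map_sum, ← Finset.sum_add_distrib]
    exact Finset.sum_congr rfl fun k _ => BiSeries.D_mul _ _
  exact this

/-- Identifies the morphism complex of endomorphisms with a matrix ring under a twisted
differential, so that `exists_null_homotopy` applies. -/
theorem toMatrix_diff {P : AAData A B} (f : Mor P P) :
    toMatrix (diff P P f) = toMatrix (P := P) (Q := P) P.m * toMatrix f
      + toMatrix f * toMatrix (P := P) (Q := P) P.m + matrixD P.gen (toMatrix f) := by
  rw [toMatrix_mul, toMatrix_mul]
  ext q p
  refine BiSeries.ext fun as bs => ?_
  simp only [Matrix.add_apply, BiSeries.coeff_add, coeff_toMatrix, diff, DGAlgebra.barMu_eq]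
  simp only [matrixD_apply, BiSeries.D, BiSeries.coeff_mk, coeff_toMatrix]
  abel

theorem IsMor.comp {P Q R : AAData A B} {g : Mor Q R} {f : Mor P Q} (hg : IsMor Q R g)
    (hf : IsMor P Q f) : IsMor P R (comp g f) := by
  intro as p bs q h
  obtain ⟨s, -, h⟩ := Finset.exists_ne_zero_of_sum_ne_zero h
  obtain ⟨t, -, h⟩ := Finset.exists_ne_zero_of_sum_ne_zero h
  obtain ⟨n, -, h⟩ := Finset.exists_ne_zero_of_sum_ne_zero h
  obtain ⟨h1, h2⟩ := hf _ _ _ _ (left_ne_zero_of_mul h)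
  obtain ⟨h3, h4⟩ := hg _ _ _ _ (right_ne_zero_of_mul h)
  rw [← List.take_append_drop s as, ← List.take_append_drop t bs]
  exact ⟨stringFrom_append.2 ⟨_, h3, h1⟩, stringFrom_append.2 ⟨_, h2, h4⟩⟩

theorem IsMor.add {P Q : AAData A B} {f g : Mor P Q} (hf : IsMor P Q f) (hg : IsMor P Q g) :
    IsMor P Q (f + g) := by
  intro as p bs q h
  by_cases h1 : f as p bs q = 0
  · refine hg as p bs q fun h2 => h ?_
    simp [h1, h2]
  · exact hf as p bs q h1

theorem isMor_ident (P : AAData A B) : IsMor P P (ident P) := by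
  intro as p bs q h
  have h1 := eq_of_kron_ne_zero (left_ne_zero_of_mul (left_ne_zero_of_mul h))
  have h2 := eq_of_kron_ne_zero (right_ne_zero_of_mul (left_ne_zero_of_mul h))
  have h3 := eq_of_kron_ne_zero (right_ne_zero_of_mul h)
  subst h1 h2 h3
  exact ⟨rfl, rfl⟩

theorem IsMor.diff {P Q : AAData A B} {f : Mor P Q} (hP : IsMor P P P.m) (hQ : IsMor Q Q Q.m)
    (hf : IsMor P Q f) : IsMor P Q (diff P Q f) := by
  have hA : IsMor P Q fun as p bs q => A.barMu (fun w => f w p bs q) as := by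
    intro as p bs q h
    refine ⟨A.stringFrom_of_barMu_ne_zero (fun w hw => (hf _ _ _ _ hw).1) h, ?_⟩
    by_contra h'
    have : (fun w => f w p bs q) = fun _ => 0 := by
      funext w
      by_contra hw
      exact h' (hf _ _ _ _ hw).2
    exact h (by beta_reduce; rw [this, A.barMu_eq, A.barDiff_zero])
  have hB : IsMor P Q fun as p bs q => B.barMu (fun w => f as p w q) bs := by
    intro as p bs q h
    refine ⟨?_, B.stringFrom_of_barMu_ne_zero (fun w hw => (hf _ _ _ _ hw).2) h⟩
    by_contra h'
    have : (fun w => f as p w q) = fun _ => 0 := by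
      funext w
      by_contra hw
      exact h' (hf _ _ _ _ hw).1
    exact h (by beta_reduce; rw [this, B.barMu_eq, B.barDiff_zero])
  exact (((hf.comp hP).add (hQ.comp hf)).add hA).add hB

/-! ### Contractions -/

/-- All coefficients on words of total length less than `k` vanish. -/
def VanishBelow {n m : Type} (k : ℕ) (M : Matrix n m (BiSeries A B)) : Prop :=
  ∀ i j as bs, as.length + bs.length < k → (M i j).coeff as bs = 0

theorem VanishBelow.mul {n : Type} [Fintype n] {k l : ℕ} {M N : Matrix n n (BiSeries A B)}
    (hM : VanishBelow k M) (hN : VanishBelow l N) : VanishBelow (k + l) (M * N) := by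
  intro i j as bs h
  rw [Matrix.mul_apply, BiSeries.coeff_sum]
  refine Finset.sum_eq_zero fun x _ => ?_
  rw [BiSeries.coeff_mul]
  refine splitSum_eq_zero fun u v huv => splitSum_eq_zero fun u' v' huv' => ?_
  subst huv huv'
  simp only [List.length_append] at h
  by_cases h1 : u.length + v'.length < k
  · rw [hM _ _ _ _ h1, mul_zero]
  · rw [hN _ _ _ _ (by omega), zero_mul]

theorem vanishBelow_zero {n m : Type} (M : Matrix n m (BiSeries A B)) : VanishBelow 0 M :=
  fun _ _ _ _ h => absurd h (Nat.not_lt_zero _)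

theorem VanishBelow.pow {n : Type} [Fintype n] [DecidableEq n] {N : Matrix n n (BiSeries A B)}
    (hN : VanishBelow 1 N) (k : ℕ) : VanishBelow k (N ^ k) := by
  induction k with
  | zero => exact vanishBelow_zero _
  | succ k ih => rw [pow_succ]; exact ih.mul hN

theorem matrix_coeff_add {n m : Type} (M N : Matrix n m (BiSeries A B)) (i : n) (j : m)
    (as : List A.gen) (bs : List B.gen) :
    ((M + N) i j).coeff as bs = (M i j).coeff as bs + (N i j).coeff as bs := rfl

theorem matrix_coeff_sum {n m α : Type} (t : Finset α) (M : α → Matrix n m (BiSeries A B)) (i : n)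
    (j : m) (as : List A.gen) (bs : List B.gen) :
    ((∑ k ∈ t, M k) i j).coeff as bs = ∑ k ∈ t, (M k i j).coeff as bs := by
  rw [Matrix.sum_apply, BiSeries.coeff_sum]

/-- The geometric series of a matrix without constant term. -/
def geomSeries {n : Type} [Fintype n] [DecidableEq n] (N : Matrix n n (BiSeries A B)) :
    Matrix n n (BiSeries A B) := fun i j => BiSeries.mk fun as bs =>
  ∑ k ∈ Finset.range (as.length + bs.length + 1), ((N ^ k) i j).coeff as bs

/-- Powers of `N` vanish on ever longer words, so each coefficient of the series is a finite sum and
may be compared with a partial geometric sum. -/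
theorem one_sub_mul_geomSeries {n : Type} [Fintype n] [DecidableEq n]
    {N : Matrix n n (BiSeries A B)} (hN : VanishBelow 1 N) : (1 - N) * geomSeries N = 1 := by
  ext i j
  refine BiSeries.ext fun as bs => ?_
  -- One more than the total length of the words: both `N ^ l` and the tail of the series vanish
  -- there.
  set l := as.length + bs.length + 1 with hl
  have h1 : VanishBelow l (geomSeries N - ∑ k ∈ Finset.range l, N ^ k) := by
    intro i j u v huv
    rw [sub_eq_add_neg, matrix_coeff_add]
    have h2 : ((geomSeries N) i j).coeff u v
        = ((∑ k ∈ Finset.range l, N ^ k : Matrix n n (BiSeries A B)) i j).coeff u v := by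
      rw [matrix_coeff_sum, geomSeries, BiSeries.coeff_mk]
      refine Finset.sum_subset (fun k hk => ?_) fun k _ hk => ?_
      · simp only [Finset.mem_range] at hk ⊢
        omega
      · simp only [Finset.mem_range] at hk
        exact hN.pow k _ _ _ _ (by omega)
    rw [h2]
    exact add_neg_cancel _
  have h3 := (vanishBelow_zero (1 - N)).mul h1
  have h4 : (1 - N) * geomSeries N
      = (1 - N) * (geomSeries N - ∑ k ∈ Finset.range l, N ^ k) + (1 + -N ^ l) := by
    rw [← sub_eq_add_neg, ← mul_neg_geom_sum]
    noncomm_ring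
  have h5 : ((-N ^ l) i j).coeff as bs = 0 := by
    have := hN.pow l i j as bs (by omega)
    change -((N ^ l) i j).coeff as bs = 0
    rw [this, neg_zero]
  rw [h4, matrix_coeff_add, matrix_coeff_add, h5, h3 i j as bs (by omega), zero_add, add_zero]

/-- A bimodule whose underlying complex has a contraction over the ground rings is
contractible. -/
theorem exists_diff_eq_ident {P : AAData A B} (hP : IsBimodule P) (h : P.gen → P.gen → ZMod 2)
    (hsupp : ∀ p q, h p q ≠ 0 → P.l p = P.l q ∧ P.r p = P.r q)
    (hh : ∀ p q, ∑ n, P.m [] p [] n * h n q + ∑ n, h p n * P.m [] n [] q = kron p q) :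
    ∃ H : Mor P P, IsMor P P H ∧ diff P P H = ident P := by
  classical
  -- The linear contraction, regarded as a morphism without higher terms.
  let h₀ : Mor P P := fun as p bs q => kron as [] * kron bs [] * h p q
  have hh₀ : IsMor P P h₀ := by
    intro as p bs q hne
    have h1 := eq_of_kron_ne_zero (left_ne_zero_of_mul (left_ne_zero_of_mul hne))
    have h2 := eq_of_kron_ne_zero (right_ne_zero_of_mul (left_ne_zero_of_mul hne))
    obtain ⟨h3, h4⟩ := hsupp _ _ (right_ne_zero_of_mul hne)
    subst h1 h2
    exact ⟨h3.symm, h4⟩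
  have hone : (1 : Matrix P.gen P.gen (BiSeries A B)) = toMatrix (ident P) := by
    ext q p
    refine BiSeries.ext fun as bs => ?_
    rw [coeff_toMatrix, ident]
    by_cases hpq : q = p
    · subst hpq
      rw [Matrix.one_apply_eq, BiSeries.coeff_one, kron_self, mul_one]
    · rw [Matrix.one_apply_ne hpq, BiSeries.coeff_zero, kron_of_ne (Ne.symm hpq), mul_zero]
  have two : ∀ M : Matrix P.gen P.gen (BiSeries A B), M + M = 0 := fun M => by
    ext i j
    exact BiSeries.add_self _
  -- By `hh` the matrix `U` is the identity on empty words, so `1 - U` has no constant term.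
  set U := toMatrix (diff P P h₀) with hU
  have hN : VanishBelow 1 (1 - U) := by
    intro q p as bs hlen
    obtain rfl : as = [] := List.length_eq_zero_iff.1 (by omega)
    obtain rfl : bs = [] := List.length_eq_zero_iff.1 (by omega)
    have h1 : (U q p).coeff [] [] = (toMatrix (ident P) q p).coeff [] [] := by
      rw [hU, coeff_toMatrix, coeff_toMatrix, ident, diff, comp_eq, comp_eq, A.barMu_eq, B.barMu_eq]
      simp [h₀, hh]
    rw [hone, sub_eq_add_neg, matrix_coeff_add, ← h1]
    exact add_neg_cancel _
  have hUN : U = 1 - (1 - U) := by abel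
  have hUM := toMatrix_diff h₀
  -- If `U x = 0` then `x = (1 - U)^k x` for every `k`, which vanishes on words of total length
  -- below `k`.
  have inj : ∀ x, U * x = 0 → x = 0 := by
    intro x hx
    have h1 : x = (1 - U) * x := by rw [sub_mul, hx, one_mul, sub_zero]
    have h2 : ∀ k, x = (1 - U) ^ k * x := by
      intro k
      induction k with
      | zero => simp
      | succ k ih => rw [pow_succ, mul_assoc, ← h1, ← ih]
    ext i j
    refine BiSeries.ext fun as bs => ?_
    rw [h2 (as.length + bs.length + 1)]
    exact ((hN.pow _).mul (vanishBelow_zero x)) _ _ _ _ (by omega)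
  have mc : toMatrix (P := P) (Q := P) P.m * toMatrix (P := P) (Q := P) P.m
      + matrixD P.gen (toMatrix (P := P) (Q := P) P.m) = 0 := by
    rw [toMatrix_mul]
    ext q p
    refine BiSeries.ext fun as bs => ?_
    have := hP.2 as p bs q
    rw [A.barMu_eq, B.barMu_eq, add_assoc] at this
    exact this
  have key := exists_null_homotopy two (matrixD P.gen) matrixD_mul
    (fun M => by ext i j; exact BiSeries.D_D _) mc
    (h := toMatrix h₀) (K := geomSeries (1 - U))
    (by rw [← hUM, ← hU]; nth_rw 1 [hUN]; exact one_sub_mul_geomSeries hN)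
    (by rw [← hUM, ← hU]; exact inj)
  let K : Mor P P := fun as p bs q => (geomSeries (1 - U) q p).coeff as bs
  -- Each coefficient of the series is a finite sum of coefficients of powers of `1 - U`, which in
  -- characteristic two is the matrix of the morphism `ident P + diff P P h₀`.
  have hK : IsMor P P K := by
    have hpow : ∀ k : ℕ, IsMor P P fun as p bs q =>
        (((1 - U) ^ k : Matrix P.gen P.gen (BiSeries A B)) q p).coeff as bs := by
      intro k
      induction k with
      | zero =>
        rw [pow_zero, hone]
        exact isMor_ident P
      | succ k ih =>
        have h1 : (1 - U : Matrix P.gen P.gen (BiSeries A B))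
            = toMatrix (ident P + diff P P h₀) := by
          rw [sub_eq_add_neg, ← eq_neg_of_add_eq_zero_left (two U), hone]
          rfl
        have h2 := ih.comp ((isMor_ident P).add (IsMor.diff hP.1 hP.1 hh₀))
        convert h2 using 1
        apply toMatrix_inj
        rw [← toMatrix_mul, ← h1]
        exact pow_succ _ _
    intro as p bs q hne
    obtain ⟨k, -, hk⟩ := Finset.exists_ne_zero_of_sum_ne_zero
      (show ∑ k ∈ Finset.range (as.length + bs.length + 1),
        ((((1 - U) ^ k : Matrix P.gen P.gen (BiSeries A B)) q p).coeff as bs) ≠ 0 from hne)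
    exact hpow k _ _ _ _ hk
  refine ⟨comp h₀ K, hh₀.comp hK, toMatrix_inj ?_⟩
  rw [toMatrix_diff, ← toMatrix_mul, ← hone]
  exact key

end AAData
/-! ### Homology of complexes of vector spaces -/

section Complexes

variable {k V W : Type*} [Field k] [AddCommGroup V] [Module k V] [AddCommGroup W] [Module k W]

/-- A linear section of `D` over its image, extended to all of `V`, inverts `D` on cycles but need
not be a contraction elsewhere. -/
theorem exists_contraction_of_exact (D : V →ₗ[k] V) (hD : ∀ v, D (D v) = 0)
    (h : LinearMap.ker D ≤ LinearMap.range D) : ∃ s : V →ₗ[k] V, D ∘ₗ s + s ∘ₗ D = LinearMap.id := by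
  obtain ⟨s₀, hs₀⟩ := D.rangeRestrict.exists_rightInverse_of_surjective D.range_rangeRestrict
  obtain ⟨s, hs⟩ := s₀.exists_extend
  have hs' : ∀ v, D v = 0 → D (s v) = v := by
    intro v hv
    have h1 : v ∈ LinearMap.range D := h hv
    have h2 := LinearMap.congr_fun hs₀ ⟨v, h1⟩
    have h3 := LinearMap.congr_fun hs ⟨v, h1⟩
    have h4 := congrArg Subtype.val h2
    simp only [LinearMap.comp_apply, Submodule.subtype_apply] at h3 h4
    rw [h3]
    exact h4
  -- The correction works because `v - s (D v)` is a cycle, so that `D` of the new map at `v` is `v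
  -- - s (D v)`, while its value at `D v` is still `s (D v)`.
  refine ⟨s ∘ₗ (LinearMap.id - s ∘ₗ D), LinearMap.ext fun v => ?_⟩
  have h1 := hs' (v - s (D v)) (by rw [map_sub, hs' _ (hD v), sub_self])
  simp only [LinearMap.add_apply, LinearMap.comp_apply, LinearMap.sub_apply, LinearMap.id_apply,
    hD, map_zero, sub_zero, h1, sub_add_cancel]

/-- The induced map on homology is onto between spaces of the same finite dimension, hence
injective. -/
theorem mem_range_of_surjective_on_homology [FiniteDimensional k V] [FiniteDimensional k W]
    (d : V →ₗ[k] V) (d' : W →ₗ[k] W) (F : V →ₗ[k] W) (hF : ∀ v, F (d v) = d' (F v))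
    (hsurj : ∀ z, d' z = 0 → ∃ c y, d c = 0 ∧ z = F c + d' y)
    (hrank : Module.finrank k
        (LinearMap.ker d' ⧸ (LinearMap.range d').comap (LinearMap.ker d').subtype)
      = Module.finrank k (LinearMap.ker d ⧸ (LinearMap.range d).comap (LinearMap.ker d).subtype))
    {c : V} (hc : d c = 0) (hFc : ∃ y, F c = d' y) : ∃ x, c = d x := by
  have hker : ∀ x ∈ LinearMap.ker d, F x ∈ LinearMap.ker d' := by
    intro x hx
    rw [LinearMap.mem_ker] at hx ⊢
    rw [← hF, hx, map_zero]
  let f := F.restrict hker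
  have hf : (LinearMap.range d).comap (LinearMap.ker d).subtype
      ≤ ((LinearMap.range d').comap (LinearMap.ker d').subtype).comap f := by
    rintro x ⟨y, hy⟩
    exact ⟨F y, by rw [← hF, hy]; rfl⟩
  have hsur : Function.Surjective (Submodule.mapQ _ _ f hf) := by
    intro z
    obtain ⟨z, rfl⟩ := Submodule.Quotient.mk_surjective _ z
    obtain ⟨c, y, hc, hz⟩ := hsurj z z.2
    refine ⟨Submodule.Quotient.mk ⟨c, hc⟩, ?_⟩
    rw [Submodule.mapQ_apply, Submodule.Quotient.eq]
    refine ⟨-y, ?_⟩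
    change d' (-y) = F c - z
    rw [hz, map_neg]
    abel
  have hinj := (LinearMap.injective_iff_surjective_of_finrank_eq_finrank hrank.symm).2 hsur
  have h0 : Submodule.mapQ _ _ f hf (Submodule.Quotient.mk ⟨c, hc⟩) = 0 := by
    rw [Submodule.mapQ_apply, Submodule.Quotient.mk_eq_zero]
    obtain ⟨y, hy⟩ := hFc
    exact ⟨y, hy.symm⟩
  have h1 := hinj (h0.trans (map_zero _).symm)
  rw [Submodule.Quotient.mk_eq_zero] at h1
  obtain ⟨x, hx⟩ := h1
  exact ⟨x, hx.symm⟩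

end Complexes

/-! ### The underlying complex of a type-AA bimodule -/

namespace AAData

variable {ι κ : Type} [Fintype ι] [Fintype κ] {A : DGAlgebra ι} {B : DGAlgebra κ}

theorem comp_nil {P Q R : AAData A B} (g : Mor Q R) (f : Mor P Q) (p : P.gen) (q : R.gen) :
    comp g f [] p [] q = ∑ n, f [] p [] n * g [] n [] q := by
  simp [comp_eq]

theorem chainD_apply (P : AAData A B) (v : P.gen → ZMod 2) (q : P.gen) :
    P.chainD v q = ∑ p, P.m [] p [] q * v p := rfl

theorem chainD_chainD {P : AAData A B} (hP : IsBimodule P) (v : P.gen → ZMod 2) :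
    P.chainD (P.chainD v) = 0 := by
  funext q
  simp only [chainD_apply, Finset.mul_sum, Pi.zero_apply]
  rw [Finset.sum_comm]
  refine Finset.sum_eq_zero fun p _ => ?_
  have := hP.2 [] p [] q
  rw [comp_nil, A.barMu_eq, B.barMu_eq, A.barDiff_nil, B.barDiff_nil, add_zero, add_zero] at this
  simp only [← mul_assoc, ← Finset.sum_mul]
  simp only [mul_comm (P.m [] _ [] q), this, zero_mul]

theorem add_eq_zero_iff_zmod {x y : ZMod 2} : x + y = 0 ↔ x = y := by
  rw [← ZModModule.sub_eq_add, sub_eq_zero]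

theorem kron_of_injective {S T : Type} {f : S → T} (hf : Function.Injective f) (s t : S) :
    kron (f s) (f t) = kron s t := by
  by_cases h : s = t
  · rw [h, kron_self, kron_self]
  · rw [kron_of_ne h, kron_of_ne (hf.ne h)]

/-! ### Mapping cones -/

/-- The mapping cone of a morphism. -/
def cone {P Q : AAData A B} (f : Mor P Q) : AAData A B where
  gen := P.gen ⊕ Q.gen
  l := Sum.elim P.l Q.l
  r := Sum.elim P.r Q.r
  m as x bs y := match x, y with
    | .inl p, .inl p' => P.m as p bs p'
    | .inl p, .inr q => f as p bs q
    | .inr _, .inl _ => 0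
    | .inr q, .inr q' => Q.m as q bs q'

section Cone

variable {P Q : AAData A B} (f : Mor P Q)

/-- The inclusion of the source into the mapping cone. -/
def coneInl (p : P.gen) : (cone f).gen := Sum.inl p

/-- The inclusion of the target into the mapping cone. -/
def coneInr (q : Q.gen) : (cone f).gen := Sum.inr q

theorem cone_cases {motive : (cone f).gen → Prop} (hl : ∀ p, motive (coneInl f p))
    (hr : ∀ q, motive (coneInr f q)) : ∀ x, motive x
  | .inl p => hl p
  | .inr q => hr q

@[simp] theorem cone_m_inl_inl (as : List A.gen) (p : P.gen) (bs : List B.gen) (p' : P.gen) :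
    (cone f).m as (coneInl f p) bs (coneInl f p') = P.m as p bs p' := rfl

@[simp] theorem cone_m_inl_inr (as : List A.gen) (p : P.gen) (bs : List B.gen) (q : Q.gen) :
    (cone f).m as (coneInl f p) bs (coneInr f q) = f as p bs q := rfl

@[simp] theorem cone_m_inr_inl (as : List A.gen) (q : Q.gen) (bs : List B.gen) (p : P.gen) :
    (cone f).m as (coneInr f q) bs (coneInl f p) = 0 := rfl

@[simp] theorem cone_m_inr_inr (as : List A.gen) (q : Q.gen) (bs : List B.gen) (q' : Q.gen) :
    (cone f).m as (coneInr f q) bs (coneInr f q') = Q.m as q bs q' := rfl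

theorem ident_cone_inl (as : List A.gen) (p : P.gen) (bs : List B.gen) (p' : P.gen) :
    ident (cone f) as (coneInl f p) bs (coneInl f p') = ident P as p bs p' := by
  rw [ident, ident, kron_of_injective (f := coneInl f) Sum.inl_injective]

theorem ident_cone_inr (as : List A.gen) (q : Q.gen) (bs : List B.gen) (q' : Q.gen) :
    ident (cone f) as (coneInr f q) bs (coneInr f q') = ident Q as q bs q' := by
  rw [ident, ident, kron_of_injective (f := coneInr f) Sum.inr_injective]

theorem ident_cone_inr_inl (as : List A.gen) (q : Q.gen) (bs : List B.gen) (p : P.gen) :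
    ident (cone f) as (coneInr f q) bs (coneInl f p) = 0 := by
  simp [ident, kron, coneInr, coneInl]

theorem sum_cone {V : Type*} [AddCommMonoid V] (g : (cone f).gen → V) :
    ∑ x, g x = ∑ p, g (coneInl f p) + ∑ q, g (coneInr f q) :=
  Fintype.sum_sum_type g

/-- The diagonal blocks of the structure equation are those of `P` and `Q`; the block from `P` to
`Q` is the cycle equation for `f`. -/
theorem cone_isBimodule (hP : IsBimodule P) (hQ : IsBimodule Q) (hf : IsHom P Q f) :
    IsBimodule (cone f) := by
  constructor
  · rintro as (p | p) bs (q | q) h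
    · exact hP.1 _ _ _ _ h
    · exact hf.1 _ _ _ _ h
    · exact absurd rfl h
    · exact hQ.1 _ _ _ _ h
  · intro as x bs y
    rw [comp_eq, sum_cone]
    induction x using cone_cases with
    | hl p =>
      induction y using cone_cases with
      | hl q =>
        have := hP.2 as p bs q
        rw [comp_eq] at this
        simpa using this
      | hr q =>
        have := congrFun (congrFun (congrFun (congrFun hf.2 as) p) bs) q
        unfold diff at this
        rw [comp_eq, comp_eq] at this
        simp only [cone_m_inl_inl, cone_m_inl_inr, cone_m_inr_inr]
        exact this
    | hr p =>
      induction y using cone_cases with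
      | hl q => simp [A.barMu_eq, B.barMu_eq, A.barDiff_zero, B.barDiff_zero]
      | hr q =>
        have := hQ.2 as p bs q
        rw [comp_eq] at this
        simpa using this

theorem chainD_cone_inl (v : (cone f).gen → ZMod 2) (p : P.gen) :
    (cone f).chainD v (coneInl f p) = P.chainD (fun p => v (coneInl f p)) p := by
  rw [chainD_apply, sum_cone, chainD_apply]
  simp

theorem chainD_cone_inr (v : (cone f).gen → ZMod 2) (q : Q.gen) :
    (cone f).chainD v (coneInr f q)
      = ∑ p, f [] p [] q * v (coneInl f p) + Q.chainD (fun q => v (coneInr f q)) q := by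
  rw [chainD_apply, sum_cone, chainD_apply]
  simp

/-- A homomorphism with acyclic mapping cone is a homotopy equivalence. -/
theorem isHomotopyEquiv_of_cone_acyclic (hP : IsBimodule P) (hQ : IsBimodule Q)
    (hf : IsHom P Q f)
    (hac : LinearMap.ker (cone f).chainD ≤ LinearMap.range (cone f).chainD) :
    IsHomotopyEquiv P Q f := by
  classical
  have hC := cone_isBimodule f hP hQ hf
  obtain ⟨s, hs⟩ := exists_contraction_of_exact (cone f).chainD (chainD_chainD hC) hac
  -- The contraction `s` from linear algebra may mix idempotents. Its part preserving both
  -- idempotents is still a contraction, since the differential preserves them.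
  let h : (cone f).gen → (cone f).gen → ZMod 2 := fun x y =>
    kron ((cone f).l x) ((cone f).l y) * kron ((cone f).r x) ((cone f).r y) * s (Pi.single x 1) y
  have hh : ∀ x y, ∑ n, (cone f).m [] x [] n * h n y + ∑ n, h x n * (cone f).m [] n [] y
      = kron x y := by
    intro x y
    have h1 : ∀ n, (cone f).m [] x [] n * h n y
        = kron ((cone f).l x) ((cone f).l y) * kron ((cone f).r x) ((cone f).r y)
          * ((cone f).m [] x [] n * s (Pi.single n 1) y) := by
      intro n
      by_cases h0 : (cone f).m [] x [] n = 0
      · simp [h0]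
      · obtain ⟨h2, h3⟩ := hC.1 _ _ _ _ h0
        simp only [StringFrom] at h2 h3
        simp only [h, h2, h3]
        ring
    have h2 : ∀ n, h x n * (cone f).m [] n [] y
        = kron ((cone f).l x) ((cone f).l y) * kron ((cone f).r x) ((cone f).r y)
          * ((cone f).m [] n [] y * s (Pi.single x 1) n) := by
      intro n
      by_cases h0 : (cone f).m [] n [] y = 0
      · simp [h0]
      · obtain ⟨h2, h3⟩ := hC.1 _ _ _ _ h0
        simp only [StringFrom] at h2 h3
        simp only [h, h2, h3]
        ring
    rw [Finset.sum_congr rfl fun n _ => h1 n, Finset.sum_congr rfl fun n _ => h2 n,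
      ← Finset.mul_sum, ← Finset.mul_sum, ← mul_add]
    have h3 := congrFun (LinearMap.congr_fun hs (Pi.single x 1)) y
    have h4 : (cone f).chainD (Pi.single x 1)
        = ∑ n, (cone f).m [] x [] n • (Pi.single n 1 : (cone f).gen → ZMod 2) := by
      funext q
      simp [chainD_apply, Pi.single_apply, Finset.sum_apply]
    have h5 : ∑ n, (cone f).m [] x [] n * s (Pi.single n 1) y
        + ∑ n, (cone f).m [] n [] y * s (Pi.single x 1) n = kron x y := by
      rw [← chainD_apply, add_comm]
      simp only [LinearMap.add_apply, LinearMap.comp_apply, h4, map_sum, map_smul,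
        LinearMap.id_apply, Pi.add_apply, Finset.sum_apply, Pi.smul_apply, smul_eq_mul] at h3
      rw [h3, Pi.single_apply, kron]
      simp only [eq_comm]
    rw [h5]
    by_cases hxy : x = y
    · subst hxy
      simp [kron_self]
    · rw [kron_of_ne hxy, mul_zero]
  obtain ⟨H, hHm, hHd⟩ := exists_diff_eq_ident hC h (fun x y hxy =>
    ⟨eq_of_kron_ne_zero (left_ne_zero_of_mul (left_ne_zero_of_mul hxy)),
      eq_of_kron_ne_zero (right_ne_zero_of_mul (left_ne_zero_of_mul hxy))⟩) hh
  have key : ∀ as x bs y, diff (cone f) (cone f) H as x bs y = ident (cone f) as x bs y :=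
    fun as x bs y => by rw [hHd]
  have move : ∀ {x y z : ZMod 2}, x + y = z → x = y + z := by decide
  -- The block of `H` from `Q` to `P` is the inverse and the diagonal blocks are the homotopies; the
  -- corresponding blocks of `diff H = ident` are the required equations.
  refine ⟨hf, fun as q bs p => H as (coneInr f q) bs (coneInl f p),
    ⟨fun as q bs p => hHm as _ bs _, ?_⟩,
    ⟨fun as p bs p' => H as (coneInl f p) bs (coneInl f p'), fun as p bs p' => hHm as _ bs _, ?_⟩,
    ⟨fun as q bs q' => H as (coneInr f q) bs (coneInr f q'), fun as q bs q' => hHm as _ bs _, ?_⟩⟩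
  · funext as q bs p
    have := key as (coneInr f q) bs (coneInl f p)
    unfold diff at this ⊢
    rw [comp_eq, comp_eq, sum_cone, sum_cone, ident_cone_inr_inl] at this
    rw [comp_eq, comp_eq]
    simpa using this
  · funext as p bs p'
    have := key as (coneInl f p) bs (coneInl f p')
    unfold diff at this ⊢
    rw [comp_eq, comp_eq, sum_cone, sum_cone, ident_cone_inl] at this
    rw [comp_eq, comp_eq, Pi.add_apply, Pi.add_apply, Pi.add_apply, Pi.add_apply, comp_eq]
    apply move
    rw [← this]
    simp only [cone_m_inl_inl, cone_m_inl_inr, cone_m_inr_inl, mul_zero, splitSum_zero,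
      Finset.sum_const_zero, add_zero]
    ring
  · funext as q bs q'
    have := key as (coneInr f q) bs (coneInr f q')
    unfold diff at this ⊢
    rw [comp_eq, comp_eq, sum_cone, sum_cone, ident_cone_inr] at this
    rw [comp_eq, comp_eq, Pi.add_apply, Pi.add_apply, Pi.add_apply, Pi.add_apply, comp_eq]
    apply move
    rw [← this]
    simp only [cone_m_inr_inr, cone_m_inl_inr, cone_m_inr_inl, zero_mul, splitSum_zero,
      Finset.sum_const_zero, zero_add]
    ring

/-- A homomorphism that is surjective on homology between bimodules with homology of the same
rank is a homotopy equivalence. -/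
theorem isHomotopyEquiv_of_surjective (hP : IsBimodule P) (hQ : IsBimodule Q)
    (hf : IsHom P Q f) (hrank : Q.homologyRank = P.homologyRank)
    (hsurj : ∀ z, Q.chainD z = 0 → ∃ c y, P.chainD c = 0 ∧
      ∀ q, z q = ∑ p, f [] p [] q * c p + Q.chainD y q) :
    IsHomotopyEquiv P Q f := by
  refine isHomotopyEquiv_of_cone_acyclic f hP hQ hf ?_
  let F : (P.gen → ZMod 2) →ₗ[ZMod 2] (Q.gen → ZMod 2) :=
    Matrix.mulVecLin (Matrix.of fun q p => f [] p [] q)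
  have hFa : ∀ v q, F v q = ∑ p, f [] p [] q * v p := fun _ _ => rfl
  have hF : ∀ v, F (P.chainD v) = Q.chainD (F v) := by
    intro v
    funext q
    simp only [hFa, chainD_apply, Finset.mul_sum]
    rw [Finset.sum_comm, Finset.sum_comm (s := Finset.univ (α := Q.gen))]
    refine Finset.sum_congr rfl fun p _ => ?_
    have := congrFun (congrFun (congrFun (congrFun hf.2 []) p) []) q
    rw [diff, comp_nil, comp_nil, A.barMu_eq, B.barMu_eq, A.barDiff_nil, B.barDiff_nil, add_zero,
      add_zero, Pi.zero_apply, Pi.zero_apply, Pi.zero_apply, Pi.zero_apply,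
      add_eq_zero_iff_zmod] at this
    simp only [← mul_assoc, ← Finset.sum_mul]
    congr 1
    simpa only [mul_comm] using this
  intro v hv
  rw [LinearMap.mem_ker] at hv
  have h1 : P.chainD (fun p => v (coneInl f p)) = 0 := by
    funext p
    rw [← chainD_cone_inl f v, hv]
    rfl
  have h2 : F (fun p => v (coneInl f p)) = Q.chainD (fun q => v (coneInr f q)) := by
    funext q
    have := chainD_cone_inr f v q
    rw [hv] at this
    exact add_eq_zero_iff_zmod.1 this.symm
  -- The source component of a cycle of the cone is a cycle whose image is a boundary, hence it is
  -- itself a boundary, of `x`.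
  obtain ⟨x, hx⟩ := mem_range_of_surjective_on_homology P.chainD Q.chainD F hF
    (fun z hz => by
      obtain ⟨c, y, hc, hy⟩ := hsurj z hz
      exact ⟨c, y, hc, funext hy⟩) hrank h1 ⟨_, h2⟩
  -- The target component plus `F x` is a cycle of `Q`. Writing it as `F c` plus the boundary of `y`
  -- makes `(x + c, y)` a primitive.
  obtain ⟨c, y, hc, hy⟩ := hsurj ((fun q => v (coneInr f q)) + F x) (by
    rw [map_add, ← h2, hx, hF]
    exact ZModModule.add_self _)
  refine ⟨fun z => Sum.elim (x + c) y z, funext (cone_cases f (fun p => ?_) fun q => ?_)⟩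
  · rw [chainD_cone_inl]
    change P.chainD (x + c) p = _
    rw [map_add, hc, add_zero, ← hx]
  · rw [chainD_cone_inr]
    change F (x + c) q + Q.chainD y q = _
    have h3 : v (coneInr f q) + F x q = F c q + Q.chainD y q := hy q
    rw [map_add, Pi.add_apply, add_assoc, ← h3, add_comm (v _), ← add_assoc]
    rw [ZModModule.add_self, zero_add]

end Cone

end AAData
/-! ### Bimodules acting on the dual side -/

/-- The value `x` on the empty word and zero on all others. -/
def nilPart {G V : Type*} [Zero V] (w : List G) (x : V) : V :=
  match w with
  | [] => x
  | _ :: _ => 0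

section NilPart

variable {G H V W : Type*} [AddCommMonoid V] [AddCommMonoid W]

@[simp] theorem nilPart_nil (x : V) : nilPart ([] : List G) x = x := rfl

@[simp] theorem nilPart_cons (a : G) (w : List G) (x : V) : nilPart (a :: w) x = 0 := rfl

theorem nilPart_add (w : List G) (x y : V) : nilPart w (x + y) = nilPart w x + nilPart w y := by
  cases w <;> simp

theorem nilPart_zero (w : List G) : nilPart w (0 : V) = 0 := by
  cases w <;> simp

theorem map_nilPart {F : Type*} [FunLike F V W] [AddMonoidHomClass F V W] (f : F) (w : List G)
    (x : V) : f (nilPart w x) = nilPart w (f x) := by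
  cases w <;> simp

theorem nilPart_mul {R : Type*} [NonUnitalNonAssocSemiring R] (w : List G) (x y : R) :
    nilPart w x * y = nilPart w (x * y) := by
  cases w <;> simp

theorem mul_nilPart {R : Type*} [NonUnitalNonAssocSemiring R] (w : List G) (x y : R) :
    x * nilPart w y = nilPart w (x * y) := by
  cases w <;> simp

theorem splitSum_nilPart_left (w : List G) (φ : List G → List G → V) :
    splitSum w (fun u v => nilPart u (φ u v)) = φ [] w := by
  rw [splitSum_eq_left _ _ (by simp)]
  rfl

theorem splitSum_nilPart_right (w : List G) (φ : List G → List G → V) :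
    splitSum w (fun u v => nilPart v (φ u v)) = φ w [] := by
  rw [splitSum_eq_right _ _ (by simp)]
  rfl

theorem splitSum_nilPart_const (w : List G) (t : List H) (φ : List G → List G → V) :
    splitSum w (fun u v => nilPart t (φ u v)) = nilPart t (splitSum w φ) := by
  cases t <;> simp

end NilPart

theorem map_barDiff' {κ : Type} [Fintype κ] (B : DGAlgebra κ) {V W : Type*} [AddCommGroup V]
    [Module (ZMod 2) V] [AddCommGroup W] [Module (ZMod 2) W] (T : V →+ W) (F : List B.gen → V)
    (w : List B.gen) : T (B.barDiff F w) = B.barDiff (fun w => T (F w)) w :=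
  B.map_barDiff (T.toZModLinearMap 2) F w

theorem barDiff_nilPart {κ : Type} [Fintype κ] (B : DGAlgebra κ) {V : Type*} [AddCommGroup V]
    [Module (ZMod 2) V] (x : V) (w : List B.gen) : B.barDiff (fun w => nilPart w x) w = 0 := by
  rcases w with _ | ⟨a, _ | ⟨b, w⟩⟩ <;>
    simp [DGAlgebra.barDiff_cons, DGAlgebra.mulHead, DGAlgebra.lin_eq, B.barDiff_zero]

theorem barDiff_nilPart_const {κ : Type} [Fintype κ] (B : DGAlgebra κ) {H V : Type*}
    [AddCommGroup V] [Module (ZMod 2) V] (t : List H) (F : List B.gen → V) (w : List B.gen) :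
    B.barDiff (fun w => nilPart t (F w)) w = nilPart t (B.barDiff F w) := by
  cases t <;> simp [B.barDiff_zero]

section MaurerCartan

variable {κ : Type} [Fintype κ] {B : DGAlgebra κ} {R : Type*} [NonUnitalRing R]
  [Module (ZMod 2) R]

/-- `δ` is a twisting cochain on the bar construction of `B` with values in `R`. -/
def IsTwisting (B : DGAlgebra κ) (d : R →+ R) (δ : List B.gen → R) : Prop :=
  ∀ w, splitSum w (fun u v => δ u * δ v) + d (δ w) + B.barDiff δ w = 0

/-- The operators by which the pairs of words act on the dual of a bimodule. -/
def twistedAct (d : R →+ R) (δ : List B.gen → R) (as bs : List B.gen) (z : R) : R :=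
  nilPart as (nilPart bs (d z)) + nilPart bs (z * δ as) + nilPart as (δ bs * z)

/-- The operators are left multiplication by `δ(bs)`, right multiplication by `δ(as)` and `d`. The
two multiplications commute, so the mixed term occurs twice, and each side separately reduces to the
twisting equation. -/
theorem twistedAct_structure {d : R →+ R} (leib : ∀ x y, d (x * y) = d x * y + x * d y)
    (sq : ∀ x, d (d x) = 0) {δ : List B.gen → R} (hδ : IsTwisting B d δ)
    (as bs : List B.gen) (z : R) :
    splitSum as (fun u v => splitSum bs fun u' v' =>
        twistedAct d δ v u' (twistedAct d δ u v' z))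
      + B.barDiff (fun w => twistedAct d δ w bs z) as
      + B.barDiff (fun w => twistedAct d δ as w z) bs = 0 := by
  have two : ∀ x : R, x + x = 0 := fun x => ZModModule.add_self x
  have hl : ∀ w, B.barDiff (fun w => z * δ w) w = z * B.barDiff δ w := fun w =>
    (map_barDiff' B (AddMonoidHom.mulLeft z) δ w).symm
  have hr : ∀ w, B.barDiff (fun w => δ w * z) w = B.barDiff δ w * z := fun w =>
    (map_barDiff' B (AddMonoidHom.mulRight z) δ w).symm
  simp only [twistedAct, map_add, mul_add, add_mul, nilPart_add, splitSum_add, map_nilPart,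
    mul_nilPart, nilPart_mul, sq, nilPart_zero, splitSum_zero, splitSum_nilPart_const,
    splitSum_nilPart_left, splitSum_nilPart_right, B.barDiff_add, barDiff_nilPart,
    barDiff_nilPart_const, hl, hr]
  have h1 : nilPart bs (d (z * δ as)) + nilPart bs (d z * δ as)
      + nilPart bs (splitSum as fun u v => z * δ u * δ v) + nilPart bs (z * B.barDiff δ as) = 0 := by
    rw [← nilPart_add, ← nilPart_add, ← nilPart_add]
    have : d (z * δ as) + d z * δ as + (splitSum as fun u v => z * δ u * δ v) + z * B.barDiff δ as
        = (d z * δ as + d z * δ as)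
          + z * (splitSum as (fun u v => δ u * δ v) + d (δ as) + B.barDiff δ as) := by
      rw [mul_add, mul_add, mul_splitSum, leib]
      simp only [mul_assoc]
      abel
    rw [this, two, hδ, mul_zero, add_zero, nilPart_zero]
  have h2 : nilPart as (d (δ bs * z)) + nilPart as (δ bs * d z)
      + nilPart as (splitSum bs fun u v => δ u * (δ v * z)) + nilPart as (B.barDiff δ bs * z)
      = 0 := by
    rw [← nilPart_add, ← nilPart_add, ← nilPart_add]
    have : d (δ bs * z) + δ bs * d z + (splitSum bs fun u v => δ u * (δ v * z))
          + B.barDiff δ bs * z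
        = (δ bs * d z + δ bs * d z)
          + (splitSum bs (fun u v => δ u * δ v) + d (δ bs) + B.barDiff δ bs) * z := by
      rw [add_mul, add_mul, splitSum_mul, leib]
      simp only [mul_assoc]
      abel
    rw [this, two, hδ, zero_mul, add_zero, nilPart_zero]
  have h3 := two (δ bs * z * δ as)
  have h4 : δ bs * (z * δ as) = δ bs * z * δ as := (mul_assoc _ _ _).symm
  rw [h4]
  have h5 := congrArg₂ (· + ·) (congrArg₂ (· + ·) h1 h2) h3
  simp only [add_zero] at h5
  refine Eq.trans ?_ h5
  abel

/-- A family of operations dual to the operators of a twisting cochain satisfies the structure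
equation. -/
theorem structure_of_twisting {P : AAData B B} {d : R →+ R}
    (leib : ∀ x y, d (x * y) = d x * y + x * d y) (sq : ∀ x, d (d x) = 0)
    {δ : List B.gen → R} (hδ : IsTwisting B d δ) (Φ : (P.gen → ZMod 2) →+ R)
    (inj : Function.Injective Φ)
    (hΦ : ∀ as bs h, Φ (fun p => ∑ q, P.m as p bs q * h q) = twistedAct d δ as bs (Φ h))
    (as : List B.gen) (p : P.gen) (bs : List B.gen) (q : P.gen) :
    AAData.comp (P := P) (Q := P) (R := P) P.m P.m as p bs q
      + B.barMu (fun w => P.m w p bs q) as + B.barMu (fun w => P.m as p w q) bs = 0 := by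
  classical
  -- The structure equation with output `q` is the operator identity applied to the indicator of
  -- `q`; injectivity of `Φ` then transports it to matrices.
  have hs : ∀ w w' p, P.m w p w' q = ∑ q', P.m w p w' q' * (Pi.single q 1 : P.gen → ZMod 2) q' := by
    intro w w' p
    simp [Pi.single_apply]
  have h1 : (fun p => AAData.comp (P := P) (Q := P) (R := P) P.m P.m as p bs q)
      = splitSum as fun u v => splitSum bs fun u' v' => fun p =>
        ∑ n, P.m v p u' n * ∑ q', P.m u n v' q' * (Pi.single q 1 : P.gen → ZMod 2) q' := by
    funext p
    simp only [AAData.comp_eq, splitSum_apply, splitSum_sum, ← hs]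
  have h2 : (fun p => B.barMu (fun w => P.m w p bs q) as)
      = B.barDiff (fun w p => ∑ q', P.m w p bs q' * (Pi.single q 1 : P.gen → ZMod 2) q') as := by
    funext p
    rw [B.barMu_eq]
    simp only [← hs]
    exact (B.map_barDiff (LinearMap.proj p) (fun w p => P.m w p bs q) as).symm
  have h3 : (fun p => B.barMu (fun w => P.m as p w q) bs)
      = B.barDiff (fun w p => ∑ q', P.m as p w q' * (Pi.single q 1 : P.gen → ZMod 2) q') bs := by
    funext p
    rw [B.barMu_eq]
    simp only [← hs]
    exact (B.map_barDiff (LinearMap.proj p) (fun w p => P.m as p w q) bs).symm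
  refine congrFun (f := (fun p => AAData.comp (P := P) (Q := P) (R := P) P.m P.m as p bs q)
    + (fun p => B.barMu (fun w => P.m w p bs q) as)
    + fun p => B.barMu (fun w => P.m as p w q) bs) (g := 0) (inj ?_) p
  rw [h1, h2, h3, map_add, map_add, map_zero, map_barDiff', map_barDiff', map_splitSum]
  simp only [map_splitSum, hΦ]
  exact twistedAct_structure leib sq hδ as bs _

/-- The bar differential of a function at a word with a marked letter. -/
theorem barDiff_append_cons {V : Type*} [AddCommGroup V] [Module (ZMod 2) V]
    (F : List B.gen → V) (bs : List B.gen) (c : B.gen) (as : List B.gen) :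
    B.barDiff F (bs ++ c :: as) = B.barDiff (fun w => F (w ++ c :: as)) bs
      + splitSum as (fun u v => splitSum bs fun u' v' =>
          ∑ n : B.gen, (AAData.ofAlgebra B).m v' c u n • F (u' ++ n :: v))
      + B.barDiff (fun w => F (bs ++ c :: w)) as := by
  induction bs generalizing F with
  | nil =>
    simp only [List.nil_append, B.barDiff_cons, B.barDiff_nil, zero_add, splitSum_nil]
    congr 1
    rcases as with _ | ⟨a, as⟩
    · simp [DGAlgebra.mulHead, AAData.ofAlgebra, DGAlgebra.lin_eq, DGAlgebra.dCoeff]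
    · rw [splitSum_cons, splitSum_eq_left]
      · simp [DGAlgebra.mulHead, AAData.ofAlgebra, DGAlgebra.lin_eq, DGAlgebra.dCoeff,
          DGAlgebra.mulCoeff]
      · intro a' u v
        simp [AAData.ofAlgebra]
  | cons b bs ih =>
    rw [List.cons_append, B.barDiff_cons, ih, B.barDiff_cons]
    simp only [splitSum_cons, splitSum_add]
    -- The letter `b` is multiplied into the marked letter only when nothing stands between them.
    have h1 : B.mulHead F b (bs ++ c :: as) = B.mulHead (fun w => F (w ++ c :: as)) b bs
        + splitSum as (fun u v =>
            ∑ n : B.gen, (AAData.ofAlgebra B).m (b :: bs) c u n • F ([] ++ n :: v)) := by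
      rcases bs with _ | ⟨b', bs⟩
      · rw [splitSum_eq_left]
        · simp [DGAlgebra.mulHead, AAData.ofAlgebra, DGAlgebra.lin_eq, DGAlgebra.mulCoeff]
        · intro a' u v
          simp [AAData.ofAlgebra]
      · rw [splitSum_eq_zero]
        · simp [DGAlgebra.mulHead]
        · intro u v _
          simp [AAData.ofAlgebra]
    rw [h1]
    simp only [List.cons_append]
    abel

/-- Evaluating a twisting cochain on words with a marked letter gives a homomorphism to the dual
of the algebra. -/
theorem diff_eq_zero_of_twisting {P : AAData B B} {d : R →+ R}
    {δ : List B.gen → R} (hδ : IsTwisting B d δ) (Φ : (P.gen → ZMod 2) →+ R)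
    (inj : Function.Injective Φ)
    (hΦ : ∀ as bs h, Φ (fun p => ∑ q, P.m as p bs q * h q) = twistedAct d δ as bs (Φ h))
    (f : AAData.Mor P (AAData.ofAlgebra B).dual)
    (hf : ∀ as bs (c : B.gen), Φ (fun p => f as p bs c) = δ (bs ++ c :: as)) :
    AAData.diff P (AAData.ofAlgebra B).dual f = 0 := by
  have hsmul : ∀ (k : ZMod 2) h, Φ (fun p => k * h p) = k • Φ h := fun k h =>
    map_smul (Φ.toZModLinearMap 2) k h
  have hsum : ∀ (k : B.gen → P.gen → ZMod 2), Φ (fun p => ∑ n, k n p) = ∑ n, Φ (k n) := by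
    intro k
    rw [← map_sum]
    congr 1
    funext p
    simp
  have key : ∀ as bs (c : B.gen),
      (fun p => AAData.diff P (AAData.ofAlgebra B).dual f as p bs c) = 0 := by
    intro as bs c
    have h1 : (fun p => AAData.comp (P := P) (Q := P) f P.m as p bs c)
        = splitSum as fun u v => splitSum bs fun u' v' => fun p =>
          ∑ n, P.m v p u' n * f u n v' c := by
      funext p
      refine (AAData.comp_eq (P := P) (Q := P) (R := (AAData.ofAlgebra B).dual) f P.m as p bs
        c).trans ?_
      simp only [splitSum_apply, splitSum_sum]
    have h2 : (fun p => AAData.comp (P := P) (Q := (AAData.ofAlgebra B).dual)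
          (R := (AAData.ofAlgebra B).dual) (AAData.ofAlgebra B).dual.m f as p bs c)
        = splitSum as fun u v => splitSum bs fun u' v' => fun p =>
          ∑ n : B.gen, (AAData.ofAlgebra B).m v' c u n * f v p u' n := by
      funext p
      refine (AAData.comp_eq (P := P) (Q := (AAData.ofAlgebra B).dual)
        (R := (AAData.ofAlgebra B).dual) (AAData.ofAlgebra B).dual.m f as p bs c).trans ?_
      simp only [splitSum_apply, splitSum_sum, mul_comm (f _ _ _ _)]
      rfl
    have h3 : (fun p => B.barMu (fun w => f w p bs c) as)
        = B.barDiff (fun w p => f w p bs c) as := by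
      funext p
      rw [B.barMu_eq]
      exact (B.map_barDiff (LinearMap.proj p) (fun w p => f w p bs c) as).symm
    have h4 : (fun p => B.barMu (fun w => f as p w c) bs)
        = B.barDiff (fun w p => f as p w c) bs := by
      funext p
      rw [B.barMu_eq]
      exact (B.map_barDiff (LinearMap.proj p) (fun w p => f as p w c) bs).symm
    refine inj ?_
    have h5 : (fun p => AAData.diff P (AAData.ofAlgebra B).dual f as p bs c)
        = (fun p => AAData.comp (P := P) (Q := P) f P.m as p bs c)
          + (fun p => AAData.comp (P := P) (Q := (AAData.ofAlgebra B).dual)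
          (R := (AAData.ofAlgebra B).dual) (AAData.ofAlgebra B).dual.m f as p bs c)
          + (fun p => B.barMu (fun w => f w p bs c) as)
          + (fun p => B.barMu (fun w => f as p w c) bs) := rfl
    rw [h5, h1, h2, h3, h4, map_add, map_add, map_add, map_zero, map_barDiff', map_barDiff',
      map_splitSum, map_splitSum]
    simp only [map_splitSum, hΦ, hf, hsum, hsmul]
    -- Cuts before and after `c`, together with `d`, give the terms with operations of `P`. The bar
    -- terms touching `c` give those with operations of `B^∨`, and the others the bar differentials
    -- of `f`.
    have h6 := hδ (bs ++ c :: as)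
    rw [splitSum_append_cons, barDiff_append_cons] at h6
    simp only [twistedAct, splitSum_add, splitSum_nilPart_const, splitSum_nilPart_left,
      splitSum_nilPart_right]
    rw [← h6]
    abel
  funext as p bs c
  exact congrFun (key as bs c) p

end MaurerCartan

/-! ### Finite sums over words -/

section Words

variable {G : Type*} [Fintype G] {V : Type*} [AddCommMonoid V]

/-- The finite set of words of a given length. -/
def words (G : Type*) [Fintype G] : ℕ → Finset (List G)
  | 0 => {[]}
  | n + 1 => (Finset.univ ×ˢ words G n).map
      ⟨fun p : G × List G => p.1 :: p.2, fun p q h => by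
        obtain ⟨h1, h2⟩ := List.cons.inj h
        exact Prod.ext h1 h2⟩

theorem mem_words {n : ℕ} {w : List G} : w ∈ words G n ↔ w.length = n := by
  induction n generalizing w with
  | zero => simp [words]
  | succ n ih =>
    cases w with
    | nil => simp [words]
    | cons a w =>
      simp only [words, Finset.mem_map, Finset.mem_product, Finset.mem_univ, true_and, ih,
        Prod.exists, List.length_cons, Nat.add_right_cancel_iff]
      constructor
      · rintro ⟨b, v, hv, h⟩
        rw [← (List.cons.inj h).2]
        exact hv
      · exact fun h => ⟨a, w, h, rfl⟩

/-- The sum over all words of a given length. -/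
def wordSum (n : ℕ) (F : List G → V) : V := ∑ w ∈ words G n, F w

@[simp] theorem wordSum_zero (F : List G → V) : wordSum 0 F = F [] := by
  simp [wordSum, words]

theorem wordSum_succ (n : ℕ) (F : List G → V) :
    wordSum (n + 1) F = ∑ a, wordSum n fun w => F (a :: w) := by
  rw [wordSum, words, Finset.sum_map, Finset.sum_product]
  rfl

theorem finsum_eq_sum_wordSum {F : List G → V} {N : ℕ} (h : ∀ w, N < w.length → F w = 0) :
    ∑ᶠ w, F w = ∑ n ∈ Finset.range (N + 1), wordSum n F := by
  classical
  rw [finsum_eq_sum_of_support_subset (s := (Finset.range (N + 1)).biUnion (words G)) F]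
  · rw [Finset.sum_biUnion]
    · rfl
    · intro i _ j _ hij
      rw [Function.onFun, Finset.disjoint_left]
      intro w hi hj
      rw [mem_words] at hi hj
      exact hij (hi.symm.trans hj)
  · intro w hw
    simp only [Finset.coe_biUnion, Set.mem_iUnion, Finset.mem_coe, Finset.mem_range, mem_words]
    refine ⟨w.length, ?_, rfl⟩
    by_contra h'
    exact hw (h w (by omega))

/-- Made for the dual of an algebra, whose operations take at most one algebra input in total. -/
theorem finsum_short {F : List G → V} (h : ∀ a b w, F (a :: b :: w) = 0) :
    ∑ᶠ w, F w = F [] + ∑ a, F [a] := by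
  rw [finsum_eq_sum_wordSum (N := 1), Finset.sum_range_succ, Finset.sum_range_one, wordSum_succ]
  · simp
  · rintro (_ | ⟨a, _ | ⟨b, w⟩⟩) hw
    · simp at hw
    · simp at hw
    · exact h _ _ _

end Words

/-! ### Matrices over a differential algebra -/

namespace DGAlgebra

variable {ι : Type} [Fintype ι] (A : DGAlgebra ι)

theorem repr_mul (x y : A.carrier) (c : A.gen) :
    A.basis.repr (x * y) c
      = ∑ a, ∑ b, A.basis.repr x a * A.basis.repr y b * A.mulCoeff a b c := by
  have h1 := A.lin_map (fun a => A.basis a * y)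
    ((Finsupp.lapply c : (A.gen →₀ ZMod 2) →ₗ[ZMod 2] ZMod 2).comp A.basis.repr.toLinearMap) x
  have h2 : A.lin (fun a => A.basis a * y) x = x * y := by
    have := A.lin_lin_mul_right (fun a => A.basis a) y x
    have hid : ∀ z, A.lin (fun a => A.basis a) z = z := fun z => by
      rw [lin_eq, A.basis.sum_repr]
    simpa [hid] using this
  rw [h2] at h1
  have h3 : A.basis.repr (x * y) c = A.lin (fun a => A.basis.repr (A.basis a * y) c) x := h1
  rw [h3, lin_eq]
  refine Finset.sum_congr rfl fun a _ => ?_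
  have h4 : A.basis.repr (A.basis a * y) c
      = A.lin (fun b => A.basis.repr (A.basis a * A.basis b) c) y := by
    have h5 := A.lin_map (fun b => A.basis a * A.basis b)
      ((Finsupp.lapply c : (A.gen →₀ ZMod 2) →ₗ[ZMod 2] ZMod 2).comp A.basis.repr.toLinearMap) y
    have h6 := A.lin_lin_mul_left (fun a => A.basis a) (A.basis a) y
    have hid : ∀ z, A.lin (fun a => A.basis a) z = z := fun z => by
      rw [lin_eq, A.basis.sum_repr]
    simp only [hid] at h6
    rw [h6] at h5
    exact h5
  rw [h4, lin_eq, Finset.smul_sum]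
  refine Finset.sum_congr rfl fun b _ => ?_
  simp [mulCoeff, mul_assoc]

theorem repr_d (x : A.carrier) (c : A.gen) :
    A.basis.repr (A.d x) c = ∑ a, A.basis.repr x a * A.dCoeff a c := by
  conv_lhs => rw [← A.basis.sum_repr x]
  rw [map_sum, map_sum, Finsupp.coe_finsetSum, Finset.sum_apply]
  simp [dCoeff]

theorem repr_sum_smul (f : A.gen → ZMod 2) (c : A.gen) :
    A.basis.repr (∑ a, f a • A.basis a) c = f c := by
  classical
  simp [map_sum, Finsupp.coe_finsetSum, Finsupp.single_apply]

/-- The entrywise differential of matrices. -/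
def matD (m n : Type) : Matrix m n A.carrier →+ Matrix m n A.carrier :=
  A.d.toAddMonoidHom.mapMatrix

theorem matD_apply {m n : Type} (M : Matrix m n A.carrier) (i : m) (j : n) :
    A.matD m n M i j = A.d (M i j) := rfl

theorem matD_mul {m n k : Type} [Fintype n] (M : Matrix m n A.carrier) (N : Matrix n k A.carrier) :
    A.matD m k (M * N) = A.matD m n M * N + M * A.matD n k N := by
  ext i j
  simp only [matD_apply, Matrix.mul_apply, Matrix.add_apply, map_sum, leibniz,
    Finset.sum_add_distrib]

theorem matD_matD {m n : Type} (M : Matrix m n A.carrier) : A.matD m n (A.matD m n M) = 0 := by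
  ext i j
  exact A.d_d _

theorem ext_repr {x y : A.carrier} (h : ∀ c, A.basis.repr x c = A.basis.repr y c) : x = y :=
  A.basis.repr.injective (Finsupp.ext h)

end DGAlgebra

/-! ### Morphisms of type AD as matrices over the output algebra -/

namespace ADData

variable {κ ι : Type} [Fintype κ] [Fintype ι] {B : DGAlgebra κ} {A : DGAlgebra ι}

/-- The matrices over the output algebra of a morphism. -/
def mat {X Z : ADData B A} (f : Mor X Z) (bs : List B.gen) : Matrix Z.gen X.gen A.carrier :=
  fun z x => ∑ a, f bs x z a • A.basis a

theorem repr_mat {X Z : ADData B A} (f : Mor X Z) (bs : List B.gen) (z : Z.gen) (x : X.gen)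
    (a : A.gen) : A.basis.repr (mat f bs z x) a = f bs x z a :=
  A.repr_sum_smul _ _

theorem mat_add {X Z : ADData B A} (f g : Mor X Z) (bs : List B.gen) :
    mat (f + g) bs = mat f bs + mat g bs := by
  ext z x
  refine A.ext_repr fun c => ?_
  rw [Matrix.add_apply, map_add, Finsupp.add_apply, repr_mat, repr_mat, repr_mat]
  rfl

theorem mat_comp {X Z W : ADData B A} (g : Mor Z W) (f : Mor X Z) (bs : List B.gen) :
    mat (comp g f) bs = splitSum bs fun u v => mat g u * mat f v := by
  ext w x
  refine A.ext_repr fun c => ?_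
  rw [repr_mat, splitSum, Matrix.sum_apply, map_sum, Finsupp.coe_finsetSum, Finset.sum_apply, comp]
  refine Finset.sum_congr rfl fun s _ => ?_
  rw [Matrix.mul_apply, map_sum, Finsupp.coe_finsetSum, Finset.sum_apply]
  refine Finset.sum_congr rfl fun n _ => ?_
  rw [A.repr_mul]
  refine Finset.sum_congr rfl fun a₁ _ => Finset.sum_congr rfl fun a₂ _ => ?_
  rw [repr_mat, repr_mat]
  ring

theorem mat_innerDiff {X Z : ADData B A} (f : Mor X Z) (bs : List B.gen) :
    mat (innerDiff f) bs = A.matD _ _ (mat f bs) + B.barDiff (mat f) bs := by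
  ext z x
  refine A.ext_repr fun c => ?_
  let T : Matrix Z.gen X.gen A.carrier →+ ZMod 2 :=
    { toFun := fun M => A.basis.repr (M z x) c
      map_zero' := by simp
      map_add' := fun M N => by simp }
  have h := map_barDiff' B T (mat f) bs
  have h' : ∀ w, T (mat f w) = f w x z c := fun w => repr_mat f w z x c
  simp only [h'] at h
  rw [Matrix.add_apply, map_add, Finsupp.add_apply, repr_mat, A.matD_apply, A.repr_d, innerDiff,
    B.barMu_eq]
  simp only [repr_mat]
  rw [← h]
  rfl

theorem mat_zero {X Z : ADData B A} (bs : List B.gen) : mat (0 : Mor X Z) bs = 0 := by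
  ext z x
  simp [mat]

theorem mat_diff {X Z : ADData B A} (f : Mor X Z) (bs : List B.gen) :
    mat (diff X Z f) bs = splitSum bs (fun u v => mat f u * mat (X := X) (Z := X) X.δ v)
      + splitSum bs (fun u v => mat (X := Z) (Z := Z) Z.δ u * mat f v)
      + (A.matD _ _ (mat f bs) + B.barDiff (mat f) bs) := by
  rw [diff, mat_add, mat_add, mat_comp, mat_comp, mat_innerDiff]

/-- Outputs in `A` are multiplied exactly as matrix entries are, so the structure equation is the
Maurer–Cartan equation in the matrix algebra over `A`. -/
theorem IsBimodule.isTwisting {X : ADData B A} (hX : X.IsBimodule) :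
    IsTwisting B (A.matD X.gen X.gen) (mat (X := X) (Z := X) X.δ) := by
  intro w
  rw [add_assoc, ← mat_innerDiff, ← mat_comp, ← mat_add, hX.2, mat_zero]

/-! ### The bimodule `X ⊠ A^∨ ⊠ X^∨` -/

theorem dual_deltaBar (X : ADData B A) (bs : List B.gen) (x y : X.gen) (as : List A.gen) :
    X.dual.deltaBar y bs as x = X.deltaBar bs x y as := by
  induction as generalizing bs y with
  | nil =>
    exact congrArg (kron bs [] * ·) (kron_comm y x)
  | cons a as ih =>
    exact Finset.sum_congr rfl fun s _ => Finset.sum_congr rfl fun n _ =>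
      (congrArg (X.δ (bs.take s) n y a * ·) (ih _ _)).trans (mul_comm _ _)

theorem deltaBar_nil (X : ADData B A) (bs : List B.gen) (x y : X.gen) :
    X.deltaBar bs x y [] = nilPart bs (kron x y) := by
  cases bs <;> simp [deltaBar]

theorem deltaBar_cons (X : ADData B A) (bs : List B.gen) (x y : X.gen) (a : A.gen)
    (as : List A.gen) :
    X.deltaBar bs x y (a :: as)
      = splitSum bs fun u v => ∑ n, X.deltaBar v x n as * X.δ u n y a := rfl

theorem deltaBar_singleton (X : ADData B A) (bs : List B.gen) (x y : X.gen) (a : A.gen) :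
    X.deltaBar bs x y [a] = X.δ bs x y a := by
  rw [deltaBar_cons]
  simp only [deltaBar_nil, nilPart_mul]
  rw [splitSum_sum]
  simp only [splitSum_nilPart_right, sum_kron_mul]

section Conj

variable (X : ADData B A)

/-- The first component of a generator of `X ⊠ A^∨ ⊠ X^∨`. -/
def conjX (p : (X.conj (AAData.ofAlgebra A).dual).gen) : X.gen := p.1.1.1.1

/-- The middle component of a generator of `X ⊠ A^∨ ⊠ X^∨`. -/
def conjA (p : (X.conj (AAData.ofAlgebra A).dual).gen) : A.gen := p.1.1.1.2

/-- The last component of a generator of `X ⊠ A^∨ ⊠ X^∨`. -/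
def conjY (p : (X.conj (AAData.ofAlgebra A).dual).gen) : X.gen := p.1.2

/-- Composability of three generators. -/
def ConjComposable (x : X.gen) (a : A.gen) (y : X.gen) : Prop := X.r x = A.r a ∧ A.l a = X.r y

variable {X} in
/-- A generator of `X ⊠ A^∨ ⊠ X^∨` given by its components. -/
def conjMk {x : X.gen} {a : A.gen} {y : X.gen} (h : X.ConjComposable x a y) :
    (X.conj (AAData.ofAlgebra A).dual).gen := ⟨(⟨(x, a), h.1⟩, y), h.2⟩

theorem conj_composable (p : (X.conj (AAData.ofAlgebra A).dual).gen) :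
    X.ConjComposable (X.conjX p) (X.conjA p) (X.conjY p) := ⟨p.1.1.2, p.2⟩

/-- Because `A^∨` takes at most one input in total, the box sums collapse to three cases:
differentiate the middle factor, feed it one output of `X`, or feed it one output of `X^∨`. -/
theorem conj_m_eq (as : List B.gen) (p : (X.conj (AAData.ofAlgebra A).dual).gen)
    (bs : List B.gen) (q : (X.conj (AAData.ofAlgebra A).dual).gen) :
    (X.conj (AAData.ofAlgebra A).dual).m as p bs q
      = nilPart as (nilPart bs (kron (X.conjX p) (X.conjX q) * kron (X.conjY q) (X.conjY p)
          * A.dCoeff (X.conjA q) (X.conjA p)))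
        + nilPart bs (kron (X.conjY q) (X.conjY p) * ∑ α, X.δ as (X.conjX p) (X.conjX q) α
            * A.mulCoeff (X.conjA q) α (X.conjA p))
        + nilPart as (kron (X.conjX p) (X.conjX q) * ∑ α, X.δ bs (X.conjY q) (X.conjY p) α
            * A.mulCoeff α (X.conjA q) (X.conjA p)) := by
  have h1 : ∀ cs, (X.boxAA (AAData.ofAlgebra A).dual).m as p.1.1 cs q.1.1
      = nilPart as (kron (X.conjX p) (X.conjX q))
          * (AAData.ofAlgebra A).m cs (X.conjA q) [] (X.conjA p)
        + ∑ α, X.δ as (X.conjX p) (X.conjX q) α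
            * (AAData.ofAlgebra A).m cs (X.conjA q) [α] (X.conjA p) := by
    intro cs
    refine (finsum_short (F := fun u : List A.gen => X.deltaBar as (X.conjX p) (X.conjX q) u
      * (AAData.ofAlgebra A).m cs (X.conjA q) u (X.conjA p)) ?_).trans ?_
    · intro a b w
      rcases cs with _ | ⟨c, _ | ⟨c', cs⟩⟩ <;> exact mul_zero _
    · simp only [deltaBar_nil, deltaBar_singleton]
  refine (finsum_short (F := fun v : List A.gen =>
    (X.boxAA (AAData.ofAlgebra A).dual).m as p.1.1 v q.1.1
      * X.dual.deltaBar (X.conjY p) bs v (X.conjY q)) ?_).trans ?_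
  · intro a b w
    rw [h1]
    simp [AAData.ofAlgebra]
  · simp only [h1, dual_deltaBar, deltaBar_nil, deltaBar_singleton]
    simp only [AAData.ofAlgebra, mul_zero, Finset.sum_const_zero, add_zero, add_mul, nilPart_mul,
      mul_nilPart, Finset.mul_sum, Finset.sum_mul]
    cases as <;> cases bs <;> simp [mul_comm, mul_left_comm, mul_assoc]

end Conj

end ADData

/-! ### Functionals on the conjugated dual as matrices, and the morphism `φ_X` -/

namespace ADData

variable {κ ι : Type} [Fintype κ] [Fintype ι] {B : DGAlgebra κ} {A : DGAlgebra ι}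

section Conj

variable (X : ADData B A)

/-- Extension by zero of a functional on `X ⊠ A^∨ ⊠ X^∨`. -/
def conjExtend (h : (X.conj (AAData.ofAlgebra A).dual).gen → ZMod 2) (x : X.gen) (a : A.gen)
    (y : X.gen) : ZMod 2 := by
  classical exact if hc : X.ConjComposable x a y then h (conjMk hc) else 0

theorem conjExtend_of_composable (h : (X.conj (AAData.ofAlgebra A).dual).gen → ZMod 2)
    {x : X.gen} {a : A.gen} {y : X.gen} (hc : X.ConjComposable x a y) :
    X.conjExtend h x a y = h (conjMk hc) := dif_pos hc

theorem composable_of_conjExtend_ne_zero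
    {h : (X.conj (AAData.ofAlgebra A).dual).gen → ZMod 2}
    {x : X.gen} {a : A.gen} {y : X.gen} (hne : X.conjExtend h x a y ≠ 0) :
    X.ConjComposable x a y := by
  by_contra hc
  exact hne (dif_neg hc)

theorem conjExtend_conj (h : (X.conj (AAData.ofAlgebra A).dual).gen → ZMod 2)
    (p : (X.conj (AAData.ofAlgebra A).dual).gen) :
    X.conjExtend h (X.conjX p) (X.conjA p) (X.conjY p) = h p :=
  X.conjExtend_of_composable h (X.conj_composable p)

theorem conjExtend_add (h h' : (X.conj (AAData.ofAlgebra A).dual).gen → ZMod 2) (x : X.gen)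
    (a : A.gen) (y : X.gen) :
    X.conjExtend (h + h') x a y = X.conjExtend h x a y + X.conjExtend h' x a y := by
  by_cases hc : X.ConjComposable x a y
  · simp only [X.conjExtend_of_composable _ hc, Pi.add_apply]
  · simp only [conjExtend, dif_neg hc, add_zero]

theorem sum_conj_mul (g : X.gen → A.gen → X.gen → ZMod 2)
    (h : (X.conj (AAData.ofAlgebra A).dual).gen → ZMod 2) :
    ∑ q, g (X.conjX q) (X.conjA q) (X.conjY q) * h q
      = ∑ x, ∑ a, ∑ y, g x a y * X.conjExtend h x a y := by
  simp only [← Fintype.sum_prod_type']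
  refine Finset.sum_of_injOn (fun q => (X.conjX q, X.conjA q, X.conjY q)) ?_ ?_ ?_ ?_
  · intro p _ q _ hpq
    obtain ⟨h1, h2⟩ := Prod.ext_iff.1 hpq
    obtain ⟨h2, h3⟩ := Prod.ext_iff.1 h2
    exact Subtype.ext (Prod.ext (Subtype.ext (Prod.ext h1 h2)) h3)
  · intro q _
    simp
  · rintro ⟨x, a, y⟩ _ hne
    by_cases hc : X.ConjComposable x a y
    · exact absurd ⟨conjMk hc, by simp, rfl⟩ hne
    · simp only [conjExtend, dif_neg hc, mul_zero]
  · intro q _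
    rw [conjExtend_conj]

/-- The matrix over `A` corresponding to a functional on `X ⊠ A^∨ ⊠ X^∨`. -/
def conjMat : ((X.conj (AAData.ofAlgebra A).dual).gen → ZMod 2)
    →+ Matrix X.gen X.gen A.carrier where
  toFun h := fun y x => ∑ a, X.conjExtend h x a y • A.basis a
  map_zero' := by
    ext y x
    refine Finset.sum_eq_zero fun a _ => ?_
    have : X.conjExtend 0 x a y = 0 := by
      by_cases hc : X.ConjComposable x a y
      · rw [X.conjExtend_of_composable _ hc]
        rfl
      · exact dif_neg hc
    rw [this, zero_smul]
  map_add' h h' := by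
    ext y x
    simp only [conjExtend_add, add_smul, Finset.sum_add_distrib]
    rfl

theorem repr_conjMat (h : (X.conj (AAData.ofAlgebra A).dual).gen → ZMod 2) (y x : X.gen)
    (a : A.gen) : A.basis.repr (X.conjMat h y x) a = X.conjExtend h x a y :=
  A.repr_sum_smul _ _

theorem conjMat_injective : Function.Injective X.conjMat := by
  intro h h' hh
  funext p
  rw [← X.conjExtend_conj h, ← X.conjExtend_conj h', ← repr_conjMat, ← repr_conjMat, hh]

/-- A matrix is given by a functional once their entries agree on composable triples and the
matrix has no other entries. -/
theorem conjMat_eq {h : (X.conj (AAData.ofAlgebra A).dual).gen → ZMod 2}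
    {M : Matrix X.gen X.gen A.carrier}
    (hsupp : ∀ x a y, A.basis.repr (M y x) a ≠ 0 → X.ConjComposable x a y)
    (heq : ∀ p, h p = A.basis.repr (M (X.conjY p) (X.conjX p)) (X.conjA p)) :
    X.conjMat h = M := by
  ext y x
  refine A.ext_repr fun a => ?_
  rw [repr_conjMat]
  by_cases hc : X.ConjComposable x a y
  · rw [X.conjExtend_of_composable _ hc, heq]
    rfl
  · have h1 : A.basis.repr (M y x) a = 0 := by
      by_contra h2
      exact hc (hsupp _ _ _ h2)
    rw [h1]
    exact dif_neg hc

variable {X}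

/-- The three cases of `conj_m_eq` transpose to `d z`, `z δ(as)` and `δ(bs) z`. This puts the
bimodule under the general results on twisting cochains. -/
theorem conjMat_act (hX : X.IsBimodule) (as bs : List B.gen)
    (h : (X.conj (AAData.ofAlgebra A).dual).gen → ZMod 2) :
    X.conjMat (fun p => ∑ q, (X.conj (AAData.ofAlgebra A).dual).m as p bs q * h q)
      = twistedAct (A.matD X.gen X.gen) (mat (X := X) (Z := X) X.δ) as bs (X.conjMat h) := by
  have hrepr : ∀ x a y, A.basis.repr (twistedAct (A.matD X.gen X.gen)
      (mat (X := X) (Z := X) X.δ) as bs (X.conjMat h) y x) a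
      = nilPart as (nilPart bs (∑ a', X.conjExtend h x a' y * A.dCoeff a' a))
        + nilPart bs (∑ x', ∑ a', ∑ α, X.conjExtend h x' a' y * X.δ as x x' α
            * A.mulCoeff a' α a)
        + nilPart as (∑ y', ∑ α, ∑ a', X.δ bs y' y α * X.conjExtend h x a' y'
            * A.mulCoeff α a' a) := by
    intro x a y
    let T : Matrix X.gen X.gen A.carrier →+ ZMod 2 :=
      { toFun := fun M => A.basis.repr (M y x) a
        map_zero' := by simp
        map_add' := fun M N => by simp }
    have h1 : T (A.matD X.gen X.gen (X.conjMat h)) = ∑ a', X.conjExtend h x a' y * A.dCoeff a' a := by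
      change A.basis.repr (A.d (X.conjMat h y x)) a = _
      rw [A.repr_d]
      simp only [repr_conjMat]
    have h2 : T (X.conjMat h * mat (X := X) (Z := X) X.δ as)
        = ∑ x', ∑ a', ∑ α, X.conjExtend h x' a' y * X.δ as x x' α * A.mulCoeff a' α a := by
      change A.basis.repr (∑ x', X.conjMat h y x' * mat (X := X) (Z := X) X.δ as x' x) a = _
      rw [map_sum, Finsupp.coe_finsetSum, Finset.sum_apply]
      simp only [A.repr_mul, repr_conjMat, repr_mat]
    have h3 : T (mat (X := X) (Z := X) X.δ bs * X.conjMat h)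
        = ∑ y', ∑ α, ∑ a', X.δ bs y' y α * X.conjExtend h x a' y' * A.mulCoeff α a' a := by
      change A.basis.repr (∑ y', mat (X := X) (Z := X) X.δ bs y y' * X.conjMat h y' x) a = _
      rw [map_sum, Finsupp.coe_finsetSum, Finset.sum_apply]
      simp only [A.repr_mul, repr_conjMat, repr_mat]
    change T (twistedAct _ _ _ _ _) = _
    rw [twistedAct, map_add, map_add, map_nilPart, map_nilPart, map_nilPart, map_nilPart, h1, h2,
      h3]
  -- Functionals see only composable triples, so the right-hand side must first be shown to have no
  -- other entries.
  refine X.conjMat_eq ?_ ?_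
  · intro x a y hne
    rw [hrepr] at hne
    by_contra hc
    apply hne
    have h1 : ∑ a', X.conjExtend h x a' y * A.dCoeff a' a = 0 := by
      refine Finset.sum_eq_zero fun a' _ => ?_
      by_contra h0
      obtain ⟨h1, h2⟩ := X.composable_of_conjExtend_ne_zero (left_ne_zero_of_mul h0)
      obtain ⟨h3, h4⟩ := A.dCoeff_ne_zero (right_ne_zero_of_mul h0)
      exact hc ⟨h1.trans h4, h3.symm.trans h2⟩
    have h2 : ∑ x', ∑ a', ∑ α, X.conjExtend h x' a' y * X.δ as x x' α * A.mulCoeff a' α a = 0 := by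
      refine Finset.sum_eq_zero fun x' _ => Finset.sum_eq_zero fun a' _ =>
        Finset.sum_eq_zero fun α _ => ?_
      by_contra h0
      obtain ⟨h1, h2⟩ := X.composable_of_conjExtend_ne_zero
        (left_ne_zero_of_mul (left_ne_zero_of_mul h0))
      obtain ⟨-, -, h3⟩ := hX.1 _ _ _ _ (right_ne_zero_of_mul (left_ne_zero_of_mul h0))
      obtain ⟨h4, -, h5⟩ := A.mulCoeff_ne_zero (right_ne_zero_of_mul h0)
      exact hc ⟨h3.symm.trans h5, h4.symm.trans h2⟩
    have h3 : ∑ y', ∑ α, ∑ a', X.δ bs y' y α * X.conjExtend h x a' y' * A.mulCoeff α a' a = 0 := by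
      refine Finset.sum_eq_zero fun y' _ => Finset.sum_eq_zero fun α _ =>
        Finset.sum_eq_zero fun a' _ => ?_
      by_contra h0
      obtain ⟨h1, h2⟩ := X.composable_of_conjExtend_ne_zero
        (right_ne_zero_of_mul (left_ne_zero_of_mul h0))
      obtain ⟨-, h3, -⟩ := hX.1 _ _ _ _ (left_ne_zero_of_mul (left_ne_zero_of_mul h0))
      obtain ⟨h4, -, h5⟩ := A.mulCoeff_ne_zero (right_ne_zero_of_mul h0)
      exact hc ⟨h1.trans h5, h4.symm.trans h3.symm⟩
    simp only [h1, h2, h3, nilPart_zero, add_zero]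
  · intro p
    rw [hrepr]
    simp only [conj_m_eq]
    rw [X.sum_conj_mul (fun x' a' y' =>
      nilPart as (nilPart bs (kron (X.conjX p) x' * kron y' (X.conjY p)
          * A.dCoeff a' (X.conjA p)))
        + nilPart bs (kron y' (X.conjY p) * ∑ α, X.δ as (X.conjX p) x' α
            * A.mulCoeff a' α (X.conjA p))
        + nilPart as (kron (X.conjX p) x' * ∑ α, X.δ bs y' (X.conjY p) α
            * A.mulCoeff α a' (X.conjA p))) h]
    simp only [add_mul, Finset.sum_add_distrib, nilPart_mul]
    have hsum : ∀ (w : List B.gen) (g : X.gen → A.gen → X.gen → ZMod 2),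
        ∑ x, ∑ a, ∑ y, nilPart w (g x a y) = nilPart w (∑ x, ∑ a, ∑ y, g x a y) := by
      intro w g
      cases w <;> simp
    simp only [hsum]
    congr 1
    · congr 1
      · congr 2
        rw [Finset.sum_comm]
        refine Finset.sum_congr rfl fun a' _ => ?_
        simp only [mul_assoc, ← Finset.mul_sum, sum_kron_mul, sum_kron_mul']
        ring
      · congr 1
        refine Finset.sum_congr rfl fun x' _ => Finset.sum_congr rfl fun a' _ => ?_
        simp only [mul_assoc, sum_kron_mul']
        rw [Finset.sum_mul]
        exact Finset.sum_congr rfl fun α _ => by ring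
    · congr 1
      simp only [mul_assoc, ← Finset.mul_sum, sum_kron_mul]
      rw [Finset.sum_comm]
      refine Finset.sum_congr rfl fun y' _ => ?_
      simp only [Finset.sum_mul, Finset.mul_sum]
      rw [Finset.sum_comm]
      exact Finset.sum_congr rfl fun α _ => Finset.sum_congr rfl fun a' _ => by ring

theorem conj_isMor (hX : X.IsBimodule) :
    AAData.IsMor (X.conj (AAData.ofAlgebra A).dual) (X.conj (AAData.ofAlgebra A).dual)
      (X.conj (AAData.ofAlgebra A).dual).m := by
  intro as p bs q hne
  rw [conj_m_eq] at hne
  change StringFrom B.l B.r (X.l (X.conjX q)) as (X.l (X.conjX p))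
    ∧ StringFrom B.l B.r (X.l (X.conjY p)) bs (X.l (X.conjY q))
  have hnil : ∀ {w : List B.gen} {k : ZMod 2}, nilPart w k ≠ 0 → w = [] ∧ k ≠ 0 := by
    intro w k h
    cases w with
    | nil => exact ⟨rfl, h⟩
    | cons a w => exact absurd rfl h
  have hadd : ∀ {a b : ZMod 2}, a + b ≠ 0 → a ≠ 0 ∨ b ≠ 0 := by decide
  rcases hadd hne with h0 | h0
  · rcases hadd h0 with h1 | h1
    · obtain ⟨has, h2⟩ := hnil h1
      obtain ⟨hbs, h3⟩ := hnil h2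
      rw [has, hbs, eq_of_kron_ne_zero (left_ne_zero_of_mul (left_ne_zero_of_mul h3)),
        eq_of_kron_ne_zero (right_ne_zero_of_mul (left_ne_zero_of_mul h3))]
      exact ⟨rfl, rfl⟩
    · obtain ⟨hbs, h2⟩ := hnil h1
      rw [hbs, eq_of_kron_ne_zero (left_ne_zero_of_mul h2)]
      obtain ⟨α, -, hα⟩ := Finset.exists_ne_zero_of_sum_ne_zero (right_ne_zero_of_mul h2)
      exact ⟨(hX.1 _ _ _ _ (left_ne_zero_of_mul hα)).1, rfl⟩
  · obtain ⟨has, h2⟩ := hnil h0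
    rw [has, eq_of_kron_ne_zero (left_ne_zero_of_mul h2)]
    obtain ⟨α, -, hα⟩ := Finset.exists_ne_zero_of_sum_ne_zero (right_ne_zero_of_mul h2)
    exact ⟨rfl, (hX.1 _ _ _ _ (left_ne_zero_of_mul hα)).1⟩

theorem conj_isBimodule (hX : X.IsBimodule) :
    (X.conj (AAData.ofAlgebra A).dual).IsBimodule :=
  ⟨conj_isMor hX, structure_of_twisting A.matD_mul A.matD_matD hX.isTwisting X.conjMat
    X.conjMat_injective (conjMat_act hX)⟩

variable (X) in
/-- The morphism `X ⊠ A^∨ ⊠ X^∨ → B^∨` given by the action of `B` on `X`. -/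
def joinMor : AAData.Mor (X.conj (AAData.ofAlgebra A).dual) (AAData.ofAlgebra B).dual :=
  fun as p bs (c : B.gen) => X.δ (bs ++ c :: as) (X.conjX p) (X.conjY p) (X.conjA p)

/-- Nothing is lost by restricting to composable triples, since `δ` is a map over the ground rings.
-/
theorem conjMat_joinMor (hX : X.IsBimodule) (as bs : List B.gen) (c : B.gen) :
    X.conjMat (fun p => X.joinMor as p bs c) = mat (X := X) (Z := X) X.δ (bs ++ c :: as) := by
  refine X.conjMat_eq ?_ ?_
  · intro x a y hne
    rw [repr_mat] at hne
    obtain ⟨-, h1, h2⟩ := hX.1 _ _ _ _ hne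
    exact ⟨h2.symm, h1.symm⟩
  · intro p
    rw [repr_mat]
    rfl

/-- The cycle equation is the twisting equation for `δ` on words with a marked letter. -/
theorem joinMor_isHom (hX : X.IsBimodule) :
    AAData.IsHom (X.conj (AAData.ofAlgebra A).dual) (AAData.ofAlgebra B).dual X.joinMor := by
  refine ⟨?_, diff_eq_zero_of_twisting hX.isTwisting X.conjMat X.conjMat_injective
    (conjMat_act hX) X.joinMor (conjMat_joinMor hX)⟩
  intro as p bs c hne
  obtain ⟨k, h1, h2, h3⟩ := stringFrom_append.1 (hX.1 _ _ _ _ hne).1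
  subst h2
  exact ⟨h3, h1⟩

end Conj

end ADData

/-! ### The dual of the algebra -/

section DualAlgebra

variable {κ : Type} [Fintype κ] (B : DGAlgebra κ)

/-- The twisting cochain sending a letter to the corresponding basis element. -/
def letterCochain : List B.gen → B.carrier
  | [a] => B.basis a
  | _ => 0

/-- On one letter the equation reads `d b + d b = 0`, on two letters `a b + a b = 0`; on other words
every term vanishes. Thus `B^∨` is covered by the same criterion as `X ⊠ A^∨ ⊠ X^∨`. -/
theorem letterCochain_isTwisting : IsTwisting B B.d.toAddMonoidHom (letterCochain B) := by
  have hlin : ∀ x : B.carrier, B.lin (fun c => B.basis c) x = x := fun x => by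
    rw [DGAlgebra.lin_eq, B.basis.sum_repr]
  have hz : ∀ x : B.carrier, B.lin (fun _ => (0 : B.carrier)) x = 0 := fun x => by
    simp [DGAlgebra.lin_eq]
  have h2 : ∀ (F : List B.gen → B.carrier) w, (∀ v, F v = 0) → B.barDiff F w = 0 := by
    intro F w hF
    rw [show F = fun _ => 0 from funext hF, B.barDiff_zero]
  intro w
  rcases w with _ | ⟨a, _ | ⟨b, w⟩⟩
  · simp [letterCochain]
  · simp only [splitSum_cons, splitSum_nil, letterCochain, B.barDiff_cons, B.barDiff_nil,
      DGAlgebra.mulHead, hlin]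
    simp only [mul_zero, zero_mul, zero_add, add_zero]
    exact ZModModule.add_self _
  · rcases w with _ | ⟨c, w⟩
    · simp only [splitSum_cons, splitSum_nil, letterCochain, B.barDiff_cons, B.barDiff_nil,
        DGAlgebra.mulHead, hlin, hz]
      simp only [mul_zero, zero_add, add_zero, map_zero]
      exact ZModModule.add_self _
    · rw [splitSum_eq_zero]
      · rw [B.barDiff_cons, B.barDiff_cons, B.barDiff_cons,
          show B.barDiff (fun v => letterCochain B (a :: b :: c :: v)) w = 0 from
            h2 _ _ fun v => rfl]
        simp only [letterCochain, DGAlgebra.mulHead, hz]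
        cases w with
        | nil => simp
        | cons e w => simp
      · rintro (_ | ⟨u, _ | ⟨u', us⟩⟩) v huv
        · simp [letterCochain]
        · obtain rfl : v = b :: c :: w := (List.cons.inj huv).2
          simp [letterCochain]
        · simp [letterCochain]

/-- A functional on the dual of the algebra as an element of the algebra. -/
def dualElt : (B.gen → ZMod 2) →+ B.carrier where
  toFun h := ∑ a, h a • B.basis a
  map_zero' := by simp
  map_add' h h' := by simp only [Pi.add_apply, add_smul, Finset.sum_add_distrib]

theorem repr_dualElt (h : B.gen → ZMod 2) (a : B.gen) :
    B.basis.repr (dualElt B h) a = h a :=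
  B.repr_sum_smul _ _

theorem dualElt_injective : Function.Injective (dualElt B) := by
  intro h h' hh
  funext a
  rw [← repr_dualElt B h, ← repr_dualElt B h', hh]

theorem dualElt_act (as bs : List B.gen) (h : B.gen → ZMod 2) :
    dualElt B (fun p => ∑ q : B.gen, (AAData.ofAlgebra B).dual.m as p bs q * h q)
      = twistedAct B.d.toAddMonoidHom (letterCochain B) as bs (dualElt B h) := by
  have hb : ∀ a b, B.basis.repr (B.basis a) b = kron a b := by
    intro a b
    classical
    rw [B.basis.repr_self, Finsupp.single_apply, kron]
  refine B.ext_repr fun c => ?_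
  rw [repr_dualElt]
  change ∑ q : B.gen, (AAData.ofAlgebra B).m bs q as c * h q = _
  rcases as with _ | ⟨a, _ | ⟨a', as⟩⟩
  · rcases bs with _ | ⟨b, _ | ⟨b', bs⟩⟩
    · simp [twistedAct, letterCochain, B.repr_d, repr_dualElt, AAData.ofAlgebra, mul_comm]
    · simp only [twistedAct, letterCochain, nilPart_nil, nilPart_cons, zero_add, B.repr_mul,
        repr_dualElt, hb, mul_assoc, ← Finset.mul_sum, sum_kron_mul]
      simp [AAData.ofAlgebra, mul_comm]
    · simp [twistedAct, letterCochain, AAData.ofAlgebra]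
  · rcases bs with _ | ⟨b, bs⟩
    · simp only [twistedAct, letterCochain, nilPart_nil, nilPart_cons, zero_add, add_zero,
        B.repr_mul, repr_dualElt, hb, mul_assoc, ← Finset.mul_sum, sum_kron_mul]
      simp [AAData.ofAlgebra, mul_comm]
    · rcases bs with _ | ⟨b', bs⟩ <;> simp [twistedAct, AAData.ofAlgebra]
  · rcases bs with _ | ⟨b, _ | ⟨b', bs⟩⟩ <;> simp [twistedAct, letterCochain, AAData.ofAlgebra]

theorem dual_ofAlgebra_isBimodule : (AAData.ofAlgebra B).dual.IsBimodule := by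
  refine ⟨?_, structure_of_twisting B.leibniz B.d_d (letterCochain_isTwisting B) (dualElt B)
    (dualElt_injective B) (dualElt_act B)⟩
  intro as p bs q hne
  change StringFrom B.l B.r (B.r q) as (B.r p) ∧ StringFrom B.l B.r (B.l p) bs (B.l q)
  change (AAData.ofAlgebra B).m bs q as p ≠ 0 at hne
  rcases as with _ | ⟨a, _ | ⟨a', as⟩⟩
  · rcases bs with _ | ⟨b, _ | ⟨b', bs⟩⟩
    · obtain ⟨h1, h2⟩ := B.dCoeff_ne_zero hne
      exact ⟨h2, h1.symm⟩
    · obtain ⟨h1, h2, h3⟩ := B.mulCoeff_ne_zero hne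
      exact ⟨h3, h1, h2⟩
    · exact absurd rfl hne
  · rcases bs with _ | ⟨b, _ | ⟨b', bs⟩⟩
    · obtain ⟨h1, h2, h3⟩ := B.mulCoeff_ne_zero hne
      exact ⟨⟨h2.symm, h3⟩, h1.symm⟩
    · exact absurd rfl hne
    · exact absurd rfl hne
  · rcases bs with _ | ⟨b, _ | ⟨b', bs⟩⟩ <;> exact absurd rfl hne

end DualAlgebra

/-! ### Sums over words of bounded length -/

section Words

variable {G : Type*} [Fintype G] {V : Type*} [AddCommMonoid V]

/-- The finite set of words of bounded length. -/
def wordsLE (G : Type*) [Fintype G] (N : ℕ) : Finset (List G) := by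
  classical exact (Finset.range (N + 1)).biUnion (words G)

theorem mem_wordsLE {N : ℕ} {w : List G} : w ∈ wordsLE G N ↔ w.length ≤ N := by
  classical
  simp [wordsLE, mem_words]

theorem sum_wordsLE (N : ℕ) (F : List G → V) :
    ∑ w ∈ wordsLE G N, F w = ∑ n ∈ Finset.range (N + 1), wordSum n F := by
  classical
  rw [wordsLE, Finset.sum_biUnion]
  · rfl
  · intro i _ j _ hij
    rw [Function.onFun, Finset.disjoint_left]
    intro w hi hj
    rw [mem_words] at hi hj
    exact hij (hi.symm.trans hj)

theorem finsum_eq_sum_wordsLE {F : List G → V} {N : ℕ} (h : ∀ w, N < w.length → F w = 0) :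
    ∑ᶠ w, F w = ∑ w ∈ wordsLE G N, F w := by
  rw [sum_wordsLE, finsum_eq_sum_wordSum h]

theorem sum_wordsLE_succ (N : ℕ) (F : List G → V) :
    ∑ w ∈ wordsLE G (N + 1), F w = F [] + ∑ a, ∑ w ∈ wordsLE G N, F (a :: w) := by
  simp only [sum_wordsLE]
  rw [Finset.sum_range_succ', Finset.sum_comm, add_comm]
  simp only [wordSum_zero, wordSum_succ]

/-- Concatenation matches pairs of words with words carrying a cut; the vanishing hypotheses dispose
of the cut words whose pieces are too long. -/
theorem sum_wordsLE_splitSum (m n : ℕ) (φ : List G → List G → V)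
    (hm : ∀ u v, m < u.length → φ u v = 0) (hn : ∀ u v, n < v.length → φ u v = 0) :
    ∑ w ∈ wordsLE G (m + n), splitSum w φ = ∑ u ∈ wordsLE G m, ∑ v ∈ wordsLE G n, φ u v := by
  simp only [splitSum]
  rw [Finset.sum_sigma', ← Finset.sum_product']
  symm
  refine Finset.sum_of_injOn (fun p => ⟨p.1 ++ p.2, p.1.length⟩) ?_ ?_ ?_ ?_
  · rintro ⟨u, v⟩ - ⟨u', v'⟩ - h
    obtain ⟨h1, h2⟩ := Sigma.mk.inj h
    obtain ⟨rfl, rfl⟩ := List.append_inj h1 (eq_of_heq h2)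
    rfl
  · rintro ⟨u, v⟩ h
    simp only [Finset.coe_product, Set.mem_prod, Finset.mem_coe, mem_wordsLE] at h
    simp only [Finset.coe_sigma, Set.mem_sigma_iff, Finset.mem_coe, mem_wordsLE,
      Finset.mem_range, List.length_append]
    omega
  · rintro ⟨w, s⟩ hs hne
    simp only [Finset.mem_sigma, Finset.mem_range] at hs
    by_contra h0
    refine hne ⟨(w.take s, w.drop s), ?_, ?_⟩
    · simp only [Finset.coe_product, Set.mem_prod, Finset.mem_coe, mem_wordsLE]
      refine ⟨?_, ?_⟩
      · by_contra h
        exact h0 (hm _ _ (not_le.1 h))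
      · by_contra h
        exact h0 (hn _ _ (not_le.1 h))
    · have : (w.take s).length = s := by
        rw [List.length_take]
        omega
      simp only [List.take_append_drop, this]
  · rintro ⟨u, v⟩ _
    simp

end Words

/-- A function of the head and the tail of a word, zero on the empty word. -/
def onCons {G V : Type*} [Zero V] (w : List G) (f : G → List G → V) : V :=
  match w with
  | [] => 0
  | a :: w => f a w

@[simp] theorem onCons_nil {G V : Type*} [Zero V] (f : G → List G → V) : onCons [] f = 0 := rfl

@[simp] theorem onCons_cons {G V : Type*} [Zero V] (a : G) (w : List G) (f : G → List G → V) :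
    onCons (a :: w) f = f a w := rfl

/-! ### The join map of `X ⊠ M` -/

namespace ADData

variable {κ ι : Type} [Fintype κ] [Fintype ι] {B : DGAlgebra κ} {A : DGAlgebra ι}
  (X : ADData B A)

/-- The matrix of a component of the structure map. -/
def deltaMat (bs : List B.gen) (a : A.gen) : Matrix X.gen X.gen (ZMod 2) :=
  fun y x => X.δ bs x y a

/-- The matrix of a component of the iterated structure map. -/
def deltaBarMat (bs : List B.gen) (as : List A.gen) : Matrix X.gen X.gen (ZMod 2) :=
  fun y x => X.deltaBar bs x y as

theorem nilPart_deltaBarMat_mul (bs : List B.gen) (M : Matrix X.gen X.gen (ZMod 2)) :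
    X.deltaBarMat bs [] * M = nilPart bs M := by
  ext y x
  rw [Matrix.mul_apply]
  cases bs with
  | nil => simp [deltaBarMat, deltaBar_nil, sum_kron_mul']
  | cons b bs => simp [deltaBarMat, deltaBar_nil]

theorem deltaBarMat_cons (bs : List B.gen) (a : A.gen) (as : List A.gen) :
    X.deltaBarMat bs (a :: as)
      = splitSum (V := Matrix X.gen X.gen (ZMod 2)) bs fun u v =>
        X.deltaMat u a * X.deltaBarMat v as := by
  ext y x
  change X.deltaBar bs x y (a :: as) = _
  rw [deltaBar_cons, splitSum, splitSum, Matrix.sum_apply]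
  refine Finset.sum_congr rfl fun s _ => ?_
  rw [Matrix.mul_apply]
  exact Finset.sum_congr rfl fun n _ => mul_comm _ _

/-- In the iterated structure map on a word with a marked letter, the marked letter is consumed
in exactly one of the outputs. -/
theorem deltaBarMat_append_cons (bs' : List B.gen) (c : B.gen) (bs : List B.gen)
    (W : List A.gen) :
    X.deltaBarMat (bs' ++ c :: bs) W
      = splitSum (V := Matrix X.gen X.gen (ZMod 2)) W fun u v => onCons v fun a w =>
          splitSum bs' fun b₁ b₂ => splitSum bs fun b₃ b₄ =>
            X.deltaBarMat b₁ u * X.deltaMat (b₂ ++ c :: b₃) a * X.deltaBarMat b₄ w := by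
  induction W generalizing bs' with
  | nil =>
    ext y x
    have : nilPart (bs' ++ c :: bs) (kron x y) = 0 := by cases bs' <;> rfl
    simp [deltaBarMat, deltaBar_nil, this]
  | cons a W ih =>
    -- The inputs of the first output `a` end after or before the marked letter: either `a` consumes
    -- `c`, or `c` is left to the induction hypothesis.
    rw [deltaBarMat_cons, splitSum_append_cons, splitSum_cons, add_comm]
    congr 1
    · simp only [onCons_cons, nilPart_deltaBarMat_mul, nilPart_mul, splitSum_nilPart_const,
        splitSum_nilPart_left]
    · simp only [ih, mul_splitSum]
      rw [splitSum_comm]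
      refine splitSum_congr fun u v _ => ?_
      cases v with
      | nil => simp
      | cons a' w =>
        simp only [onCons_cons, mul_splitSum, deltaBarMat_cons, splitSum_mul]
        rw [← splitSum_assoc bs' fun p q b₂ => splitSum bs fun b₃ b₄ =>
          X.deltaMat p a * (X.deltaBarMat q u * X.deltaMat (b₂ ++ c :: b₃) a'
            * X.deltaBarMat b₄ w)]
        refine splitSum_congr fun b₁ b₂ _ => ?_
        rw [splitSum_comm]
        simp only [mul_assoc]

variable {X}

theorem conjExtend_joinMor (hX : X.IsBimodule) (as bs : List B.gen) (c : B.gen) (x : X.gen)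
    (a : A.gen) (y : X.gen) :
    X.conjExtend (fun p => X.joinMor as p bs c) x a y = X.deltaMat (bs ++ c :: as) a y x := by
  rw [← repr_conjMat, conjMat_joinMor hX, repr_mat]
  rfl

/-- Makes the bound uniform over all input words of length at most `k`; the sum of the bounds for
the individual lengths serves as a common one. -/
theorem exists_word_bound {M : LeftData A} (h : X.BoxLeftDefined M) (k : ℕ) :
    ∃ N : ℕ, (∀ bs x y as, bs.length ≤ k → N < as.length → X.deltaBar bs x y as = 0) ∨
      ∀ as p q, N < as.length → M.m as p q = 0 := by
  rcases h with h | ⟨N, h⟩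
  · choose f hf using h
    refine ⟨∑ j ∈ Finset.range (k + 1), f j, Or.inl fun bs x y as hbs has => ?_⟩
    refine hf bs.length bs x y as rfl (lt_of_le_of_lt ?_ has)
    exact Finset.single_le_sum (f := f) (fun _ _ => Nat.zero_le _)
      (Finset.mem_range.2 (Nat.lt_succ_of_le hbs))
  · exact ⟨N, Or.inr h⟩

theorem mul_mul_entry {n : Type} [Fintype n] (P Q R : Matrix n n (ZMod 2)) (y x : n) :
    (P * Q * R) y x = ∑ x₁, ∑ y₁, P y y₁ * Q y₁ x₁ * R x₁ x := by
  simp only [Matrix.mul_apply, Finset.sum_mul]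

theorem sum_comm_pairs {S T U W V : Type*} [AddCommMonoid V] (s : Finset S) (t : Finset T)
    (u : Finset U) (w : Finset W) (f : S → T → U → W → V) :
    ∑ a ∈ s, ∑ b ∈ t, ∑ c ∈ u, ∑ d ∈ w, f a b c d
      = ∑ c ∈ u, ∑ d ∈ w, ∑ a ∈ s, ∑ b ∈ t, f a b c d := by
  rw [← Finset.sum_product' s t, ← Finset.sum_product' u w]
  simp only [← Finset.sum_product' u w, ← Finset.sum_product' s t]
  exact Finset.sum_comm

/-- No homotopy is needed. Every contributing output word has the form `u ++ a :: w`, with `a` the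
output consuming `c`, and the value of `M` on such a word is a coefficient of `∇_M` evaluated on
`a`. -/
theorem nablaBox_eq (hX : X.IsBimodule) {M : LeftData A} (hM : X.BoxLeftDefined M) :
    X.nablaBox M = AAData.comp X.joinMor (X.conjMor M.nabla) := by
  funext as g bs c
  revert c
  intro (c : B.gen)
  let x : X.gen := g.1.1.1.1
  let p : M.gen := g.1.1.1.2.1.1
  let q : M.gen := g.1.1.1.2.1.2
  let y : X.gen := g.1.2
  obtain ⟨N, hN⟩ := exists_word_bound hM (bs ++ c :: as).length
  have hz₁ : ∀ v x₁ (a : A.gen) w w', v.length ≤ as.length → N < w.length →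
      X.deltaBar v x x₁ w * M.m (w' ++ a :: w) p q = 0 := by
    intro v x₁ a w w' hv hw
    rcases hN with hN | hN
    · rw [hN v _ _ _ (by simp; omega) hw, zero_mul]
    · rw [hN _ _ _ (by simp; omega), mul_zero]
  have hz₂ : ∀ v' y₁ w', v'.length ≤ bs.length → N < w'.length →
      (∀ (a : A.gen) w, M.m (w' ++ a :: w) p q = 0) ∨ X.deltaBar v' y₁ y w' = 0 := by
    intro v' y₁ w' hv hw
    rcases hN with hN | hN
    · exact Or.inr (hN v' _ _ _ (by simp; omega) hw)
    · exact Or.inl fun a w => hN _ _ _ (by simp; omega)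
  have hlen : ∀ {G : Type} {u v w : List G}, u ++ v = w → u.length ≤ w.length
      ∧ v.length ≤ w.length := by
    rintro G u v w rfl
    simp
  -- The common summand: `X^∨` produces `u` from `b₁`, `φ_X` produces `a` from `b₂, c, b₃`, and `X`
  -- produces `w` from `b₄`.
  let E : List A.gen → A.gen → List A.gen → ZMod 2 := fun u a w =>
    splitSum bs fun b₁ b₂ => splitSum as fun b₃ b₄ =>
      (X.deltaBarMat b₁ u * X.deltaMat (b₂ ++ c :: b₃) a * X.deltaBarMat b₄ w) y x
        * M.m (u ++ a :: w) p q
  have hE : ∀ u a w, N < u.length ∨ N < w.length → E u a w = 0 := by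
    intro u a w h
    refine splitSum_eq_zero fun b₁ b₂ hb => splitSum_eq_zero fun b₃ b₄ hb' => ?_
    rw [mul_mul_entry, Finset.sum_mul]
    refine Finset.sum_eq_zero fun x₁ _ => ?_
    rw [Finset.sum_mul]
    refine Finset.sum_eq_zero fun y₁ _ => ?_
    simp only [deltaBarMat]
    rcases h with h | h
    · rcases hz₂ b₁ y₁ u (hlen hb).1 h with h0 | h0
      · rw [h0, mul_zero]
      · simp [h0]
    · rw [mul_assoc, hz₁ _ _ _ _ _ (hlen hb').2 h, mul_zero]
  have hleft : X.nablaBox M as g bs c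
      = ∑ u ∈ wordsLE A.gen N, ∑ a, ∑ w ∈ wordsLE A.gen N, E u a w := by
    change ∑ᶠ W : List A.gen, X.deltaBar (bs ++ c :: as) x y W * M.m W p q = _
    -- At most `N` letters on either side of the marked output, plus that output.
    rw [finsum_eq_sum_wordsLE (N := N + (N + 1))]
    · have h1 : ∀ W, X.deltaBar (bs ++ c :: as) x y W * M.m W p q
          = splitSum W fun u v => onCons v fun a w => E u a w := by
        intro W
        have h2 := congrFun (congrFun (X.deltaBarMat_append_cons bs c as W) y) x
        rw [splitSum, Matrix.sum_apply] at h2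
        change X.deltaBarMat (bs ++ c :: as) W y x * _ = _
        rw [h2, Finset.sum_mul]
        refine splitSum_congr (φ := fun u v => (onCons v fun a w => splitSum bs fun b₁ b₂ =>
          splitSum as fun b₃ b₄ => X.deltaBarMat b₁ u * X.deltaMat (b₂ ++ c :: b₃) a
            * X.deltaBarMat b₄ w : Matrix X.gen X.gen (ZMod 2)) y x * M.m W p q) fun u v huv => ?_
        cases v with
        | nil => simp
        | cons a w =>
          subst huv
          simp only [onCons_cons, E, splitSum, Matrix.sum_apply, Finset.sum_mul]
      rw [Finset.sum_congr rfl fun W _ => h1 W, sum_wordsLE_splitSum]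
      · refine Finset.sum_congr rfl fun u _ => ?_
        rw [sum_wordsLE_succ]
        simp only [onCons_nil, onCons_cons, zero_add]
      · rintro u (_ | ⟨a, w⟩) hu
        · rfl
        · exact hE _ _ _ (Or.inl hu)
      · rintro u (_ | ⟨a, w⟩) hu
        · rfl
        · exact hE _ _ _ (Or.inr (Nat.lt_of_succ_lt_succ hu))
    · intro W hW
      rcases hN with hN | hN
      · rw [hN _ _ _ _ le_rfl (by omega), zero_mul]
      · rw [hN _ _ _ (by omega), mul_zero]
  let Gf : List B.gen → List B.gen → X.gen → A.gen → X.gen → ZMod 2 := fun v u' x₁ a y₁ =>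
    ∑ w' ∈ wordsLE A.gen N, (∑ w ∈ wordsLE A.gen N,
      X.deltaBar v x x₁ w * M.m (w' ++ a :: w) p q) * X.deltaBar u' y₁ y w'
  have hconj : ∀ v u' n, v.length ≤ as.length → u'.length ≤ bs.length →
      X.conjMor M.nabla v g u' n = Gf v u' (X.conjX n) (X.conjA n) (X.conjY n) := by
    intro v u' n hv hu'
    change ∑ᶠ w' : List A.gen, (∑ᶠ w : List A.gen, X.deltaBar v x (X.conjX n) w
      * M.m (w' ++ X.conjA n :: w) p q) * X.dual.deltaBar y u' w' (X.conjY n) = _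
    simp only [dual_deltaBar]
    rw [finsum_eq_sum_wordsLE (N := N)]
    · refine Finset.sum_congr rfl fun w' _ => ?_
      rw [finsum_eq_sum_wordsLE (N := N) fun w hw => hz₁ _ _ _ _ _ hv hw]
    · intro w' hw'
      rcases hz₂ u' (X.conjY n) w' hu' hw' with h0 | h0
      · simp only [h0, mul_zero, finsum_zero, zero_mul]
      · rw [h0, mul_zero]
  have hG : ∀ v u' u v', ∑ x₁, ∑ a, ∑ y₁, Gf v u' x₁ a y₁ * X.deltaMat (v' ++ c :: u) a y₁ x₁
      = ∑ w' ∈ wordsLE A.gen N, ∑ a, ∑ w ∈ wordsLE A.gen N,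
        (X.deltaBarMat u' w' * X.deltaMat (v' ++ c :: u) a * X.deltaBarMat v w) y x
          * M.m (w' ++ a :: w) p q := by
    intro v u' u v'
    simp only [Gf, mul_mul_entry, Finset.sum_mul]
    rw [Finset.sum_comm, Finset.sum_comm (s := wordsLE A.gen N)]
    refine Finset.sum_congr rfl fun a _ => ?_
    rw [sum_comm_pairs]
    refine Finset.sum_congr rfl fun w' _ => Finset.sum_congr rfl fun w _ =>
      Finset.sum_congr rfl fun x₁ _ => Finset.sum_congr rfl fun y₁ _ => ?_
    simp only [deltaBarMat]
    ring
  rw [hleft]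
  refine Eq.trans ?_ (AAData.comp_eq (R := (AAData.ofAlgebra B).dual) X.joinMor
    (X.conjMor M.nabla) as g bs c).symm
  simp only [← splitSum_sum]
  have hright : ∀ u v u' v', u ++ v = as → u' ++ v' = bs →
      ∑ n, X.conjMor M.nabla v g u' n * X.joinMor u n v' c
        = ∑ w' ∈ wordsLE A.gen N, ∑ a, ∑ w ∈ wordsLE A.gen N,
        (X.deltaBarMat u' w' * X.deltaMat (v' ++ c :: u) a * X.deltaBarMat v w) y x
          * M.m (w' ++ a :: w) p q := by
    intro u v u' v' h h'
    rw [Finset.sum_congr rfl fun n _ => by rw [hconj v u' n (hlen h).2 (hlen h').1],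
      X.sum_conj_mul (Gf v u') fun n => X.joinMor u n v' c]
    simp only [conjExtend_joinMor hX]
    exact hG v u' u v'
  refine Eq.trans ?_ (splitSum_congr fun u v h => splitSum_congr fun u' v' h' =>
    (hright u v u' v' h h').symm)
  simp only [E, splitSum_sum]
  refine Finset.sum_congr rfl fun w' _ => Finset.sum_congr rfl fun a _ =>
    Finset.sum_congr rfl fun w _ => splitSum_comm _ _ _

end ADData

/-! ### Insertions into words of operators -/

section Insertion

variable {G R : Type*} [Ring R]

/-- The product of the operators assigned to the letters of a word. -/
def wordProd (ρ : G → R) (w : List G) : R := (w.map ρ).prod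

@[simp] theorem wordProd_nil (ρ : G → R) : wordProd ρ [] = 1 := rfl

@[simp] theorem wordProd_cons (ρ : G → R) (a : G) (w : List G) :
    wordProd ρ (a :: w) = ρ a * wordProd ρ w := by simp [wordProd]

theorem wordProd_append (ρ : G → R) (u v : List G) :
    wordProd ρ (u ++ v) = wordProd ρ u * wordProd ρ v := by simp [wordProd]

/-- The sum over the letters of a word of the products in which the operator of that letter is
replaced by the value of `k`. -/
def insertion (ρ k : G → R) (w : List G) : R :=
  splitSum w fun u v => onCons v fun c v => wordProd ρ u * k c * wordProd ρ v

@[simp] theorem insertion_nil (ρ k : G → R) : insertion ρ k [] = 0 := by simp [insertion]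

theorem insertion_cons (ρ k : G → R) (a : G) (w : List G) :
    insertion ρ k (a :: w) = k a * wordProd ρ w + ρ a * insertion ρ k w := by
  rw [insertion, splitSum_cons, insertion, mul_splitSum]
  simp only [onCons_cons, wordProd_nil, one_mul]
  congr 1
  refine splitSum_congr fun u v _ => ?_
  cases v <;> simp [mul_assoc]

/-- Insertion is a derivation over the word product: the replaced letter lies in one of the two
parts. -/
theorem insertion_append (ρ k : G → R) (u v : List G) :
    insertion ρ k (u ++ v)
      = insertion ρ k u * wordProd ρ v + wordProd ρ u * insertion ρ k v := by
  induction u with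
  | nil => simp
  | cons a u ih =>
    rw [List.cons_append, insertion_cons, ih, insertion_cons, wordProd_append, wordProd_cons]
    noncomm_ring

/-- Beyond length `2 * N + 1`, one of the two words around the replaced letter is longer than `N`.
-/
theorem insertion_eq_zero {ρ : G → R} (k : G → R) {N : ℕ}
    (h : ∀ w, N < w.length → wordProd ρ w = 0) {w : List G} (hw : 2 * N + 1 < w.length) :
    insertion ρ k w = 0 := by
  refine splitSum_eq_zero fun u v huv => ?_
  cases v with
  | nil => rfl
  | cons c v =>
    rw [onCons_cons]
    subst huv
    simp only [List.length_append, List.length_cons] at hw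
    by_cases hu : N < u.length
    · rw [h u hu, zero_mul, zero_mul]
    · rw [h v (by omega), mul_zero]

theorem insertion_add (ρ k k' : G → R) (w : List G) :
    insertion ρ (fun c => k c + k' c) w = insertion ρ k w + insertion ρ k' w := by
  rw [insertion, insertion, insertion, ← splitSum_add]
  refine splitSum_congr fun u v _ => ?_
  cases v <;> simp [mul_add, add_mul]

variable {ι : Type} [Fintype ι] (A : DGAlgebra ι) [Module (ZMod 2) R]

/-- The linear part of the curvature of a family of operators. -/
def curvatureD (ρ : A.gen → R) (c : A.gen) : R := ∑ a, A.dCoeff a c • ρ a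

/-- The quadratic part of the curvature of a family of operators. -/
def curvatureMul (ρ : A.gen → R) (c : A.gen) : R :=
  ∑ a, ∑ b, A.mulCoeff a b c • (ρ a * ρ b)

variable {V T : Type*} [AddCommGroup V] [Module (ZMod 2) V] [AddCommGroup T]

theorem biadditive_smul (τ : R →+ V →+ T) (k : ZMod 2) (x : R) (y : V) :
    τ x (k • y) = τ (k • x) y := by
  obtain rfl | rfl : k = 0 ∨ k = 1 := by revert k; decide
  · simp
  · simp

/-- Summation by parts: moving the bar differential onto the word product replaces one operator by
its curvature. Multiplying two letters shortens the word, hence the smaller range for the quadratic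
part. -/
theorem sum_barDiff_wordProd (ρ : A.gen → R) (τ : R →+ V →+ T) (F : List A.gen → V) (n : ℕ) :
    ∑ w ∈ wordsLE A.gen (n + 1), τ (wordProd ρ w) (A.barDiff F w)
      = ∑ w ∈ wordsLE A.gen (n + 1), τ (insertion ρ (curvatureD A ρ) w) (F w)
        + ∑ w ∈ wordsLE A.gen n, τ (insertion ρ (curvatureMul A ρ) w) (F w) := by
  have hI : ∀ (τ : R →+ V →+ T) (F : List A.gen → V) w,
      ∑ a, τ (ρ a * wordProd ρ w) (A.lin (fun c => F (c :: w)) (A.d (A.basis a)))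
        = ∑ c, τ (curvatureD A ρ c * wordProd ρ w) (F (c :: w)) := by
    intro τ F w
    have hs : ∀ (k : ZMod 2) (x : R), k • x * wordProd ρ w = k • (x * wordProd ρ w) := by
      intro k x
      obtain rfl | rfl : k = 0 ∨ k = 1 := by revert k; decide
      · simp
      · simp
    simp only [DGAlgebra.lin_eq, map_sum, biadditive_smul, curvatureD, Finset.sum_mul, hs,
      AddMonoidHom.finsetSum_apply]
    exact Finset.sum_comm
  have hII : ∀ (τ : R →+ V →+ T) (F : List A.gen → V) w,
      ∑ a, ∑ b, τ (ρ a * (ρ b * wordProd ρ w))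
          (A.lin (fun c => F (c :: w)) (A.basis a * A.basis b))
        = ∑ c, τ (curvatureMul A ρ c * wordProd ρ w) (F (c :: w)) := by
    intro τ F w
    have hs : ∀ (k : ZMod 2) (x : R), k • x * wordProd ρ w = k • (x * wordProd ρ w) := by
      intro k x
      obtain rfl | rfl : k = 0 ∨ k = 1 := by revert k; decide
      · simp
      · simp
    simp only [DGAlgebra.lin_eq, map_sum, biadditive_smul, curvatureMul, Finset.sum_mul, hs,
      AddMonoidHom.finsetSum_apply, mul_assoc]
    rw [Finset.sum_congr rfl fun a _ => Finset.sum_comm, Finset.sum_comm]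
    rfl
  have h0 : wordsLE A.gen 0 = {[]} := by
    ext w
    simp [mem_wordsLE]
  induction n generalizing τ F with
  | zero =>
    simp only [sum_wordsLE_succ, h0, Finset.sum_singleton, A.barDiff_cons, insertion_cons,
      wordProd_cons, insertion_nil, A.barDiff_nil, DGAlgebra.mulHead, map_zero, AddMonoidHom.zero_apply, mul_zero, add_zero,
      zero_add]
    exact hI τ F []
  | succ n ih =>
    have h3 : ∀ a, ∑ w ∈ wordsLE A.gen (n + 1), τ (ρ a * wordProd ρ w)
        (A.barDiff (fun w => F (a :: w)) w) = _ := fun a =>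
      ih (τ.comp (AddMonoidHom.mulLeft (ρ a))) fun w => F (a :: w)
    have h2 : ∑ a, ∑ w ∈ wordsLE A.gen (n + 1), τ (ρ a * wordProd ρ w) (A.mulHead F a w)
        = ∑ c, ∑ w ∈ wordsLE A.gen n, τ (curvatureMul A ρ c * wordProd ρ w) (F (c :: w)) := by
      simp only [sum_wordsLE_succ n, DGAlgebra.mulHead, map_zero, zero_add, wordProd_cons]
      rw [Finset.sum_congr rfl fun a _ => Finset.sum_comm, Finset.sum_comm,
        Finset.sum_congr rfl fun w _ => hII τ F w, Finset.sum_comm]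
    have h1 : ∑ a, ∑ w ∈ wordsLE A.gen (n + 1), τ (ρ a * wordProd ρ w)
          (A.lin (fun c => F (c :: w)) (A.d (A.basis a)))
        = ∑ c, ∑ w ∈ wordsLE A.gen (n + 1), τ (curvatureD A ρ c * wordProd ρ w) (F (c :: w)) := by
      rw [Finset.sum_comm, Finset.sum_congr rfl fun w _ => hI τ F w, Finset.sum_comm]
    rw [sum_wordsLE_succ (n + 1), sum_wordsLE_succ (n + 1), sum_wordsLE_succ n]
    simp only [A.barDiff_cons, insertion_cons, wordProd_cons, insertion_nil, A.barDiff_nil,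
      map_zero, AddMonoidHom.zero_apply, zero_add, map_add, AddMonoidHom.add_apply,
      Finset.sum_add_distrib, h1, h2, h3, AddMonoidHom.comp_apply, AddMonoidHom.coe_mulLeft]
    abel

end Insertion

/-! ### Matrices over tensor products -/

section Tens

variable {m n : Type} {R : Type*} [AddCommGroup R] [Module (ZMod 2) R]

/-- The Kronecker product of a scalar matrix and a matrix. -/
def kronMat : Matrix m m (ZMod 2) →+ Matrix n n R →+ Matrix (m × n) (m × n) R :=
  AddMonoidHom.mk' (fun M => AddMonoidHom.mk'
    (fun H i j => M i.1 j.1 • H i.2 j.2)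
    fun H H' => by
      ext i j
      exact smul_add _ _ _)
    fun M M' => by
      ext H i j
      exact add_smul _ _ _

theorem kronMat_apply (M : Matrix m m (ZMod 2)) (H : Matrix n n R) (i j : m × n) :
    kronMat M H i j = M i.1 j.1 • H i.2 j.2 := rfl

theorem kronMat_smul (k : ZMod 2) (M : Matrix m m (ZMod 2)) (H : Matrix n n R) :
    kronMat (k • M) H = k • kronMat M H := by
  ext i j
  exact mul_smul _ _ _

theorem kronMat_mul {R : Type*} [Ring R] [Algebra (ZMod 2) R] [Fintype m] [Fintype n]
    (M M' : Matrix m m (ZMod 2)) (H H' : Matrix n n R) :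
    kronMat (M * M') (H * H') = kronMat M H * kronMat M' H' := by
  ext i j
  simp only [kronMat_apply, Matrix.mul_apply, Fintype.sum_prod_type, Finset.sum_smul,
    Finset.smul_sum, smul_mul_smul_comm]
  exact Finset.sum_comm

theorem matD_kronMat {ν : Type} [Fintype ν] (C : DGAlgebra ν) (M : Matrix m m (ZMod 2))
    (H : Matrix n n C.carrier) :
    C.matD (m × n) (m × n) (kronMat M H) = kronMat M (C.matD n n H) := by
  ext i j
  exact C.d.map_smul _ _

end Tens

section Coef

variable {ι : Type} [Fintype ι] {A : DGAlgebra ι} {n : Type}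

/-- The matrix of coefficients of a basis element in the entries of a matrix. -/
def coefMat (U : Matrix n n A.carrier) (a : A.gen) : Matrix n n (ZMod 2) :=
  fun i j => A.basis.repr (U i j) a

theorem coefMat_add (U V : Matrix n n A.carrier) (a : A.gen) :
    coefMat (U + V) a = coefMat U a + coefMat V a := by
  ext i j
  simp [coefMat]

theorem coefMat_zero (a : A.gen) : coefMat (0 : Matrix n n A.carrier) a = 0 := by
  ext i j
  simp [coefMat]

theorem coefMat_matD (U : Matrix n n A.carrier) (c : A.gen) :
    coefMat (A.matD n n U) c = ∑ a, A.dCoeff a c • coefMat U a := by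
  ext i j
  rw [Matrix.sum_apply]
  simp only [coefMat, A.matD_apply, A.repr_d, Matrix.smul_apply, smul_eq_mul, mul_comm]

theorem coefMat_mul [Fintype n] (U V : Matrix n n A.carrier) (c : A.gen) :
    coefMat (U * V) c = ∑ a, ∑ b, A.mulCoeff a b c • (coefMat U a * coefMat V b) := by
  ext i j
  simp only [Matrix.sum_apply, Matrix.smul_apply, Matrix.mul_apply, smul_eq_mul, coefMat,
    map_sum, Finsupp.coe_finsetSum, Finset.sum_apply, A.repr_mul, Finset.mul_sum]
  rw [Finset.sum_comm]
  refine Finset.sum_congr rfl fun a _ => ?_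
  rw [Finset.sum_comm]
  exact Finset.sum_congr rfl fun b _ => Finset.sum_congr rfl fun k _ => mul_comm _ _

end Coef

/-! ### First order deformations over the dual numbers -/

section DualNumbers

variable {G R : Type*}

/-- A first order deformation of a family of operators. -/
def deform (ρ u : G → R) (a : G) : DualNumber R := (ρ a, u a)

@[simp] theorem fst_deform (ρ u : G → R) (a : G) : (deform ρ u a).fst = ρ a := rfl

@[simp] theorem snd_deform (ρ u : G → R) (a : G) : (deform ρ u a).snd = u a := rfl

variable [Ring R]

theorem fst_wordProd (ρ u : G → R) (w : List G) :
    (wordProd (deform ρ u) w).fst = wordProd ρ w := by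
  induction w with
  | nil => simp
  | cons a w ih => simp [ih]

/-- Insertion is the first order variation of the word product. Identities for insertions can
therefore be read off from identities for products over the dual numbers. -/
theorem snd_wordProd (ρ u : G → R) (w : List G) :
    (wordProd (deform ρ u) w).snd = insertion ρ u w := by
  induction w with
  | nil => simp
  | cons a w ih => simp [ih, insertion_cons, fst_wordProd, add_comm]

theorem fst_insertion (ρ u k : G → R) (w : List G) :
    (insertion (deform ρ u) (deform 0 k) w).fst = 0 := by
  induction w with
  | nil => simp
  | cons a w ih => simp [ih, insertion_cons]

theorem snd_insertion (ρ u k : G → R) (w : List G) :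
    (insertion (deform ρ u) (deform 0 k) w).snd = insertion ρ k w := by
  induction w with
  | nil => simp
  | cons a w ih => simp [ih, insertion_cons, fst_insertion, fst_wordProd]

theorem wordProd_deform_eq_zero {ρ : G → R} (u : G → R) {N : ℕ}
    (h : ∀ w, N < w.length → wordProd ρ w = 0) {w : List G} (hw : 2 * N + 1 < w.length) :
    wordProd (deform ρ u) w = 0 :=
  TrivSqZeroExt.ext ((fst_wordProd ρ u w).trans (h w (by omega)))
    ((snd_wordProd ρ u w).trans (insertion_eq_zero u h hw))

end DualNumbers

/-! ### The pairing of operator families with twisting cochains -/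

section Deformation

variable {ι ν : Type} [Fintype ι] [Fintype ν] {A : DGAlgebra ι} {C : DGAlgebra ν}
  {m n : Type} [Fintype m] [DecidableEq m] [Fintype n]

/-- The curvature of `D` vanishes by `hD`, so the deformed family has only first order curvature:
the linearization of `D * D + d D` in the direction `U`. -/
theorem curvature_deform {D : Matrix m m A.carrier} (hD : D * D + A.matD m m D = 0)
    (U : Matrix m m A.carrier) (c : A.gen) :
    curvatureD A (deform (coefMat D) (coefMat U)) c
        + curvatureMul A (deform (coefMat D) (coefMat U)) c
      = deform 0 (coefMat (A.matD m m U + U * D + D * U)) c := by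
  refine TrivSqZeroExt.ext ?_ ?_
  · have h := congrArg (coefMat · c) hD
    simp only [coefMat_add, coefMat_mul, coefMat_matD, coefMat_zero] at h
    rw [fst_deform, Pi.zero_apply, ← h, add_comm]
    simp [curvatureD, curvatureMul, TrivSqZeroExt.fst_sum]
  · rw [snd_deform]
    simp only [coefMat_add, coefMat_mul, coefMat_matD]
    simp [curvatureD, curvatureMul, TrivSqZeroExt.snd_sum, Finset.sum_add_distrib, smul_add]
    abel

/-- The sum over all words of the products of two families of matrices. -/
def pairing (K : List A.gen → Matrix m m (ZMod 2)) (η : List A.gen → Matrix n n C.carrier) :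
    Matrix (m × n) (m × n) C.carrier := ∑ᶠ w, kronMat (K w) (η w)

/-- With `D` the part of `X` without inputs and `η` the cochain of `Y`, the pairing of insertions of
`U` is `U ⊠ id_Y`. The identity says that this assignment commutes with the twisted differentials.
-/
theorem pairing_insertion {D : Matrix m m A.carrier} (hD : D * D + A.matD m m D = 0)
    (U : Matrix m m A.carrier) {η : List A.gen → Matrix n n C.carrier}
    (hη : IsTwisting A (C.matD n n) η)
    (hN : ∃ N : ℕ, (∀ w, N < w.length → wordProd (coefMat D) w = 0) ∨
      ∀ w, N < w.length → η w = 0) :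
    pairing (insertion (coefMat D) (coefMat (A.matD m m U + U * D + D * U))) η
      = C.matD _ _ (pairing (insertion (coefMat D) (coefMat U)) η)
        + pairing (insertion (coefMat D) (coefMat U)) η * pairing (wordProd (coefMat D)) η
        + pairing (wordProd (coefMat D)) η * pairing (insertion (coefMat D) (coefMat U)) η := by
  obtain ⟨N, hN⟩ := hN
  set ρ := coefMat D with hρ
  set u := coefMat U with hu
  set k := coefMat (A.matD m m U + U * D + D * U) with hk
  have zP : ∀ w, 2 * N + 1 < w.length → kronMat (wordProd ρ w) (η w) = 0 := by
    intro w hw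
    rcases hN with h | h
    · rw [h w (by omega), map_zero, AddMonoidHom.zero_apply]
    · rw [h w (by omega), map_zero]
  have zI : ∀ k w, 2 * N + 1 < w.length → kronMat (insertion ρ k w) (η w) = 0 := by
    intro k w hw
    rcases hN with h | h
    · rw [insertion_eq_zero k h hw, map_zero, AddMonoidHom.zero_apply]
    · rw [h w (by omega), map_zero]
  -- Only the first order part is kept, so that summation by parts for the deformed family becomes a
  -- statement about insertions.
  let τ : DualNumber (Matrix m m (ZMod 2)) →+ Matrix n n C.carrier →+
      Matrix (m × n) (m × n) C.carrier :=
    kronMat.comp (AddMonoidHom.mk' TrivSqZeroExt.snd fun _ _ => rfl)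
  have hτ : ∀ r H, τ r H = kronMat r.snd H := fun _ _ => rfl
  -- Deformed products vanish beyond length `2 * N + 1`, so insertions into them vanish beyond `2 *
  -- (2 * N + 1) + 1`.
  obtain ⟨K, hK⟩ : ∃ K, K = 4 * N + 3 := ⟨_, rfl⟩
  have zE : ∀ k w, K < w.length → τ (insertion (deform ρ u) k w) (η w) = 0 := by
    intro k w hw
    rcases hN with h | h
    · rw [insertion_eq_zero (N := 2 * N + 1) k (fun w => wordProd_deform_eq_zero u h) (by omega),
        map_zero, AddMonoidHom.zero_apply]
    · rw [h w (by omega), map_zero]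
  have main := sum_barDiff_wordProd A (deform ρ u) τ η K
  rw [← finsum_eq_sum_wordsLE (N := K + 1) fun w hw => zE _ w (by omega),
    finsum_eq_sum_wordsLE (zE _), ← Finset.sum_add_distrib] at main
  have hR : ∑ w ∈ wordsLE A.gen K, (τ (insertion (deform ρ u)
        (curvatureD A (deform ρ u)) w) (η w) + τ (insertion (deform ρ u)
        (curvatureMul A (deform ρ u)) w) (η w)) = pairing (insertion ρ k) η := by
    rw [pairing, finsum_eq_sum_wordsLE (N := K) fun w hw => zI _ w (by omega)]
    refine Finset.sum_congr rfl fun w _ => ?_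
    rw [← AddMonoidHom.add_apply, ← map_add, ← insertion_add,
      funext fun c => curvature_deform hD U c, hτ, snd_insertion]
  rw [hR] at main
  rw [← main]
  simp only [hτ, snd_wordProd]
  -- The twisting equation trades the bar differential of `η` for `d η` and products; these yield
  -- the differential term and the two commutator terms.
  have hb : ∀ w, A.barDiff η w = C.matD n n (η w) + splitSum w fun p q => η p * η q := by
    intro w
    rw [← add_right_cancel_iff (a := A.barDiff η w), ZModModule.add_self, ← hη w]
    abel
  simp only [hb, map_add, Finset.sum_add_distrib]
  rw [add_assoc]
  congr 1
  · rw [pairing, finsum_eq_sum_wordsLE (N := K + 1) fun w hw => zI _ w (by omega), map_sum]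
    exact Finset.sum_congr rfl fun w _ => (matD_kronMat C _ _).symm
  · have h1 : ∀ w, kronMat (insertion ρ u w) (splitSum w fun p q => η p * η q)
        = splitSum w (fun p q => kronMat (insertion ρ u p) (η p) * kronMat (wordProd ρ q) (η q))
          + splitSum w fun p q =>
            kronMat (wordProd ρ p) (η p) * kronMat (insertion ρ u q) (η q) := by
      intro w
      rw [map_splitSum, ← splitSum_add]
      refine splitSum_congr fun p q hpq => ?_
      rw [← hpq, insertion_append, map_add, AddMonoidHom.add_apply, kronMat_mul, kronMat_mul]
    simp only [h1, Finset.sum_add_distrib, pairing]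
    rw [finsum_eq_sum_wordsLE (N := 2 * N + 2) fun w hw => zI _ w (by omega),
      finsum_eq_sum_wordsLE (N := 2 * N + 2) fun w hw => zP w (by omega),
      show K + 1 = (2 * N + 2) + (2 * N + 2) by omega, sum_wordsLE_splitSum,
      sum_wordsLE_splitSum]
    · simp only [Finset.sum_mul_sum]
    · intro p q hp
      rw [zP p (by omega), zero_mul]
    · intro p q hq
      rw [zI _ q (by omega), mul_zero]
    · intro p q hp
      rw [zI _ p (by omega), zero_mul]
    · intro p q hq
      rw [zP q (by omega), mul_zero]

end Deformation

/-! ### Action of algebra elements on a tensor product -/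

theorem stringFrom_left_unique {ι G : Type} {l r : G → ι} {i i' j : ι} {w : List G}
    (h : StringFrom l r i w j) (h' : StringFrom l r i' w j) : i = i' := by
  cases w with
  | nil => exact h.trans h'.symm
  | cons a w => exact h.1.symm.trans h'.1

section Support

variable {ι G n : Type} [Fintype n] [DecidableEq n] {l r : G → ι} {f : n → ι}
  {ρ k : G → Matrix n n (ZMod 2)}

theorem wordProd_support (hρ : ∀ a i j, ρ a i j ≠ 0 → f i = l a ∧ r a = f j) {w : List G} {i j : n}
    (h : wordProd ρ w i j ≠ 0) : StringFrom l r (f i) w (f j) := by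
  induction w generalizing i with
  | nil =>
    rw [wordProd_nil, Matrix.one_apply] at h
    rw [(ite_ne_right_iff.1 h).1]
    rfl
  | cons a w ih =>
    rw [wordProd_cons, Matrix.mul_apply] at h
    obtain ⟨p, -, hp⟩ := Finset.exists_ne_zero_of_sum_ne_zero h
    obtain ⟨h1, h2⟩ := hρ _ _ _ (left_ne_zero_of_mul hp)
    exact ⟨h1.symm, h2 ▸ ih (right_ne_zero_of_mul hp)⟩

theorem insertion_support (hρ : ∀ a i j, ρ a i j ≠ 0 → f i = l a ∧ r a = f j)
    (hk : ∀ a i j, k a i j ≠ 0 → f i = l a ∧ r a = f j) {w : List G} {i j : n}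
    (h : insertion ρ k w i j ≠ 0) : StringFrom l r (f i) w (f j) := by
  induction w generalizing i with
  | nil => exact absurd rfl h
  | cons a w ih =>
    rw [insertion_cons, Matrix.add_apply, Matrix.mul_apply, Matrix.mul_apply] at h
    have hadd : ∀ {a b : ZMod 2}, a + b ≠ 0 → a ≠ 0 ∨ b ≠ 0 := by decide
    rcases hadd h with h | h
    · obtain ⟨p, -, hp⟩ := Finset.exists_ne_zero_of_sum_ne_zero h
      obtain ⟨h1, h2⟩ := hk _ _ _ (left_ne_zero_of_mul hp)
      exact ⟨h1.symm, h2 ▸ wordProd_support hρ (right_ne_zero_of_mul hp)⟩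
    · obtain ⟨p, -, hp⟩ := Finset.exists_ne_zero_of_sum_ne_zero h
      obtain ⟨h1, h2⟩ := hρ _ _ _ (left_ne_zero_of_mul hp)
      exact ⟨h1.symm, h2 ▸ ih (right_ne_zero_of_mul hp)⟩

/-- Generators of `X ⊠ Y` are the composable pairs among all pairs. Restriction to them is
multiplicative when the right factor maps composable pairs to composable pairs. -/
theorem submatrix_mul_of_range {R : Type*} [NonUnitalNonAssocSemiring R] {m p : Type} [Fintype m]
    [Fintype p] {e : p → m} (he : Function.Injective e) (M N : Matrix m m R)
    (h : ∀ i j, N i (e j) ≠ 0 → i ∈ Set.range e) :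
    (M * N).submatrix e e = M.submatrix e e * N.submatrix e e := by
  ext i j
  rw [Matrix.submatrix_apply, Matrix.mul_apply, Matrix.mul_apply]
  symm
  refine Finset.sum_of_injOn e he.injOn (fun _ _ => by simp) ?_ ?_
  · intro q _ hq
    by_cases h0 : N q (e j) = 0
    · rw [h0, mul_zero]
    · obtain ⟨q, rfl⟩ := h _ _ h0
      exact absurd ⟨q, by simp, rfl⟩ hq
  · intro q _
    rfl

theorem exists_of_pairing_ne_zero {ι ν m n : Type} [Fintype ι] [Fintype ν] {A : DGAlgebra ι}
    {C : DGAlgebra ν} [Fintype m] [DecidableEq m] [Fintype n]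
    {K : List A.gen → Matrix m m (ZMod 2)}
    {η : List A.gen → Matrix n n C.carrier} {i j : m × n} (h : pairing K η i j ≠ 0) :
    ∃ w, K w i.1 j.1 ≠ 0 ∧ η w i.2 j.2 ≠ 0 := by
  classical
  by_contra! h'
  refine h ?_
  rw [pairing, finsum_def]
  split_ifs with hf
  · rw [Matrix.sum_apply]
    refine Finset.sum_eq_zero fun w _ => ?_
    rw [kronMat_apply]
    by_cases hw : K w i.1 j.1 = 0
    · rw [hw, zero_smul]
    · rw [h' w hw, smul_zero]
  · rfl

end Support

theorem insertion_sum_smul {G R : Type*} [Ring R] [Module (ZMod 2) R] {S : Type*} (s : Finset S)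
    (ρ : G → R) (c : S → ZMod 2) (k : S → G → R) (w : List G) :
    insertion ρ (fun a => ∑ i ∈ s, c i • k i a) w = ∑ i ∈ s, c i • insertion ρ (k i) w := by
  let T : (G → R) →+ R := AddMonoidHom.mk' (fun k => insertion ρ k w) fun k k' =>
    insertion_add ρ k k' w
  have h := map_sum T (fun i => c i • k i) s
  have h2 : ∀ i, T (c i • k i) = c i • T (k i) := fun i => ZMod.map_smul T _ _
  simp only [h2] at h
  refine Eq.trans ?_ h
  congr 1
  funext a
  simp

/-! ### Null-homotopic actions on `X ⊠ Y` -/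

namespace ADData

variable {κ ι ν : Type} [Fintype κ] [Fintype ι] [Fintype ν] {B : DGAlgebra κ} {A : DGAlgebra ι}
  {C : DGAlgebra ν} {X : ADData B A} {Y : ADData A C}

theorem coefMat_mat (bs : List B.gen) :
    coefMat (mat (X := X) (Z := X) X.δ bs) = X.deltaMat bs := by
  funext a
  ext y x
  exact repr_mat _ _ _ _ _

theorem deltaBarMat_nil [DecidableEq X.gen] (w : List A.gen) :
    X.deltaBarMat [] w = wordProd (X.deltaMat []) w := by
  induction w with
  | nil =>
    ext y x
    simp only [deltaBarMat, deltaBar_nil, nilPart_nil, wordProd_nil, Matrix.one_apply, kron,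
      eq_comm]
  | cons a w ih => rw [deltaBarMat_cons, splitSum_nil, ih, wordProd_cons]

/-- A single input is consumed by exactly one output; all others come from the part of `δ` without
inputs. -/
theorem deltaBarMat_singleton [DecidableEq X.gen] (b : B.gen) (w : List A.gen) :
    X.deltaBarMat [b] w = insertion (X.deltaMat []) (X.deltaMat [b]) w := by
  refine (X.deltaBarMat_append_cons [] b [] w).trans ?_
  simp only [splitSum_nil, List.nil_append, deltaBarMat_nil]
  rfl

theorem deltaMat_support (hX : X.IsBimodule) (bs : List B.gen) (a : A.gen) (y x : X.gen)
    (h : X.deltaMat bs a y x ≠ 0) : X.r y = A.l a ∧ A.r a = X.r x :=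
  (hX.1 _ _ _ _ h).2

theorem exists_box_bound [DecidableEq X.gen] (h : X.BoxDefined Y) :
    ∃ N : ℕ, (∀ w, N < w.length → wordProd (X.deltaMat []) w = 0) ∨
      ∀ w, N < w.length → mat (X := Y) (Z := Y) Y.δ w = 0 := by
  rcases h with h | ⟨N, h⟩
  · obtain ⟨N, hN⟩ := h 0
    refine ⟨N, Or.inl fun w hw => ?_⟩
    rw [← deltaBarMat_nil]
    ext y x
    exact hN [] x y w rfl hw
  · refine ⟨N, Or.inr fun w hw => ?_⟩
    ext y x
    refine C.ext_repr fun c => ?_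
    rw [repr_mat, h w x y c hw]
    simp

variable (X Y) in
/-- The components of a generator of a tensor product. -/
def boxVal (p : (X.box Y).gen) : X.gen × Y.gen := Subtype.val p

theorem mat_box_eq {N : ℕ} (bs : List B.gen)
    (hN : (∀ w, N < w.length → X.deltaBarMat bs w = 0) ∨
      ∀ w, N < w.length → mat (X := Y) (Z := Y) Y.δ w = 0) :
    mat (X := X.box Y) (Z := X.box Y) (X.box Y).δ bs
      = (pairing (X.deltaBarMat bs) (mat (X := Y) (Z := Y) Y.δ)).submatrix (X.boxVal Y)
        (X.boxVal Y) := by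
  have h1 : ∀ w, N < w.length →
      kronMat (X.deltaBarMat bs w) (mat (X := Y) (Z := Y) Y.δ w) = 0 := by
    intro w hw
    rcases hN with h | h
    · rw [h w hw, map_zero, AddMonoidHom.zero_apply]
    · rw [h w hw, map_zero]
  ext q p
  refine C.ext_repr fun c => ?_
  have h2 : ∀ w, X.deltaBar bs p.1.1 q.1.1 w * Y.δ w p.1.2 q.1.2 c
      = C.basis.repr (kronMat (X.deltaBarMat bs w) (mat (X := Y) (Z := Y) Y.δ w) (X.boxVal Y q)
        (X.boxVal Y p)) c := by
    intro w
    rw [kronMat_apply, map_smul, Finsupp.smul_apply, repr_mat]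
    rfl
  rw [repr_mat, pairing, finsum_eq_sum_wordsLE h1, Matrix.submatrix_apply, Matrix.sum_apply,
    map_sum, Finsupp.coe_finsetSum, Finset.sum_apply]
  refine (finsum_congr h2).trans (finsum_eq_sum_wordsLE fun w hw => ?_)
  rw [h1 w hw]
  simp

/-- The new null-homotopy is `U ⊠ id_Y`, by `pairing_insertion` restricted to composable pairs. -/
theorem exists_box_null_homotopy (hX : X.IsBimodule) (hY : Y.IsBimodule) (hXY : X.BoxDefined Y)
    (β : B.gen → ZMod 2) (U : Matrix X.gen X.gen A.carrier)
    (hU : ∀ a y x, coefMat U a y x ≠ 0 → X.r y = A.l a ∧ A.r a = X.r x)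
    (hβ : ∑ b, β b • mat (X := X) (Z := X) X.δ [b] = A.matD _ _ U
      + U * mat (X := X) (Z := X) X.δ [] + mat (X := X) (Z := X) X.δ [] * U) :
    ∃ V : Matrix (X.box Y).gen (X.box Y).gen C.carrier,
      ∑ b, β b • mat (X := X.box Y) (Z := X.box Y) (X.box Y).δ [b] = C.matD _ _ V
        + V * mat (X := X.box Y) (Z := X.box Y) (X.box Y).δ []
        + mat (X := X.box Y) (Z := X.box Y) (X.box Y).δ [] * V := by
  classical
  obtain ⟨N, hN⟩ := exists_box_bound hXY
  set D := mat (X := X) (Z := X) X.δ [] with hD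
  set η := mat (X := Y) (Z := Y) Y.δ with hη
  have hDD : D * D + A.matD _ _ D = 0 := by
    have h := hX.isTwisting []
    rwa [splitSum_nil, B.barDiff_nil, add_zero] at h
  have hρ : coefMat D = X.deltaMat [] := coefMat_mat []
  have hnil : ∀ w, X.deltaBarMat [] w = wordProd (coefMat D) w := fun w => by
    rw [hρ, deltaBarMat_nil]
  have hone : ∀ b w, X.deltaBarMat [b] w = insertion (coefMat D) (X.deltaMat [b]) w := fun b w => by
    rw [hρ, deltaBarMat_singleton]
  rw [← hρ] at hN
  have key := pairing_insertion hDD U hY.isTwisting ⟨N, hN⟩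
  have hN₀ : (∀ w, N < w.length → X.deltaBarMat [] w = 0) ∨
      ∀ w, N < w.length → η w = 0 := by
    simpa only [hnil] using hN
  have hN₁ : ∀ b, (∀ w, 2 * N + 1 < w.length → X.deltaBarMat [b] w = 0) ∨
      ∀ w, 2 * N + 1 < w.length → η w = 0 := by
    intro b
    rcases hN with h | h
    · exact Or.inl fun w hw => by rw [hone, insertion_eq_zero _ h hw]
    · exact Or.inr fun w hw => h w (by omega)
  have hsum : pairing (insertion (coefMat D) (coefMat (A.matD _ _ U + U * D + D * U))) η
      = ∑ b, β b • pairing (X.deltaBarMat [b]) η := by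
    have h0 : ∀ b w, 2 * N + 1 < w.length → kronMat (X.deltaBarMat [b] w) (η w) = 0 := by
      intro b w hw
      rcases hN₁ b with h | h
      · rw [h w hw, map_zero, AddMonoidHom.zero_apply]
      · rw [h w hw, map_zero]
    have h1 : ∀ w, kronMat (insertion (coefMat D) (coefMat (A.matD _ _ U + U * D + D * U)) w) (η w)
        = ∑ b, β b • kronMat (X.deltaBarMat [b] w) (η w) := by
      intro w
      have h2 : coefMat (A.matD _ _ U + U * D + D * U)
          = fun a => ∑ b, β b • X.deltaMat [b] a := by
        rw [← hβ]
        funext a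
        ext y x
        simp only [coefMat, Matrix.sum_apply, Matrix.smul_apply, map_sum, map_smul,
          Finsupp.coe_finsetSum, Finset.sum_apply, Finsupp.smul_apply, repr_mat]
        rfl
      rw [h2, insertion_sum_smul, map_sum, AddMonoidHom.finsetSum_apply]
      refine Finset.sum_congr rfl fun b _ => ?_
      rw [hone, kronMat_smul]
    simp only [pairing]
    rw [finsum_congr h1, finsum_eq_sum_wordsLE (N := 2 * N + 1), Finset.sum_comm]
    · refine Finset.sum_congr rfl fun b _ => ?_
      rw [finsum_eq_sum_wordsLE (h0 b), Finset.smul_sum]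
    · intro w hw
      exact Finset.sum_eq_zero fun b _ => by rw [h0 b w hw, smul_zero]
  -- The word determines its initial idempotent from its final one, so a nonzero entry starting at a
  -- composable pair ends at a composable pair.
  have hsupp : ∀ (K : List A.gen → Matrix X.gen X.gen (ZMod 2)),
      (∀ w y x, K w y x ≠ 0 → StringFrom A.l A.r (X.r y) w (X.r x)) →
      ∀ i j, pairing K η i (X.boxVal Y j) ≠ 0 → i ∈ Set.range (X.boxVal Y) := by
    intro K hK i j h
    obtain ⟨w, h1, h2⟩ := exists_of_pairing_ne_zero h
    obtain ⟨c, hc⟩ : ∃ c, C.basis.repr (η w i.2 (X.boxVal Y j).2) c ≠ 0 := by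
      by_contra! h0
      exact h2 (C.ext_repr fun c => by rw [h0, map_zero]; rfl)
    rw [hη, repr_mat] at hc
    have h3 := hK _ _ _ h1
    have h4 := (hY.1 _ _ _ _ hc).1
    have h5 : X.r (X.boxVal Y j).1 = Y.l (X.boxVal Y j).2 := j.2
    rw [h5] at h3
    exact ⟨⟨i, stringFrom_left_unique h3 h4⟩, rfl⟩
  refine ⟨(pairing (insertion (coefMat D) (coefMat U)) η).submatrix (X.boxVal Y) (X.boxVal Y), ?_⟩
  have hsD : ∀ a y x, coefMat D a y x ≠ 0 → X.r y = A.l a ∧ A.r a = X.r x := by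
    rw [hρ]
    exact deltaMat_support hX []
  have hm₀ := mat_box_eq [] hN₀
  rw [show X.deltaBarMat [] = wordProd (coefMat D) from funext hnil] at hm₀
  rw [hm₀, Finset.sum_congr rfl fun b _ => by rw [mat_box_eq [b] (hN₁ b)]]
  have hinj : Function.Injective (X.boxVal Y) := Subtype.val_injective
  rw [← submatrix_mul_of_range hinj _ _ (hsupp _ fun w y x => wordProd_support hsD),
    ← submatrix_mul_of_range hinj _ _ (hsupp _ fun w y x => insertion_support hsD hU)]
  rw [hsum] at key
  refine Eq.trans ?_ (congrArg (fun M => M.submatrix (X.boxVal Y) (X.boxVal Y)) key)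
  ext i j
  simp only [Matrix.sum_apply, Matrix.smul_apply, Matrix.submatrix_apply]
  rfl

end ADData

/-! ### Detecting boundaries of `B` on the identity bimodule -/

namespace ADData

variable {κ : Type} [Fintype κ] {B : DGAlgebra κ}

theorem mat_identity_nil :
    mat (X := identity B) (Z := identity B) (identity B).δ [] = 0 := by
  ext y x
  exact Finset.sum_eq_zero fun a _ => zero_smul _ _

/-- The action of an algebra element on the identity bimodule, as a matrix. -/
theorem lin_mat_identity (z : B.carrier) (y x : (identity B).gen) :
    B.lin (fun b => mat (X := identity B) (Z := identity B) (identity B).δ [b]) z y x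
      = B.e ((identity B).l y) * z * B.e ((identity B).r x) := by
  refine B.ext_repr fun c => ?_
  rw [DGAlgebra.lin_eq, Matrix.sum_apply, map_sum, Finsupp.coe_finsetSum, Finset.sum_apply,
    B.repr_mul_e, B.repr_e_mul]
  have h : ∀ b, B.basis.repr ((B.basis.repr z b
      • mat (X := identity B) (Z := identity B) (identity B).δ [b]) y x) c
      = kron b c * (B.basis.repr z b
        * (kron (B.l c) ((identity B).l y) * kron (B.r c) ((identity B).r x))) := by
    intro b
    rw [Matrix.smul_apply, map_smul, Finsupp.smul_apply, repr_mat, smul_eq_mul]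
    change B.basis.repr z b * (kron b c * kron (B.l c) ((identity B).l y)
      * kron (B.r c) ((identity B).r x)) = _
    ring
  rw [Finset.sum_congr rfl fun b _ => h b, sum_kron_mul']
  ring

theorem mat_ident_nil {Z : ADData B B} (y x : Z.gen) :
    mat (X := Z) (Z := Z) (ident Z) [] y x = kron x y • B.e (Z.r x) := by
  refine B.ext_repr fun c => ?_
  rw [repr_mat, map_smul, Finsupp.smul_apply, ident, kron_nil_nil, one_mul]
  rfl

theorem mul_mat_ident {Z : ADData B B} (M : Matrix Z.gen Z.gen B.carrier) (y x : Z.gen) :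
    (M * mat (X := Z) (Z := Z) (ident Z) []) y x = M y x * B.e (Z.r x) := by
  rw [Matrix.mul_apply, Finset.sum_eq_single x]
  · rw [mat_ident_nil, kron_self, one_smul]
  · intro t _ ht
    rw [mat_ident_nil, kron_of_ne (Ne.symm ht), zero_smul, mul_zero]
  · simp

/-- The entries are `e_y z e_x`, and the idempotents sum to `1`. -/
theorem sum_sum_mul_ident (z : B.carrier) :
    ∑ y, ∑ x, (B.lin (fun b => mat (X := identity B) (Z := identity B) (identity B).δ [b]) z
      * mat (X := identity B) (Z := identity B) (ident (identity B)) []) y x = z := by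
  simp only [mul_mat_ident, lin_mat_identity, mul_assoc]
  change ∑ y : κ, ∑ x : κ, B.e y * (z * (B.e x * B.e x)) = z
  simp only [(B.idem.idem _).eq, ← Finset.mul_sum, ← Finset.sum_mul, B.idem.complete, one_mul,
    mul_one]

theorem matD_lin_mat_identity {z : B.carrier} (hz : B.d z = 0) :
    B.matD (identity B).gen (identity B).gen
      (B.lin (fun b => mat (X := identity B) (Z := identity B) (identity B).δ [b]) z) = 0 := by
  ext y x
  rw [B.matD_apply, lin_mat_identity, B.leibniz, B.leibniz, B.d_e, B.d_e, hz]
  simp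

/-- A cycle of the algebra that acts null-homotopically on a bimodule equivalent to the identity
is a boundary. -/
theorem exists_d_eq_of_null_homotopy {Z : ADData B B} (e : Z.HomotopyEquivalent (identity B))
    {z : B.carrier} (hz : B.d z = 0) (V : Matrix Z.gen Z.gen B.carrier)
    (hV : B.lin (fun b => mat (X := Z) (Z := Z) Z.δ [b]) z = B.matD _ _ V
      + V * mat (X := Z) (Z := Z) Z.δ [] + mat (X := Z) (Z := Z) Z.δ [] * V) :
    ∃ y, B.d y = z := by
  obtain ⟨f, g, hf, hg, -, H, -, hH⟩ := e
  set Δ := mat (X := Z) (Z := Z) Z.δ [] with hΔ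
  set Zz := B.lin (fun b => mat (X := Z) (Z := Z) Z.δ [b]) z with hZz
  set Iz := B.lin (fun b => mat (X := identity B) (Z := identity B) (identity B).δ [b]) z with hIz
  set fz := B.lin (fun b => mat f [b]) z with hfz
  have two : ∀ {m n : Type} (M : Matrix m n B.carrier), M + M = 0 := fun M => ZModModule.add_self M
  have eqn : ∀ {m n : Type} {M N : Matrix m n B.carrier}, M + N = 0 → M = N := by
    intro m n M N h
    rw [← add_right_cancel_iff (a := N), h, two]
  -- The cycle equation without inputs; the identity bimodule has no operation without inputs.
  have hf₀ : mat f [] * Δ = B.matD _ _ (mat f []) := by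
    have h := mat_diff f []
    rw [hf.2, mat_zero, splitSum_nil, splitSum_nil, mat_identity_nil, Matrix.zero_mul, add_zero,
      B.barDiff_nil, add_zero] at h
    exact eqn h.symm
  have hg₀ : Δ * mat g [] = B.matD _ _ (mat g []) := by
    have h := mat_diff g []
    rw [hg.2, mat_zero, splitSum_nil, splitSum_nil, mat_identity_nil, Matrix.mul_zero, zero_add,
      B.barDiff_nil, add_zero] at h
    exact eqn h.symm
  have hH₀ : mat f [] * mat g [] + mat (ident (identity B)) [] = B.matD _ _ (mat H []) := by
    have h := mat_diff H []
    rw [hH, mat_add, mat_comp, splitSum_nil, splitSum_nil, splitSum_nil, mat_identity_nil,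
      mul_zero, zero_mul, zero_add, zero_add, B.barDiff_nil, add_zero] at h
    exact h
  -- The one-input cycle equation for `f`, weighted by the coefficients of `z`. The term with `d b`
  -- drops out because `d z = 0`.
  have hfb : mat f [] * Zz + fz * Δ + Iz * mat f [] + B.matD _ _ fz = 0 := by
    have h : ∀ b, mat f [] * mat (X := Z) (Z := Z) Z.δ [b] + mat f [b] * Δ
        + mat (X := identity B) (Z := identity B) (identity B).δ [b] * mat f []
        + B.matD _ _ (mat f [b]) + B.lin (fun c => mat f [c]) (B.d (B.basis b)) = 0 := by
      intro b
      have h := mat_diff f [b]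
      rw [hf.2, mat_zero] at h
      simp only [splitSum_cons, splitSum_nil, mat_identity_nil, Matrix.zero_mul, zero_add,
        B.barDiff_cons, B.barDiff_nil, DGAlgebra.mulHead, add_zero] at h
      rw [h]
      abel
    have h1 : ∑ b, B.basis.repr z b • (mat f [] * mat (X := Z) (Z := Z) Z.δ [b] + mat f [b] * Δ
        + mat (X := identity B) (Z := identity B) (identity B).δ [b] * mat f []
        + B.matD _ _ (mat f [b]) + B.lin (fun c => mat f [c]) (B.d (B.basis b))) = 0 :=
      Finset.sum_eq_zero fun b _ => by rw [h b, smul_zero]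
    have h2 : ∑ b, B.basis.repr z b • B.lin (fun c => mat f [c]) (B.d (B.basis b)) = 0 := by
      rw [← DGAlgebra.lin_eq, B.lin_comp, hz, map_zero]
    simp only [smul_add, Finset.sum_add_distrib, h2, add_zero] at h1
    rw [hZz, hIz, hfz]
    simp only [DGAlgebra.lin_eq, Matrix.mul_sum, Matrix.sum_mul, Matrix.mul_smul, Matrix.smul_mul,
      map_sum, ZMod.map_smul]
    exact h1
  have hI : B.matD _ _ Iz = 0 := matD_lin_mat_identity hz
  -- The null-homotopy `V` is conjugated by `f` and `g`. The other two summands correct for `f`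
  -- commuting with the action only up to `fz`, and for `f g` being the identity only up to `H`.
  have hId : Iz * mat (X := identity B) (Z := identity B) (ident (identity B)) []
      = B.matD _ _ (mat f [] * V * mat g [] + fz * mat g [] + Iz * mat H []) := by
    have h1 := congrArg (· * mat g []) hfb
    simp only [hV, Matrix.mul_add, Matrix.add_mul, Matrix.zero_mul] at h1
    have h2 : mat f [] * (V * Δ) * mat g [] = mat f [] * V * B.matD _ _ (mat g []) := by
      rw [← hg₀]
      simp only [Matrix.mul_assoc]
    have h3 : mat f [] * (Δ * V) * mat g [] = B.matD _ _ (mat f []) * V * mat g [] := by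
      rw [← hf₀]
      simp only [Matrix.mul_assoc]
    have h4 : fz * Δ * mat g [] = fz * B.matD _ _ (mat g []) := by
      rw [← hg₀, Matrix.mul_assoc]
    have h5 : Iz * mat f [] * mat g []
        = Iz * mat (ident (identity B)) [] + Iz * B.matD _ _ (mat H []) := by
      rw [← hH₀, Matrix.mul_add, Matrix.mul_assoc, add_left_comm, two, add_zero]
    rw [h2, h3, h4, h5] at h1
    simp only [map_add, B.matD_mul, hI, Matrix.zero_mul, zero_add, Matrix.add_mul]
    refine eqn ?_
    rw [← h1]
    abel
  refine ⟨∑ y, ∑ x, (mat f [] * V * mat g [] + fz * mat g [] + Iz * mat H []) y x, ?_⟩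
  rw [map_sum, ← sum_sum_mul_ident z, ← hIz, hId]
  refine Finset.sum_congr rfl fun y _ => ?_
  rw [map_sum]
  rfl

end ADData
-- Surjectivity of `φ_X` on homology
namespace ADData

variable {κ ι : Type} [Fintype κ] [Fintype ι] {B : DGAlgebra κ} {A : DGAlgebra ι}
  {X : ADData B A} {Y : ADData A B}

/-- A linear functional annihilating the kernel of a matrix factors through the matrix. -/
theorem exists_factor_of_annihilates_ker {m n : Type} [Fintype m] [Fintype n]
    (M : (n → ZMod 2) →ₗ[ZMod 2] (m → ZMod 2)) (ψ : Module.Dual (ZMod 2) (n → ZMod 2))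
    (h : ∀ c, M c = 0 → ψ c = 0) : ∃ θ : Module.Dual (ZMod 2) (m → ZMod 2), ψ = θ.comp M := by
  have h1 : ψ ∈ (LinearMap.ker M).dualAnnihilator := by
    rw [Submodule.mem_dualAnnihilator]
    exact h
  rw [← LinearMap.range_dualMap_eq_dualAnnihilator_ker] at h1
  obtain ⟨θ, hθ⟩ := h1
  exact ⟨θ, hθ.symm⟩

theorem dual_eq_sum {n : Type} [Fintype n] [DecidableEq n]
    (ψ : Module.Dual (ZMod 2) (n → ZMod 2)) (c : n → ZMod 2) :
    ψ c = ∑ i, c i * ψ (Pi.single i 1) := by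
  conv_lhs => rw [pi_eq_sum_univ' c]
  simp [map_sum]

theorem conjMat_sum_smul (β : B.gen → ZMod 2)
    (h : B.gen → (X.conj (AAData.ofAlgebra A).dual).gen → ZMod 2) :
    X.conjMat (fun p => ∑ q, β q * h q p) = ∑ q, β q • X.conjMat (h q) := by
  have h1 : (fun p => ∑ q, β q * h q p) = ∑ q, β q • h q := by
    funext p
    simp
  rw [h1, map_sum]
  exact Finset.sum_congr rfl fun q _ => ZMod.map_smul _ _ _

/-- The linear part of `joinMor` is onto in homology. -/
theorem joinMor_surjective (hX : X.IsBimodule) (hY : Y.IsBimodule) (hXY : X.BoxDefined Y)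
    (eXY : (X.box Y).HomotopyEquivalent (identity B)) (z : B.gen → ZMod 2)
    (hz : (AAData.ofAlgebra B).dual.chainD z = 0) :
    ∃ c y, (X.conj (AAData.ofAlgebra A).dual).chainD c = 0 ∧
      ∀ q, z q = ∑ p, X.joinMor [] p [] q * c p + (AAData.ofAlgebra B).dual.chainD y q := by
  classical
  let P := X.conj (AAData.ofAlgebra A).dual
  let dQ : (B.gen → ZMod 2) →ₗ[ZMod 2] (B.gen → ZMod 2) := (AAData.ofAlgebra B).dual.chainD
  have hdQ : ∀ v q, dQ v q = ∑ p, B.dCoeff q p * v p := fun v q =>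
    AAData.chainD_apply (P := (AAData.ofAlgebra B).dual) v q
  let F : (P.gen → ZMod 2) →ₗ[ZMod 2] (B.gen → ZMod 2) :=
    Matrix.mulVecLin (Matrix.of fun q p => X.joinMor [] p [] q)
  have hF : ∀ v q, F v q = ∑ p, X.joinMor [] p [] q * v p := fun v q => rfl
  suffices hmem : z ∈ (LinearMap.ker P.chainD).map F ⊔ LinearMap.range dQ by
    obtain ⟨_, ⟨c, hc, rfl⟩, _, ⟨y, rfl⟩, h⟩ := Submodule.mem_sup.1 hmem
    exact ⟨c, y, hc, fun q => (congrFun h q).symm⟩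
  by_contra hmem
  -- A functional separating `z` from the image of the cycles and the boundaries; its coefficients
  -- `β` define an element `w` of `B`.
  obtain ⟨l, hl, hle⟩ := Submodule.exists_le_ker_of_notMem hmem
  set β : B.gen → ZMod 2 := fun q => l (Pi.single q 1) with hβ
  have hlβ : ∀ v, l v = ∑ q, v q * β q := dual_eq_sum l
  set w : B.carrier := ∑ q, β q • B.basis q with hw
  have hwr : ∀ q, B.basis.repr w q = β q := B.repr_sum_smul β
  -- Vanishing on boundaries of `B^∨` means, by duality, that `w` is a cycle.
  have hdw : B.d w = 0 := by
    refine B.ext_repr fun p => ?_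
    have h1 : l (dQ (Pi.single p 1)) = 0 :=
      hle (Submodule.mem_sup_right (LinearMap.mem_range_self dQ _))
    rw [hlβ] at h1
    rw [B.repr_d, map_zero, Finsupp.zero_apply, ← h1]
    refine Finset.sum_congr rfl fun q _ => ?_
    rw [hwr, hdQ]
    simp [Pi.single_apply, mul_comm]
  -- Vanishing on the image of cycles makes the pulled-back functional factor through the
  -- differential of `X ⊠ A^∨ ⊠ X^∨`.
  obtain ⟨θ, hθ⟩ := exists_factor_of_annihilates_ker P.chainD (l.comp F) fun c hc =>
    hle (Submodule.mem_sup_left ⟨c, hc, rfl⟩)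
  have hψ : ∀ p, ∑ q, β q * X.joinMor [] p [] q = ∑ q, P.m [] p [] q * θ (Pi.single q 1) := by
    intro p
    have h1 := LinearMap.congr_fun hθ (Pi.single p 1)
    rw [LinearMap.comp_apply, LinearMap.comp_apply, hlβ, dual_eq_sum θ] at h1
    simp only [hF, AAData.chainD_apply, Pi.single_apply, mul_ite, mul_one, mul_zero,
      Finset.sum_ite_eq', Finset.mem_univ, if_true] at h1
    simpa only [mul_comm] using h1
  let u : P.gen → ZMod 2 := fun q => θ (Pi.single q 1)
  -- In matrix form: the action of `w` on `X` is the twisted differential of the matrix of `u`.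
  have hact := conjMat_act hX [] [] u
  rw [← show (fun p => ∑ q, β q * X.joinMor [] p [] q) = fun p => ∑ q, P.m [] p [] q * u q from
    funext hψ, conjMat_sum_smul β fun q p => X.joinMor [] p [] q] at hact
  simp only [conjMat_joinMor hX, List.nil_append] at hact
  obtain ⟨V, hV⟩ := exists_box_null_homotopy hX hY hXY β (X.conjMat u) (by
    intro a y x h
    rw [coefMat, repr_conjMat] at h
    obtain ⟨h1, h2⟩ := X.composable_of_conjExtend_ne_zero h
    exact ⟨h2.symm, h1.symm⟩) hact
  obtain ⟨γ, hγ⟩ := exists_d_eq_of_null_homotopy eXY hdw V (by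
    rw [DGAlgebra.lin_eq]
    simpa only [hwr] using hV)
  -- With `w = d γ`, pairing `w` with `z` equals pairing `γ` with the differential of `z`, which is
  -- zero.
  apply hl
  rw [hlβ]
  have h1 : ∀ q, z q * β q = ∑ a, B.basis.repr γ a * (B.dCoeff a q * z q) := by
    intro q
    rw [← hwr, ← hγ, B.repr_d, Finset.mul_sum]
    exact Finset.sum_congr rfl fun a _ => by ring
  rw [Finset.sum_congr rfl fun q _ => h1 q, Finset.sum_comm]
  refine Finset.sum_eq_zero fun a _ => ?_
  rw [← Finset.mul_sum, ← hdQ]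
  have h2 : dQ z = 0 := hz
  rw [h2, Pi.zero_apply, mul_zero]

end ADData

/-! ### Reflexivity of homotopy, and the conclusion -/

namespace AAData

variable {ι κ : Type} [Fintype ι] [Fintype κ] {A : DGAlgebra ι} {B : DGAlgebra κ}

theorem homotopic_refl {P Q : AAData A B} (f : Mor P Q) : Homotopic P Q f f := by
  refine ⟨0, fun as p bs q h => absurd rfl h, ?_⟩
  funext as p bs q
  have h1 : A.barDiff (fun _ => (0 : ZMod 2)) as = 0 := A.barDiff_zero as
  have h2 : B.barDiff (fun _ => (0 : ZMod 2)) bs = 0 := B.barDiff_zero bs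
  refine Eq.trans ?_ (ZModModule.add_self (f as p bs q)).symm
  rw [diff, comp, comp, A.barMu_eq, B.barMu_eq]
  simp [h1, h2]

end AAData

end Bordered

end

theorem mainTheorem9 {ι κ : Type} [Fintype ι] [Fintype κ]
    (A : Bordered.DGAlgebra ι) (B : Bordered.DGAlgebra κ)
    (X : Bordered.ADData B A) (hX : X.IsBimodule)
    (Y : Bordered.ADData A B) (hY : Y.IsBimodule)
    (hYX : Y.BoxDefined X) (hXY : X.BoxDefined Y)
    (eYX : (Y.box X).HomotopyEquivalent (Bordered.ADData.identity A))
    (eXY : (X.box Y).HomotopyEquivalent (Bordered.ADData.identity B))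
    (hrank : (Bordered.AAData.ofAlgebra B).dual.homologyRank
      = (X.conj (Bordered.AAData.ofAlgebra A).dual).homologyRank) :
    ∃ φ : Bordered.AAData.Mor (X.conj (Bordered.AAData.ofAlgebra A).dual)
        (Bordered.AAData.ofAlgebra B).dual,
      Bordered.AAData.IsHomotopyEquiv (X.conj (Bordered.AAData.ofAlgebra A).dual)
        (Bordered.AAData.ofAlgebra B).dual φ ∧
      ∀ M : Bordered.LeftData A, M.IsModule → X.BoxLeftDefined M →
        Bordered.AAData.Homotopic (X.conj M.tensDual) (Bordered.AAData.ofAlgebra B).dual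
          (X.nablaBox M)
          (Bordered.AAData.comp φ (X.conjMor M.nabla)) := by
  refine ⟨X.joinMor, Bordered.AAData.isHomotopyEquiv_of_surjective X.joinMor
    (Bordered.ADData.conj_isBimodule hX) (Bordered.dual_ofAlgebra_isBimodule B)
    (Bordered.ADData.joinMor_isHom hX) hrank
    (Bordered.ADData.joinMor_surjective hX hY hXY eXY), fun M _ hM => ?_⟩
  -- The two morphisms coincide, so the zero homotopy suffices.
  rw [← Bordered.ADData.nablaBox_eq hX hM]
  exact Bordered.AAData.homotopic_refl _
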